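/- Let $n\ge 3$ and let $c_1,\dots,c_{n-1}\in\mathbb Q$ satisfy $c_r>0$ for $1\le r\le n-2$, $c_{n-1}<0$ and $\sum_{r=1}^{n-1}c_r\neq 0$. A complex nilmanifold here is a compact quotient $M=\Gamma\backslash G$ of a simply connected nilpotent Lie group $G$ by a discrete subgroup $\Gamma$, endowed with a complex structure $J$ induced by a left-invariant complex structure on $G$. For a Hermitian metric $g$ on a complex manifold of complex dimension $n$, with fundamental form $\omega(X,Y)=g(JX,Y)$, the Lee form is the real $1$-form $\theta$ with $d\omega^{n-1}=\theta\wedge\omega^{n-1}$. The metric is balanced if $d\omega^{n-1}=0$, locally conformally balanced (lcb) if $\theta$ is closed, globally conformally balanced (gcb) if $\theta$ is exact, strictly lcb if it is lcb but not gcb, and locally conformally Kähler (lcK) if every point has a neighbourhood $U$ with a smooth $f:U\to\mathbb R$ such that $d(e^{-f}\omega)=0$ on $U$. 1. There exists a 2-step complex nilmanifold $M=\Gamma\backslash G$ of complex dimension $n$ whose Lie algebra has a left-invariant $(1,0)$-coframe $\alpha_1,\dots,\alpha_n$ with $$d\alpha_i=0\quad(1\le i\le n-1),\qquad d\alpha_n=\sum_{r=1}^{n-1}c_r\,\alpha_r\wedge\overline{\alpha}_r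 .\qquad(*)$$ 2. On every complex nilmanifold $M=\Gamma\backslash G$ of complex dimension $n$ with a left-invariant $(1,0)$-coframe satisfying $(*)$: (a) there is a left-invariant balanced Hermitian metric; (b) the left-invariant Hermitian metric with fundamental form $\omega_1=\mathrm i\sum_{i=1}^n\alpha_i\wedge\overline{\alpha}_i$ has Lee form $\theta=\big(\sum_{r=1}^{n-1}c_r\big)(\alpha_n+\overline{\alpha}_n)$, which is closed and not exact; so this metric is strictly lcb. Moreover, it is not lcK. 3. Consequently the balanced analogue of Vaisman's theorem fails in every complex dimension $n\ge3$: it is not true that on every compact connected complex manifold of dimension $n$ admitting a balanced metric every lcb metric is gcb. -/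

import Mathlib

open Set
open scoped Manifold ContDiff Nat

universe u

noncomputable section

/-! ### Alternating forms on a real topological vector space -/

section Alternating

variable {V : Type*} [AddCommGroup V] [Module ℝ V] [TopologicalSpace V]
  {A : Type*} [NormedCommRing A] [NormedAlgebra ℝ A] {k l : ℕ}

/-- The multilinear map `(v, w) ↦ a v * b w`. -/
def tensorMul (a : V [⋀^Fin k]→L[ℝ] A) (b : V [⋀^Fin l]→L[ℝ] A) :
    ContinuousMultilinearMap ℝ (fun _ : Fin k ⊕ Fin l => V) A where
  toMultilinearMap := (LinearMap.mul' ℝ A).compMultilinearMap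
    (a.toAlternatingMap.toMultilinearMap.domCoprod b.toAlternatingMap.toMultilinearMap)
  cont := by
    change Continuous fun v : (Fin k ⊕ Fin l → V) =>
      a (fun i => v (Sum.inl i)) * b (fun j => v (Sum.inr j))
    exact (a.cont.comp (by fun_prop)).mul (b.cont.comp (by fun_prop))

/-- The exterior product
`(a ∧ b)(v₁, …, vₖ₊ₗ) = 1 / (k! l!) * ∑ σ, sign σ * a (v_σ₁, …, v_σₖ) * b (v_σₖ₊₁, …, v_σₖ₊ₗ)`;
in particular `(a ∧ b)(v, w) = a v * b w - a w * b v` for `k = l = 1`. -/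
def wedge (a : V [⋀^Fin k]→L[ℝ] A) (b : V [⋀^Fin l]→L[ℝ] A) : V [⋀^Fin (k + l)]→L[ℝ] A :=
  ((k ! : ℝ) * (l ! : ℝ))⁻¹ •
    ContinuousMultilinearMap.alternatization ((tensorMul a b).domDomCongr finSumFinEquiv)

/-- The exterior power `a ∧ ⋯ ∧ a` (`m` factors) of a `2`-form. -/
def wedgePow (a : V [⋀^Fin 2]→L[ℝ] A) : (m : ℕ) → V [⋀^Fin (2 * m)]→L[ℝ] A
  | 0 => ContinuousAlternatingMap.constOfIsEmpty ℝ V (Fin 0) 1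
  | m + 1 => wedge (wedgePow a m) a

/-- The complex conjugate of a complex valued form. -/
def conjForm (a : V [⋀^Fin k]→L[ℝ] ℂ) : V [⋀^Fin k]→L[ℝ] ℂ :=
  (Complex.conjCLE : ℂ →L[ℝ] ℂ).compContinuousAlternatingMap a

/-- A real form regarded as a complex valued form. -/
def complexify (a : V [⋀^Fin k]→L[ℝ] ℝ) : V [⋀^Fin k]→L[ℝ] ℂ :=
  Complex.ofRealCLM.compContinuousAlternatingMap a

end Alternating

/-! ### Differential forms on a manifold modelled on a real normed space -/

section Forms

variable {E : Type*} [NormedAddCommGroup E] [NormedSpace ℝ E]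
  {M : Type*} [TopologicalSpace M] [ChartedSpace E M]
  {F : Type*} [NormedAddCommGroup F] [NormedSpace ℝ F] {k : ℕ}

variable (E M F k) in
/-- Differential `k`-forms on `M` with values in `F` (no regularity assumed). -/
abbrev DiffForm := (x : M) → TangentSpace 𝓘(ℝ, E) x [⋀^Fin k]→L[ℝ] F

namespace DiffForm

/-- The expression of a form in the chart at `x₀`, meaningful on the target of that chart. -/
def inChart (η : DiffForm E M F k) (x₀ : M) : E → E [⋀^Fin k]→L[ℝ] F := fun y =>
  (η ((extChartAt 𝓘(ℝ, E) x₀).symm y)).compContinuousLinearMap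
    (mfderiv 𝓘(ℝ, E) 𝓘(ℝ, E) (extChartAt 𝓘(ℝ, E) x₀).symm y)

/-- A form is smooth if its expression in every preferred chart is smooth. -/
def IsSmooth (η : DiffForm E M F k) : Prop :=
  ∀ x₀ : M, ContDiffOn ℝ ∞ (η.inChart x₀) (extChartAt 𝓘(ℝ, E) x₀).target

/-- The exterior derivative, computed at `x` in the chart at `x`. -/
def d (η : DiffForm E M F k) : DiffForm E M F (k + 1) := fun x =>
  (extDeriv (η.inChart x) (extChartAt 𝓘(ℝ, E) x x)).compContinuousLinearMap
    (mfderiv 𝓘(ℝ, E) 𝓘(ℝ, E) (extChartAt 𝓘(ℝ, E) x) x)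

/-- A form is closed if its exterior derivative vanishes. -/
def IsClosed (η : DiffForm E M F k) : Prop := ∀ x, η.d x = 0

/-- A real `1`-form is exact if it is the differential of a smooth function. -/
def IsExact (η : DiffForm E M ℝ 1) : Prop :=
  ∃ f : M → ℝ, ContMDiff 𝓘(ℝ, E) 𝓘(ℝ, ℝ) ∞ f ∧
    ∀ (x : M) (v : TangentSpace 𝓘(ℝ, E) x), η x (fun _ => v) = mfderiv 𝓘(ℝ, E) 𝓘(ℝ, ℝ) f x v

end DiffForm

end Forms

/-! ### Hermitian metrics on complex manifolds -/

/-- The model space `ℂⁿ`. -/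
abbrev CSpace (n : ℕ) := EuclideanSpace ℂ (Fin n)

section Hermitian

variable {n : ℕ} {M : Type*} [TopologicalSpace M] [ChartedSpace (CSpace n) M]

/-- The complex structure of a manifold with charts in `ℂⁿ` on its real tangent spaces:
multiplication by `i` in the preferred chart (in any chart, if the manifold is complex). -/
def complexStructure (x : M) :
    TangentSpace 𝓘(ℝ, CSpace n) x →L[ℝ] TangentSpace 𝓘(ℝ, CSpace n) x :=
  show CSpace n →L[ℝ] CSpace n from
    (Complex.I • ContinuousLinearMap.id ℂ (CSpace n)).restrictScalars ℝ

lemma complexStructure_sq (x : M) (v : TangentSpace 𝓘(ℝ, CSpace n) x) :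
    complexStructure x (complexStructure x v) = -v := by
  change Complex.I • (Complex.I • (show CSpace n from v)) = -(show CSpace n from v)
  rw [smul_smul, Complex.I_mul_I, neg_one_smul]

variable (n M) in
/-- A smooth Hermitian metric: a Riemannian metric for which the complex structure is
orthogonal. -/
structure HermitianMetric where
  /-- The underlying Riemannian metric. -/
  g : (x : M) → TangentSpace 𝓘(ℝ, CSpace n) x →L[ℝ] TangentSpace 𝓘(ℝ, CSpace n) x →L[ℝ] ℝ
  symm : ∀ x v w, g x v w = g x w v
  pos : ∀ x v, v ≠ 0 → 0 < g x v v
  compatible : ∀ x v w, g x (complexStructure x v) (complexStructure x w) = g x v w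
  /-- The coefficients of the metric in every preferred chart are smooth. -/
  smooth : ∀ (x₀ : M) (v w : CSpace n), ContDiffOn ℝ ∞
    (fun y : CSpace n => g ((extChartAt 𝓘(ℝ, CSpace n) x₀).symm y)
      (mfderiv 𝓘(ℝ, CSpace n) 𝓘(ℝ, CSpace n) (extChartAt 𝓘(ℝ, CSpace n) x₀).symm y v)
      (mfderiv 𝓘(ℝ, CSpace n) 𝓘(ℝ, CSpace n) (extChartAt 𝓘(ℝ, CSpace n) x₀).symm y w))
    (extChartAt 𝓘(ℝ, CSpace n) x₀).target

namespace HermitianMetric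

lemma apply_complexStructure_self (h : HermitianMetric n M) (x : M)
    (v : TangentSpace 𝓘(ℝ, CSpace n) x) : h.g x (complexStructure x v) v = 0 := by
  have h1 := h.compatible x (complexStructure x v) v
  rw [complexStructure_sq, map_neg, _root_.neg_apply,
    h.symm x v (complexStructure x v)] at h1
  linarith

/-- The fundamental form `ω(X, Y) = g(JX, Y)`. -/
def fundamentalForm (h : HermitianMetric n M) : DiffForm (CSpace n) M ℝ 2 := fun x =>
  { toFun := fun v => h.g x (complexStructure x (v 0)) (v 1)
    map_update_add' := by
      intro _ v i a b
      fin_cases i <;> simp [Function.update]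
    map_update_smul' := by
      intro _ v i c a
      fin_cases i <;> simp [Function.update]
    map_eq_zero_of_eq' := by
      intro v i j hv hij
      have h01 : v 0 = v 1 := by
        fin_cases i <;> fin_cases j <;> simp_all
      change h.g x (complexStructure x (v 0)) (v 1) = 0
      rw [h01, apply_complexStructure_self]
    cont := by
      change Continuous fun v : Fin 2 → TangentSpace 𝓘(ℝ, CSpace n) x =>
        h.g x (complexStructure x (v 0)) (v 1)
      change Continuous fun v : Fin 2 → CSpace n =>
        (show CSpace n →L[ℝ] CSpace n →L[ℝ] ℝ from h.g x)
          ((show CSpace n →L[ℝ] CSpace n from complexStructure x) (v 0)) (v 1)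
      fun_prop }

/-- The power `ωⁿ⁻¹` of the fundamental form, where `n` is the complex dimension. -/
def omegaPow (h : HermitianMetric n M) : DiffForm (CSpace n) M ℝ (2 * (n - 1)) := fun x =>
  wedgePow (h.fundamentalForm x) (n - 1)

/-- `θ` is the Lee form of the metric: `d(ωⁿ⁻¹) = θ ∧ ωⁿ⁻¹` (which determines `θ` for `n ≥ 2`). -/
def IsLeeForm (h : HermitianMetric n M) (θ : DiffForm (CSpace n) M ℝ 1) : Prop :=
  θ.IsSmooth ∧ ∀ (x : M) (v : Fin (2 * (n - 1) + 1) → TangentSpace 𝓘(ℝ, CSpace n) x),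
    h.omegaPow.d x v = wedge (θ x) (h.omegaPow x) (v ∘ Fin.cast (Nat.add_comm _ _))

/-- Balanced metrics: `d(ωⁿ⁻¹) = 0`. -/
def IsBalanced (h : HermitianMetric n M) : Prop := h.omegaPow.IsClosed

/-- Locally conformally balanced metrics: the Lee form is closed. -/
def IsLCB (h : HermitianMetric n M) : Prop := ∃ θ, h.IsLeeForm θ ∧ θ.IsClosed

/-- Globally conformally balanced metrics: the Lee form is exact. -/
def IsGCB (h : HermitianMetric n M) : Prop := ∃ θ, h.IsLeeForm θ ∧ θ.IsExact

/-- Locally conformally Kähler metrics: around every point there is a smooth `f` such that the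
fundamental form `e^(-f) ω` of the metric `e^(-f) g` is closed. -/
def IsLCK (h : HermitianMetric n M) : Prop :=
  ∀ x : M, ∃ (U : Set M) (f : M → ℝ), IsOpen U ∧ x ∈ U ∧
    ContMDiffOn 𝓘(ℝ, CSpace n) 𝓘(ℝ, ℝ) ∞ f U ∧
    ∀ y ∈ U, DiffForm.d (fun z => Real.exp (-f z) • h.fundamentalForm z) y = 0

end HermitianMetric

end Hermitian

/-! ### Complex nilmanifolds -/

/-- The space `Γ\G` of orbits of the subgroup `Γ` acting on `G` by left translations. -/
abbrev LeftQuotient {G : Type*} [Group G] (Γ : Subgroup G) := MulAction.orbitRel.Quotient Γ G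

/-- A compact complex nilmanifold `(Γ\G, J)` of complex dimension `n` with left-invariant complex
structure. The Lie group `G`, of real dimension `2n`, is modelled on `ℂⁿ` as a real vector space;
its charts are not related to the complex structure. -/
structure ComplexNilmanifold (n : ℕ) where
  /-- The Lie group. -/
  G : Type*
  [group : Group G]
  [topG : TopologicalSpace G]
  [chartedG : ChartedSpace (CSpace n) G]
  [lieGroup : LieGroup 𝓘(ℝ, CSpace n) ∞ G]
  [simplyConnected : SimplyConnectedSpace G]
  nilpotent : Group.IsNilpotent G
  /-- The discrete cocompact subgroup. -/
  Γ : Subgroup G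
  [discrete : DiscreteTopology Γ]
  [compact : CompactSpace (LeftQuotient Γ)]
  [charted : ChartedSpace (CSpace n) (LeftQuotient Γ)]
  /-- `Γ\G` is a complex manifold. -/
  [complexManifold : IsManifold 𝓘(ℂ, CSpace n) ω (LeftQuotient Γ)]
  /-- The smooth structure of `Γ\G` is the one induced from `G`. -/
  localDiffeo : IsLocalDiffeomorph 𝓘(ℝ, CSpace n) 𝓘(ℝ, CSpace n) ∞
    (fun g : G => (Quotient.mk _ g : LeftQuotient Γ))
  /-- The complex structure on the Lie algebra of `G`. -/
  J : GroupLieAlgebra 𝓘(ℝ, CSpace n) G →L[ℝ] GroupLieAlgebra 𝓘(ℝ, CSpace n) G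
  /-- The complex structure of `Γ\G` is induced from the left-invariant extension of `J` to `G`. -/
  leftInvariant : ∀ (g : G) (X : GroupLieAlgebra 𝓘(ℝ, CSpace n) G),
    complexStructure (Quotient.mk _ g : LeftQuotient Γ)
        (mfderiv 𝓘(ℝ, CSpace n) 𝓘(ℝ, CSpace n) (fun a : G => (Quotient.mk _ a : LeftQuotient Γ)) g
          (mulInvariantVectorField X g)) =
      mfderiv 𝓘(ℝ, CSpace n) 𝓘(ℝ, CSpace n) (fun a : G => (Quotient.mk _ a : LeftQuotient Γ)) g
        (mulInvariantVectorField (J X) g)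

namespace ComplexNilmanifold

attribute [instance] group topG chartedG lieGroup simplyConnected discrete compact charted
  complexManifold

variable {n : ℕ}

/-- The underlying compact complex manifold `Γ\G`. -/
abbrev M (X : ComplexNilmanifold n) := LeftQuotient X.Γ

/-- The projection `G → Γ\G`. -/
def proj (X : ComplexNilmanifold n) (g : X.G) : X.M := Quotient.mk _ g

/-- The Lie algebra of `G`. -/
abbrev LieAlg (X : ComplexNilmanifold n) := GroupLieAlgebra 𝓘(ℝ, CSpace n) X.G

/-- The left-invariant form on `G` with value `a` at the identity. -/
def leftForm (X : ComplexNilmanifold n) {F : Type*} [NormedAddCommGroup F] [NormedSpace ℝ F]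
    {k : ℕ} (a : X.LieAlg [⋀^Fin k]→L[ℝ] F) : DiffForm (CSpace n) X.G F k := fun g =>
  a.compContinuousLinearMap
    (show TangentSpace 𝓘(ℝ, CSpace n) g →L[ℝ] X.LieAlg from
      mfderiv 𝓘(ℝ, CSpace n) 𝓘(ℝ, CSpace n) (fun b : X.G => g⁻¹ * b) g)

/-- The form `η` on `Γ\G` is the left-invariant form induced by the form `a` on the Lie algebra:
its pullback to `G` is the left-invariant form with value `a` at the identity. -/
def IsInducedBy (X : ComplexNilmanifold n) {F : Type*} [NormedAddCommGroup F] [NormedSpace ℝ F]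
    {k : ℕ} (η : DiffForm (CSpace n) X.M F k) (a : X.LieAlg [⋀^Fin k]→L[ℝ] F) : Prop :=
  ∀ g : X.G, (η (X.proj g)).compContinuousLinearMap
    (mfderiv 𝓘(ℝ, CSpace n) 𝓘(ℝ, CSpace n) X.proj g) = X.leftForm a g

/-- The Lie algebra is `2`-step nilpotent. -/
def IsTwoStep (X : ComplexNilmanifold n) : Prop :=
  (∀ x y z : X.LieAlg, ⁅⁅x, y⁆, z⁆ = 0) ∧ ∃ x y : X.LieAlg, ⁅x, y⁆ ≠ 0

/-- The complex `1`-forms `α₁, …, αₙ` on the Lie algebra form a `(1,0)`-coframe: each is of type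
`(1,0)`, and together they identify the Lie algebra with `ℂⁿ`. -/
def IsCoframe (X : ComplexNilmanifold n) (α : Fin n → X.LieAlg [⋀^Fin 1]→L[ℝ] ℂ) : Prop :=
  (∀ i v, α i (fun _ => X.J v) = Complex.I * α i (fun _ => v)) ∧
    Function.Bijective fun (v : X.LieAlg) (i : Fin n) => α i (fun _ => v)

/-- The structure equations `dαᵣ = 0` for `r ≤ m` and `dαₘ₊₁ = ∑ᵣ cᵣ αᵣ ∧ ᾱᵣ` for a
`(1,0)`-coframe `α₁, …, αₘ₊₁`. -/
def HasStructureEquations {m : ℕ} (X : ComplexNilmanifold (m + 1)) (c : Fin m → ℚ)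
    (α : Fin (m + 1) → X.LieAlg [⋀^Fin 1]→L[ℝ] ℂ) : Prop :=
  X.IsCoframe α ∧
  (∀ r : Fin m, (X.leftForm (α r.castSucc)).IsClosed) ∧
  (X.leftForm (α (Fin.last m))).d = X.leftForm
    (∑ r : Fin m, ((c r : ℚ) : ℂ) • wedge (α r.castSucc) (conjForm (α r.castSucc)))

end ComplexNilmanifold

end

/-!
On a nilmanifold `Γ\G` with coframe `α₁, …, αₘ₊₁` write `αₖ = ξₖ + i υₖ`, and consider the
left-invariant metrics with fundamental form `ω = i ∑ aₖ αₖ ∧ ᾱₖ = 2 ∑ aₖ ξₖ ∧ υₖ`, where `aₖ > 0`.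
The structure equations say that all the forms `ξₖ`, `υₖ` are closed except the last one, for which
`dυₘ₊₁ = -2 ∑ cᵣ ξᵣ ∧ υᵣ`. Hence `dω = 2 aₘ₊₁ ξₘ₊₁ ∧ β` with `β = 2 ∑ cᵣ ξᵣ ∧ υᵣ`, and
`d(ωᵐ) = 2 m aₘ₊₁ ξₘ₊₁ ∧ β ∧ ωᵐ⁻¹`. Multiplying by `ξₘ₊₁` kills the last plane, and in the remaining
`2m` real dimensions replacing one factor of `ωᵐ` by `β` multiplies the volume form by the trace of
`β` relative to `ω` (`altSum_sum_replace`). Therefore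
`d(ωᵐ) = (2 aₘ₊₁ ∑ cᵣ / aᵣ) ξₘ₊₁ ∧ ωᵐ` (`StructureEquationsAt.extDeriv_wedgePow`), and everything is
read off from this formula:

* as the `cᵣ` do not all have the same sign, there are positive weights with `∑ cᵣ / aᵣ = 0`, so
  some invariant metric is balanced;
* for `a = 1` the Lee form is `2 (∑ cᵣ) ξₘ₊₁`, which is closed; were some Lee form of this metric
  exact, it would vanish at a maximum of its primitive, but `d(ωᵐ)` vanishes nowhere
  (`altSum_planePow_pos`), so the metric is not globally conformally balanced;
* if `F ω` were closed for a positive function `F`, the values of `d(F ω)` on the triples formed by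
  the vector dual to `ξₘ₊₁` and the vectors dual to `ξᵣ`, `υᵣ` would give `dF = -2 F aₘ₊₁ cᵣ / aᵣ`
  on the first vector for every `r`, although the `cᵣ` have different signs.

To compute on `Γ\G` in the given charts, the Maurer-Cartan form of `G` is pushed forward to `Γ\G`
(`ComplexNilmanifold.mc`): an invariant form is the pullback of a constant form by it, and the
structure equations pass from the group to every chart because both Maurer-Cartan forms are
related by local sections of the projection (`ComplexNilmanifold.exists_chartExpr_mc_eq`).

For the existence of nilmanifolds with these structure equations, `G = ℂᵐ⁺¹` carries the product
`x * y = x + y + (∑ cᵣ x̄ᵣ yᵣ) eₘ₊₁` (`HeisGroup`). Left translations are affine with complex linear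
part, so the quotient by the lattice of points with coordinates in `N ℤ[i]`, with `N` a common
denominator of the `cᵣ`, is a complex manifold, and the left-invariant forms which are the
coordinates at the identity satisfy the structure equations.
-/

noncomputable section

/-! ### Alternating sums -/

section AltSum

variable {V : Type*} {ι κ : Type*} [Fintype ι] [DecidableEq ι] [Fintype κ] [DecidableEq κ]

/-- The alternating sum `∑ σ, sign σ * T (v ∘ σ)` of a function of a family of vectors. The
function need not be multilinear. -/
def altSum (T : (ι → V) → ℝ) (v : ι → V) : ℝ :=
  ∑ σ : Equiv.Perm ι, ((Equiv.Perm.sign σ : ℤ) : ℝ) * T (v ∘ σ)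

lemma altSum_comp_perm (T : (ι → V) → ℝ) (ρ : Equiv.Perm ι) (v : ι → V) :
    altSum (fun w => T (w ∘ ρ)) v = ((Equiv.Perm.sign ρ : ℤ) : ℝ) * altSum T v := by
  unfold altSum
  rw [Finset.mul_sum]
  refine Fintype.sum_equiv (Equiv.mulRight ρ) _ _ fun σ => ?_
  have h : ((Equiv.Perm.sign ρ : ℤ) : ℝ) * ((Equiv.Perm.sign ρ : ℤ) : ℝ) = 1 := by
    rcases Int.units_eq_one_or (Equiv.Perm.sign ρ) with h | h <;> simp [h]
  simp only [Equiv.coe_mulRight, Equiv.Perm.sign_mul, Equiv.Perm.coe_mul, Units.val_mul,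
    Int.cast_mul, Function.comp_assoc]
  linear_combination -(((Equiv.Perm.sign σ : ℤ) : ℝ) * T (v ∘ (⇑σ ∘ ⇑ρ))) * h

lemma altSum_swap (T : (ι → V) → ℝ) {i j : ι} (h : i ≠ j) (v : ι → V) :
    altSum (fun w => T (w ∘ Equiv.swap i j)) v = -altSum T v := by
  simp [altSum_comp_perm, Equiv.Perm.sign_swap h]

lemma altSum_equiv (e : ι ≃ κ) (T : (ι → V) → ℝ) (v : κ → V) :
    altSum (fun w : κ → V => T (w ∘ e)) v = altSum T (v ∘ e) := by
  unfold altSum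
  refine Fintype.sum_equiv (Equiv.permCongr e.symm) _ _ fun σ => ?_
  have h : (v ∘ σ) ∘ e = (v ∘ e) ∘ (Equiv.permCongr e.symm σ) := by
    funext i
    simp [Equiv.permCongr_apply]
  rw [Equiv.Perm.sign_permCongr, ← h]

lemma altSum_add (S T : (ι → V) → ℝ) (v : ι → V) :
    altSum (fun w => S w + T w) v = altSum S v + altSum T v := by
  simp [altSum, mul_add, Finset.sum_add_distrib]

lemma altSum_sub (S T : (ι → V) → ℝ) (v : ι → V) :
    altSum (fun w => S w - T w) v = altSum S v - altSum T v := by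
  simp [altSum, mul_sub, Finset.sum_sub_distrib]

lemma altSum_mul_left (c : ℝ) (T : (ι → V) → ℝ) (v : ι → V) :
    altSum (fun w => c * T w) v = c * altSum T v := by
  simp only [altSum, Finset.mul_sum]
  exact Finset.sum_congr rfl fun σ _ => by ring

lemma altSum_sum {ν : Type*} (s : Finset ν) (T : ν → (ι → V) → ℝ) (v : ι → V) :
    altSum (fun w => ∑ i ∈ s, T i w) v = ∑ i ∈ s, altSum (T i) v := by
  simp only [altSum, Finset.mul_sum]
  exact Finset.sum_comm

/-- Alternating in part of the variables first only contributes a factorial. -/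
lemma altSum_altSum_mul (S : (ι → V) → ℝ) (R : (κ → V) → ℝ) (v : ι ⊕ κ → V) :
    altSum (fun w => altSum S (w ∘ Sum.inl) * R (w ∘ Sum.inr)) v =
      ((Fintype.card ι)! : ℝ) * altSum (fun w => S (w ∘ Sum.inl) * R (w ∘ Sum.inr)) v := by
  have h1 : ∀ w : ι ⊕ κ → V, altSum S (w ∘ Sum.inl) * R (w ∘ Sum.inr) =
      ∑ τ : Equiv.Perm ι, ((Equiv.Perm.sign τ : ℤ) : ℝ) *
        (fun w : ι ⊕ κ → V => S (w ∘ Sum.inl) * R (w ∘ Sum.inr))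
          (w ∘ Equiv.Perm.sumCongr τ 1) := by
    intro w
    rw [altSum, Finset.sum_mul]
    refine Finset.sum_congr rfl fun τ _ => ?_
    rw [mul_assoc]
    rfl
  simp_rw [h1]
  rw [altSum_sum]
  simp_rw [altSum_mul_left]
  have h2 : ∀ τ : Equiv.Perm ι, ((Equiv.Perm.sign τ : ℤ) : ℝ) * altSum (fun w : ι ⊕ κ → V =>
      (fun w : ι ⊕ κ → V => S (w ∘ Sum.inl) * R (w ∘ Sum.inr)) (w ∘ Equiv.Perm.sumCongr τ 1)) v =
      altSum (fun w => S (w ∘ Sum.inl) * R (w ∘ Sum.inr)) v := by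
    intro τ
    rw [altSum_comp_perm (fun w : ι ⊕ κ → V => S (w ∘ Sum.inl) * R (w ∘ Sum.inr))
      (Equiv.Perm.sumCongr τ 1), Equiv.Perm.sign_sumCongr]
    rcases Int.units_eq_one_or (Equiv.Perm.sign τ) with h | h <;> simp [h]
  rw [Finset.sum_congr rfl fun τ _ => h2 τ]
  simp [Fintype.card_perm]

/-- The mirror image of `altSum_altSum_mul`. -/
lemma altSum_mul_altSum (S : (ι → V) → ℝ) (R : (κ → V) → ℝ) (v : ι ⊕ κ → V) :
    altSum (fun w => S (w ∘ Sum.inl) * altSum R (w ∘ Sum.inr)) v =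
      ((Fintype.card κ)! : ℝ) * altSum (fun w => S (w ∘ Sum.inl) * R (w ∘ Sum.inr)) v := by
  have h := altSum_altSum_mul R S (v ∘ Equiv.sumComm κ ι)
  rw [← altSum_equiv (Equiv.sumComm κ ι), ← altSum_equiv (Equiv.sumComm κ ι)] at h
  simp only [mul_comm (S _)]
  exact h

/-- An alternating sum only depends on the antisymmetrization in three chosen variables. -/
lemma altSum_eq_of_cyclic {i j k : ι} (hij : i ≠ j) (hik : i ≠ k)
    {S T : (ι → V) → ℝ}
    (h : ∀ w : ι → V,
      S w - S (w ∘ Equiv.swap i j) + S (w ∘ (Equiv.swap i j * Equiv.swap i k : Equiv.Perm ι)) =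
      T w - T (w ∘ Equiv.swap i j) + T (w ∘ (Equiv.swap i j * Equiv.swap i k : Equiv.Perm ι)))
    (v : ι → V) : altSum S v = altSum T v := by
  have key : ∀ U : (ι → V) → ℝ, altSum (fun w => U w - U (w ∘ Equiv.swap i j) +
      U (w ∘ (Equiv.swap i j * Equiv.swap i k : Equiv.Perm ι))) v = 3 * altSum U v := by
    intro U
    rw [altSum_add, altSum_sub, altSum_swap U hij, altSum_comp_perm, Equiv.Perm.sign_mul,
      Equiv.Perm.sign_swap hij, Equiv.Perm.sign_swap hik]
    push_cast
    ring
  have h' := key S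
  simp_rw [h] at h'
  rw [key T] at h'
  linarith

/-- An alternating sum only depends on the antisymmetrization in two chosen variables. -/
lemma altSum_eq_of_swap {i j : ι} (hij : i ≠ j) {S T : (ι → V) → ℝ}
    (h : ∀ w : ι → V, S w - S (w ∘ Equiv.swap i j) = T w - T (w ∘ Equiv.swap i j))
    (v : ι → V) : altSum S v = altSum T v := by
  have key : ∀ U : (ι → V) → ℝ, altSum (fun w => U w - U (w ∘ Equiv.swap i j)) v =
      2 * altSum U v := by
    intro U
    rw [altSum_sub, altSum_swap U hij]
    ring
  have h' := key S
  simp_rw [h] at h'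
  rw [key T] at h'
  linarith

/-- Expansion of an alternating sum along the first variable. -/
lemma altSum_succ {N : ℕ} (T : V → (Fin N → V) → ℝ) (v : Fin (N + 1) → V) :
    altSum (fun w : Fin (N + 1) → V => T (w 0) (fun i => w i.succ)) v =
      ∑ i : Fin (N + 1), (-1) ^ (i : ℕ) * altSum (T (v i)) (i.removeNth v) := by
  let Φ : Fin (N + 1) × Equiv.Perm (Fin N) → Equiv.Perm (Fin (N + 1)) := fun p =>
    p.1.cycleRange⁻¹ * Equiv.Perm.decomposeFin.symm (0, p.2)
  have hΦ0 : ∀ p, Φ p 0 = p.1 := by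
    intro p
    simp only [Φ, Equiv.Perm.mul_apply, Equiv.Perm.decomposeFin_symm_apply_zero]
    exact Fin.cycleRange_symm_zero _
  have hΦs : ∀ p (j : Fin N), Φ p j.succ = p.1.succAbove (p.2 j) := by
    intro p j
    simp only [Φ, Equiv.Perm.mul_apply, Equiv.Perm.decomposeFin_symm_apply_succ, Equiv.swap_self,
      Equiv.refl_apply]
    exact Fin.cycleRange_symm_succ _ _
  have hinj : Function.Injective Φ := by
    rintro ⟨i, e⟩ ⟨i', e'⟩ h
    have h0 : i = i' := by simpa [hΦ0] using congrArg (fun σ => σ 0) h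
    subst h0
    refine Prod.ext rfl (Equiv.ext fun j => ?_)
    have := congrArg (fun σ => σ j.succ) h
    simp only [hΦs] at this
    exact Fin.succAbove_right_injective this
  have hbij : Function.Bijective Φ := by
    rw [Fintype.bijective_iff_injective_and_card]
    refine ⟨hinj, ?_⟩
    simp [Fintype.card_perm, Nat.factorial_succ]
  unfold altSum
  rw [← (Equiv.ofBijective Φ hbij).sum_comp, Fintype.sum_prod_type]
  refine Finset.sum_congr rfl fun i _ => ?_
  rw [Finset.mul_sum]
  refine Finset.sum_congr rfl fun e _ => ?_
  have hs : Equiv.Perm.sign (Φ (i, e)) = (-1) ^ (i : ℕ) * Equiv.Perm.sign e := by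
    simp [Φ, Equiv.Perm.sign_mul, Equiv.Perm.decomposeFin.symm_sign, Fin.sign_cycleRange]
  have hv : (fun j : Fin N => (v ∘ Φ (i, e)) j.succ) = i.removeNth v ∘ e := by
    ext j
    simp [hΦs, Fin.removeNth]
  simp only [Equiv.ofBijective_apply]
  rw [hv, hs]
  simp [hΦ0, mul_assoc]

end AltSum

/-! ### Exterior products as alternating sums -/

section Wedge

variable {V : Type*} [AddCommGroup V] [Module ℝ V] [TopologicalSpace V]
  {W : Type*} [AddCommGroup W] [Module ℝ W] [TopologicalSpace W]
  {A : Type*} [NormedCommRing A] [NormedAlgebra ℝ A] {k l : ℕ}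

lemma wedge_apply (a : V [⋀^Fin k]→L[ℝ] A) (b : V [⋀^Fin l]→L[ℝ] A) (v : Fin (k + l) → V) :
    wedge a b v = ((k ! : ℝ) * (l ! : ℝ))⁻¹ • ∑ σ : Equiv.Perm (Fin (k + l)),
      Equiv.Perm.sign σ • (a (v ∘ σ ∘ finSumFinEquiv ∘ Sum.inl) *
        b (v ∘ σ ∘ finSumFinEquiv ∘ Sum.inr)) := by
  simp only [wedge, ContinuousAlternatingMap.smul_apply,
    ContinuousMultilinearMap.alternatization_apply_apply]
  rfl

lemma wedge_eq_altSum (a : V [⋀^Fin k]→L[ℝ] ℝ) (b : V [⋀^Fin l]→L[ℝ] ℝ) (v : Fin (k + l) → V) :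
    wedge a b v = ((k ! : ℝ) * (l ! : ℝ))⁻¹ *
      altSum (fun w : Fin k ⊕ Fin l → V => a (w ∘ Sum.inl) * b (w ∘ Sum.inr))
        (v ∘ finSumFinEquiv) := by
  rw [wedge_apply, ← altSum_equiv, smul_eq_mul, altSum]
  congr 1
  refine Finset.sum_congr rfl fun σ _ => ?_
  rw [Units.smul_def, zsmul_eq_mul]
  rfl

lemma wedge_one_one_apply (a b : V [⋀^Fin 1]→L[ℝ] A) (v : Fin 2 → V) :
    wedge a b v =
      a (fun _ => v 0) * b (fun _ => v 1) - a (fun _ => v 1) * b (fun _ => v 0) := by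
  have hl : ∀ σ : Equiv.Perm (Fin (1 + 1)),
      v ∘ σ ∘ finSumFinEquiv ∘ Sum.inl = fun _ : Fin 1 => v (σ 0) := by
    intro σ; funext i; fin_cases i; rfl
  have hr : ∀ σ : Equiv.Perm (Fin (1 + 1)),
      v ∘ σ ∘ finSumFinEquiv ∘ Sum.inr = fun _ : Fin 1 => v (σ 1) := by
    intro σ; funext i; fin_cases i; rfl
  rw [wedge_apply]
  simp only [hl, hr]
  rw [show (Finset.univ : Finset (Equiv.Perm (Fin (1 + 1)))) = {1, Equiv.swap 0 1} by decide,
    Finset.sum_pair (by decide)]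
  simp [sub_eq_add_neg]

lemma wedge_compContinuousLinearMap (a : V [⋀^Fin k]→L[ℝ] A) (b : V [⋀^Fin l]→L[ℝ] A)
    (L : W →L[ℝ] V) :
    wedge (a.compContinuousLinearMap L) (b.compContinuousLinearMap L) =
      (wedge a b).compContinuousLinearMap L := by
  ext v
  simp only [ContinuousAlternatingMap.compContinuousLinearMap_apply, wedge_apply]
  rfl

lemma wedgePow_compContinuousLinearMap (a : V [⋀^Fin 2]→L[ℝ] A) (L : W →L[ℝ] V) (m : ℕ) :
    wedgePow (a.compContinuousLinearMap L) m = (wedgePow a m).compContinuousLinearMap L := by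
  induction m with
  | zero => rfl
  | succ m ih => rw [wedgePow, ih, wedge_compContinuousLinearMap]; rfl

/-- Pairs of indices below `m`, and one more pair appended at the end. -/
def pairsSucc (m : ℕ) : (Fin m × Fin 2) ⊕ Fin 2 ≃ Fin (m + 1) × Fin 2 where
  toFun := Sum.elim (fun p => (p.1.castSucc, p.2)) (fun j => (Fin.last m, j))
  invFun p := Fin.lastCases (motive := fun _ => (Fin m × Fin 2) ⊕ Fin 2)
    (Sum.inr p.2) (fun i => Sum.inl (i, p.2)) p.1
  left_inv := by rintro (⟨i, j⟩ | j) <;> simp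
  right_inv := by
    rintro ⟨i, j⟩
    induction i using Fin.lastCases <;> simp

/-- The bijection through which the arguments of the `m`-th power of a `2`-form are grouped into
pairs. -/
def pairsEquiv : (m : ℕ) → Fin m × Fin 2 ≃ Fin (2 * m)
  | 0 => Equiv.equivOfIsEmpty (Fin 0 × Fin 2) (Fin 0)
  | m + 1 => (pairsSucc m).symm.trans
      (((pairsEquiv m).sumCongr (Equiv.refl (Fin 2))).trans finSumFinEquiv)

lemma wedgePow_eq_altSum (a : V [⋀^Fin 2]→L[ℝ] ℝ) (m : ℕ) (v : Fin (2 * m) → V) :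
    wedgePow a m v = (2 ^ m : ℝ)⁻¹ *
      altSum (fun w : Fin m × Fin 2 → V => ∏ l, a ![w (l, 0), w (l, 1)]) (v ∘ pairsEquiv m) := by
  induction m with
  | zero => simp [wedgePow, altSum]
  | succ m ih =>
    have h2 : ∀ u : Fin 2 → V, a ![u 0, u 1] = a u := by
      intro u; congr 1; funext i; fin_cases i <;> rfl
    have hT : (fun w : (Fin m × Fin 2) ⊕ Fin 2 → V =>
        (∏ l, a ![(w ∘ Sum.inl) (l, 0), (w ∘ Sum.inl) (l, 1)]) * a (w ∘ Sum.inr)) =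
        fun w => (fun w : Fin (m + 1) × Fin 2 → V => ∏ l, a ![w (l, 0), w (l, 1)])
          (w ∘ (pairsSucc m).symm) := by
      funext w
      simp only [Fin.prod_univ_castSucc]
      congr 1
      · simp [pairsSucc]
      · rw [h2 fun j => (w ∘ (pairsSucc m).symm) (Fin.last m, j)]
        congr 1
        funext j
        simp [pairsSucc]
    have hv : (v ∘ finSumFinEquiv) ∘ ((pairsEquiv m).sumCongr (Equiv.refl (Fin 2))) =
        (v ∘ pairsEquiv (m + 1)) ∘ pairsSucc m := by
      funext p
      simp [pairsEquiv]
    have h1 : wedge (wedgePow a m) a v = ((((2 * m) ! : ℕ) : ℝ) * ((2 ! : ℕ) : ℝ))⁻¹ *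
        ((2 ^ m : ℝ)⁻¹ * altSum (fun w : (Fin m × Fin 2) ⊕ Fin 2 → V =>
          altSum (fun w : Fin m × Fin 2 → V => ∏ l, a ![w (l, 0), w (l, 1)]) (w ∘ Sum.inl) *
            a (w ∘ Sum.inr)) ((v ∘ finSumFinEquiv) ∘
              ((pairsEquiv m).sumCongr (Equiv.refl (Fin 2))))) := by
      rw [wedge_eq_altSum]
      congr 1
      rw [← altSum_mul_left, ← altSum_equiv ((pairsEquiv m).sumCongr (Equiv.refl (Fin 2)))]
      congr 1
      funext w
      rw [ih, mul_assoc]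
      rfl
    change wedge (wedgePow a m) a v = _
    rw [h1, altSum_altSum_mul, hT, hv, altSum_equiv (pairsSucc m).symm
      (fun w : Fin (m + 1) × Fin 2 → V => ∏ l, a ![w (l, 0), w (l, 1)])]
    have hv' : ((v ∘ pairsEquiv (m + 1)) ∘ pairsSucc m) ∘ (pairsSucc m).symm =
        v ∘ pairsEquiv (m + 1) := by
      funext p; simp
    rw [hv']
    have hf : (((2 * m) ! : ℕ) : ℝ) ≠ 0 := by positivity
    simp only [Fintype.card_prod, Fintype.card_fin, mul_comm m 2]
    rw [show ((2 ! : ℕ) : ℝ) = 2 by norm_num [Nat.factorial]]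
    field_simp
    ring

/-- The arguments of the product of a `1`-form and the `m`-th power of a `2`-form, those of the
power being grouped into pairs. -/
def onePairsEquiv (m : ℕ) : Fin 1 ⊕ (Fin m × Fin 2) ≃ Fin (2 * m + 1) :=
  ((Equiv.refl (Fin 1)).sumCongr (pairsEquiv m)).trans
    (finSumFinEquiv.trans (finCongr (Nat.add_comm 1 (2 * m))))

lemma onePairsEquiv_inl (m : ℕ) (i : Fin 1) : onePairsEquiv m (Sum.inl i) = 0 := by
  ext; simp [onePairsEquiv]

lemma onePairsEquiv_inr (m : ℕ) (p : Fin m × Fin 2) :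
    onePairsEquiv m (Sum.inr p) = (pairsEquiv m p).succ := by
  ext; simp [onePairsEquiv, Nat.add_comm]

lemma wedge_wedgePow_eq_altSum (θ : V [⋀^Fin 1]→L[ℝ] ℝ) (a : V [⋀^Fin 2]→L[ℝ] ℝ) (m : ℕ)
    (v : Fin (2 * m + 1) → V) :
    wedge θ (wedgePow a m) (v ∘ Fin.cast (Nat.add_comm _ _)) = (2 ^ m : ℝ)⁻¹ *
      altSum (fun w : Fin 1 ⊕ (Fin m × Fin 2) → V => θ (fun _ => w (Sum.inl 0)) *
        ∏ l, a ![w (Sum.inr (l, 0)), w (Sum.inr (l, 1))]) (v ∘ onePairsEquiv m) := by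
  have hθ : ∀ u : Fin 1 → V, θ (fun _ => u 0) = θ u := by
    intro u; congr 1; funext i; fin_cases i; rfl
  have hv : ((v ∘ Fin.cast (Nat.add_comm _ _)) ∘ finSumFinEquiv) ∘
      (Equiv.refl (Fin 1)).sumCongr (pairsEquiv m) = v ∘ onePairsEquiv m := by
    funext p; rfl
  have h1 : wedge θ (wedgePow a m) (v ∘ Fin.cast (Nat.add_comm _ _)) =
      (((1 ! : ℕ) : ℝ) * (((2 * m) ! : ℕ) : ℝ))⁻¹ * ((2 ^ m : ℝ)⁻¹ *
        altSum (fun w : Fin 1 ⊕ (Fin m × Fin 2) → V => θ (w ∘ Sum.inl) *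
          altSum (fun w : Fin m × Fin 2 → V => ∏ l, a ![w (l, 0), w (l, 1)]) (w ∘ Sum.inr))
        (v ∘ onePairsEquiv m)) := by
    rw [wedge_eq_altSum]
    congr 1
    rw [← altSum_mul_left, ← hv, ← altSum_equiv ((Equiv.refl (Fin 1)).sumCongr (pairsEquiv m))]
    congr 1
    funext w
    rw [wedgePow_eq_altSum, mul_left_comm]
    rfl
  rw [h1, altSum_mul_altSum]
  have hf : (((2 * m) ! : ℕ) : ℝ) ≠ 0 := by positivity
  simp only [Fintype.card_prod, Fintype.card_fin, mul_comm m 2, Nat.factorial_one, Nat.cast_one,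
    one_mul, ← hθ]
  field_simp
  rfl

end Wedge

/-! ### Powers of a sum of decomposable `2`-forms -/

section PlaneForm

variable {V : Type*} {m : ℕ}

/-- The `2`-form `2 x ∧ y` of two `1`-forms, as a function of two vectors. -/
def planeForm (x y : V → ℝ) (p q : V) : ℝ := 2 * (x p * y q - y p * x q)

/-- In the product of a function of three variables and of `2`-forms in disjoint pairs of variables,
the first factor matters up to its antisymmetrization only. -/
lemma altSum_mul_prod_erase_congr (l : Fin m) {K K' : V → V → V → ℝ}
    (h : ∀ u p q, K u p q - K p u q + K q u p = K' u p q - K' p u q + K' q u p)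
    (F : Fin m → V → V → ℝ) (v : Fin 1 ⊕ (Fin m × Fin 2) → V) :
    altSum (fun w => K (w (Sum.inl 0)) (w (Sum.inr (l, 0))) (w (Sum.inr (l, 1))) *
        ∏ l' ∈ Finset.univ.erase l, F l' (w (Sum.inr (l', 0))) (w (Sum.inr (l', 1)))) v =
      altSum (fun w => K' (w (Sum.inl 0)) (w (Sum.inr (l, 0))) (w (Sum.inr (l, 1))) *
        ∏ l' ∈ Finset.univ.erase l, F l' (w (Sum.inr (l', 0))) (w (Sum.inr (l', 1)))) v := by
  have h0 : (Sum.inl 0 : Fin 1 ⊕ (Fin m × Fin 2)) ≠ Sum.inr (l, 0) := by simp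
  have h1 : (Sum.inl 0 : Fin 1 ⊕ (Fin m × Fin 2)) ≠ Sum.inr (l, 1) := by simp
  have h01 : (Sum.inr (l, 0) : Fin 1 ⊕ (Fin m × Fin 2)) ≠ Sum.inr (l, 1) := by simp
  refine altSum_eq_of_cyclic h0 h1 (fun w => ?_) v
  have hR : ∀ (l' : Fin m) (j : Fin 2), l' ∈ Finset.univ.erase l →
      Equiv.swap (Sum.inl 0 : Fin 1 ⊕ (Fin m × Fin 2)) (Sum.inr (l, 0)) (Sum.inr (l', j)) =
        Sum.inr (l', j) ∧
      Equiv.swap (Sum.inl 0 : Fin 1 ⊕ (Fin m × Fin 2)) (Sum.inr (l, 1)) (Sum.inr (l', j)) =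
        Sum.inr (l', j) := by
    intro l' j hl'
    have := Finset.ne_of_mem_erase hl'
    constructor <;> exact Equiv.swap_apply_of_ne_of_ne (by simp) (by simp [this])
  have hP1 : ∏ l' ∈ Finset.univ.erase l, F l'
        ((w ∘ Equiv.swap (Sum.inl 0) (Sum.inr (l, 0))) (Sum.inr (l', 0)))
        ((w ∘ Equiv.swap (Sum.inl 0) (Sum.inr (l, 0))) (Sum.inr (l', 1))) =
      ∏ l' ∈ Finset.univ.erase l, F l' (w (Sum.inr (l', 0))) (w (Sum.inr (l', 1))) :=
    Finset.prod_congr rfl fun l' hl' => by simp [(hR l' _ hl').1]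
  have hP2 : ∏ l' ∈ Finset.univ.erase l, F l'
        ((w ∘ (Equiv.swap (Sum.inl 0) (Sum.inr (l, 0)) *
          Equiv.swap (Sum.inl 0) (Sum.inr (l, 1)) : Equiv.Perm _)) (Sum.inr (l', 0)))
        ((w ∘ (Equiv.swap (Sum.inl 0) (Sum.inr (l, 0)) *
          Equiv.swap (Sum.inl 0) (Sum.inr (l, 1)) : Equiv.Perm _)) (Sum.inr (l', 1))) =
      ∏ l' ∈ Finset.univ.erase l, F l' (w (Sum.inr (l', 0))) (w (Sum.inr (l', 1))) :=
    Finset.prod_congr rfl fun l' hl' => by simp [(hR l' _ hl').1, (hR l' _ hl').2]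
  rw [hP1, hP2]
  have e1 := Equiv.swap_apply_of_ne_of_ne h1.symm h01.symm
  have e2 := Equiv.swap_apply_of_ne_of_ne h0.symm h01
  simp only [Function.comp_apply, Equiv.Perm.mul_apply, Equiv.swap_apply_left,
    Equiv.swap_apply_right, e1, e2]
  linear_combination (∏ l' ∈ Finset.univ.erase l,
    F l' (w (Sum.inr (l', 0))) (w (Sum.inr (l', 1)))) * h (w (Sum.inl 0)) (w (Sum.inr (l, 0)))
      (w (Sum.inr (l, 1)))

variable (x y : Fin (m + 1) → V → ℝ)

/-- The product of the last of the `1`-forms `x` and the `2`-forms `2 x ∧ y` with indices `κ`. -/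
def planeMonomial (κ : Fin m → Fin (m + 1)) (w : Fin 1 ⊕ (Fin m × Fin 2) → V) : ℝ :=
  x (Fin.last m) (w (Sum.inl 0)) *
    ∏ l, planeForm (x (κ l)) (y (κ l)) (w (Sum.inr (l, 0))) (w (Sum.inr (l, 1)))

/-- The last plane is killed by the first factor: `x ∧ (x ∧ y) = 0`. -/
lemma altSum_planeMonomial_eq_zero_of_last {κ : Fin m → Fin (m + 1)} {l : Fin m}
    (h : κ l = Fin.last m) (v : Fin 1 ⊕ (Fin m × Fin 2) → V) :
    altSum (planeMonomial x y κ) v = 0 := by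
  have h1 := altSum_mul_prod_erase_congr l
    (K := fun u p q => x (Fin.last m) u * planeForm (x (Fin.last m)) (y (Fin.last m)) p q)
    (K' := fun _ _ _ => 0) (fun u p q => by simp only [planeForm]; ring)
    (fun l' => planeForm (x (κ l')) (y (κ l'))) v
  have h2 : altSum (fun _ : Fin 1 ⊕ (Fin m × Fin 2) → V => (0 : ℝ)) v = 0 := by simp [altSum]
  simp only [zero_mul, h2] at h1
  rw [← h1]
  congr 1
  funext w
  rw [planeMonomial, ← Finset.mul_prod_erase _ _ (Finset.mem_univ l), h, mul_assoc]

/-- A plane cannot occur twice: `(x ∧ y) ∧ (x ∧ y) = 0`. -/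
lemma altSum_planeMonomial_eq_zero_of_eq {κ : Fin m → Fin (m + 1)} {l l' : Fin m} (hl : l ≠ l')
    (h : κ l = κ l') (v : Fin 1 ⊕ (Fin m × Fin 2) → V) :
    altSum (planeMonomial x y κ) v = 0 := by
  have h2 : altSum (fun _ : Fin 1 ⊕ (Fin m × Fin 2) → V => (0 : ℝ)) v = 0 := by simp [altSum]
  rw [← h2]
  have hij : (Sum.inr (l, 1) : Fin 1 ⊕ (Fin m × Fin 2)) ≠ Sum.inr (l', 0) := by simp
  have hik : (Sum.inr (l, 1) : Fin 1 ⊕ (Fin m × Fin 2)) ≠ Sum.inr (l', 1) := by simp [hl]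
  have hjk : (Sum.inr (l', 0) : Fin 1 ⊕ (Fin m × Fin 2)) ≠ Sum.inr (l', 1) := by simp
  refine altSum_eq_of_cyclic hij hik (fun w => ?_) v
  have hsplit : ∀ w : Fin 1 ⊕ (Fin m × Fin 2) → V, planeMonomial x y κ w =
      x (Fin.last m) (w (Sum.inl 0)) *
        (planeForm (x (κ l)) (y (κ l)) (w (Sum.inr (l, 0))) (w (Sum.inr (l, 1))) *
        (planeForm (x (κ l)) (y (κ l)) (w (Sum.inr (l', 0))) (w (Sum.inr (l', 1))) *
        ∏ i ∈ (Finset.univ.erase l).erase l',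
          planeForm (x (κ i)) (y (κ i)) (w (Sum.inr (i, 0))) (w (Sum.inr (i, 1))))) := by
    intro w
    rw [planeMonomial, ← Finset.mul_prod_erase _ _ (Finset.mem_univ l),
      ← Finset.mul_prod_erase _ _ (Finset.mem_erase.2 ⟨hl.symm, Finset.mem_univ l'⟩), ← h]
  have hR : ∀ (i : Fin m) (j : Fin 2), i ∈ (Finset.univ.erase l).erase l' →
      Equiv.swap (Sum.inr (l, 1) : Fin 1 ⊕ (Fin m × Fin 2)) (Sum.inr (l', 0)) (Sum.inr (i, j)) =
        Sum.inr (i, j) ∧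
      Equiv.swap (Sum.inr (l, 1) : Fin 1 ⊕ (Fin m × Fin 2)) (Sum.inr (l', 1)) (Sum.inr (i, j)) =
        Sum.inr (i, j) := by
    intro i j hi
    have hi' := Finset.ne_of_mem_erase hi
    have hi2 := Finset.ne_of_mem_erase (Finset.mem_of_mem_erase hi)
    constructor <;> exact Equiv.swap_apply_of_ne_of_ne (by simp [hi2]) (by simp [hi'])
  have hP1 : ∏ i ∈ (Finset.univ.erase l).erase l', planeForm (x (κ i)) (y (κ i))
        ((w ∘ Equiv.swap (Sum.inr (l, 1)) (Sum.inr (l', 0))) (Sum.inr (i, 0)))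
        ((w ∘ Equiv.swap (Sum.inr (l, 1)) (Sum.inr (l', 0))) (Sum.inr (i, 1))) =
      ∏ i ∈ (Finset.univ.erase l).erase l',
        planeForm (x (κ i)) (y (κ i)) (w (Sum.inr (i, 0))) (w (Sum.inr (i, 1))) :=
    Finset.prod_congr rfl fun i hi => by simp [(hR i _ hi).1]
  have hP2 : ∏ i ∈ (Finset.univ.erase l).erase l', planeForm (x (κ i)) (y (κ i))
        ((w ∘ (Equiv.swap (Sum.inr (l, 1)) (Sum.inr (l', 0)) *
          Equiv.swap (Sum.inr (l, 1)) (Sum.inr (l', 1)) : Equiv.Perm _)) (Sum.inr (i, 0)))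
        ((w ∘ (Equiv.swap (Sum.inr (l, 1)) (Sum.inr (l', 0)) *
          Equiv.swap (Sum.inr (l, 1)) (Sum.inr (l', 1)) : Equiv.Perm _)) (Sum.inr (i, 1))) =
      ∏ i ∈ (Finset.univ.erase l).erase l',
        planeForm (x (κ i)) (y (κ i)) (w (Sum.inr (i, 0))) (w (Sum.inr (i, 1))) :=
    Finset.prod_congr rfl fun i hi => by simp [(hR i _ hi).1, (hR i _ hi).2]
  have e0 : ∀ j k, Equiv.swap (Sum.inr (l, 1) : Fin 1 ⊕ (Fin m × Fin 2)) (Sum.inr (l', j))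
      (Sum.inl k) = Sum.inl k :=
    fun j k => Equiv.swap_apply_of_ne_of_ne (by simp) (by simp)
  have e1 : ∀ j, Equiv.swap (Sum.inr (l, 1) : Fin 1 ⊕ (Fin m × Fin 2)) (Sum.inr (l', j))
      (Sum.inr (l, 0)) = Sum.inr (l, 0) :=
    fun j => Equiv.swap_apply_of_ne_of_ne (by simp) (by simp [hl])
  have e2 := Equiv.swap_apply_of_ne_of_ne hik.symm hjk.symm
  have e3 := Equiv.swap_apply_of_ne_of_ne hij.symm hjk
  simp only [hsplit]
  rw [hP1, hP2]
  simp only [Function.comp_apply, Equiv.Perm.mul_apply, Equiv.swap_apply_left,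
    Equiv.swap_apply_right, e0, e1, e2, e3]
  -- The Plücker relation: a decomposable `2`-form has square zero.
  simp only [planeForm]
  ring

lemma exists_perm_of_injective {κ : Fin m → Fin (m + 1)} (hinj : Function.Injective κ)
    (hlast : ∀ l, κ l ≠ Fin.last m) : ∃ π : Equiv.Perm (Fin m), ∀ l, κ l = (π l).castSucc := by
  have hinj' : Function.Injective fun l => (κ l).castPred (hlast l) := fun l l' h =>
    hinj (Fin.castPred_inj.1 h)
  exact ⟨Equiv.ofBijective _ (Finite.injective_iff_bijective.1 hinj'), fun l => by simp⟩

/-- Only the index functions which are bijections onto the indices other than the last one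
contribute to the expansion of a power. -/
lemma altSum_planeMonomial_eq_zero_or (κ : Fin m → Fin (m + 1)) :
    (∀ v, altSum (planeMonomial x y κ) v = 0) ∨
      ∃ π : Equiv.Perm (Fin m), ∀ l, κ l = (π l).castSucc := by
  by_cases hinj : Function.Injective κ
  · by_cases hlast : ∀ l, κ l ≠ Fin.last m
    · exact Or.inr (exists_perm_of_injective hinj hlast)
    · push Not at hlast
      obtain ⟨l, hl⟩ := hlast
      exact Or.inl (altSum_planeMonomial_eq_zero_of_last x y hl)
  · simp only [Function.Injective, not_forall] at hinj
    obtain ⟨l, l', h, hl⟩ := hinj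
    exact Or.inl (altSum_planeMonomial_eq_zero_of_eq x y hl h)

lemma prod_sum_planeForm (a : Fin m → Fin (m + 1) → ℝ) (w : Fin 1 ⊕ (Fin m × Fin 2) → V) :
    x (Fin.last m) (w (Sum.inl 0)) * ∏ l, (∑ k, a l k *
      planeForm (x k) (y k) (w (Sum.inr (l, 0))) (w (Sum.inr (l, 1)))) =
    ∑ κ : Fin m → Fin (m + 1), (∏ l, a l (κ l)) * planeMonomial x y κ w := by
  rw [Finset.prod_univ_sum, Fintype.piFinset_univ, Finset.mul_sum]
  refine Finset.sum_congr rfl fun κ _ => ?_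
  rw [planeMonomial, Finset.prod_mul_distrib]
  ring

/-- Replacing one factor of a power of `∑ a x ∧ y` by `∑ b x ∧ y`, in all possible places,
multiplies the top degree form by the trace `∑ b / a`. -/
lemma altSum_sum_replace (a b : Fin (m + 1) → ℝ) (ha : ∀ k, a k ≠ 0) (hb : b (Fin.last m) = 0)
    (v : Fin 1 ⊕ (Fin m × Fin 2) → V) :
    ∑ l, altSum (fun w => x (Fin.last m) (w (Sum.inl 0)) *
        (∑ k, b k * planeForm (x k) (y k) (w (Sum.inr (l, 0))) (w (Sum.inr (l, 1)))) *
        ∏ l' ∈ Finset.univ.erase l,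
          ∑ k, a k * planeForm (x k) (y k) (w (Sum.inr (l', 0))) (w (Sum.inr (l', 1)))) v =
      (∑ k, b k / a k) * altSum (fun w => x (Fin.last m) (w (Sum.inl 0)) *
        ∏ l, ∑ k, a k * planeForm (x k) (y k) (w (Sum.inr (l, 0))) (w (Sum.inr (l, 1)))) v := by
  have h1 : ∀ (l : Fin m), altSum (fun w => x (Fin.last m) (w (Sum.inl 0)) *
        (∑ k, b k * planeForm (x k) (y k) (w (Sum.inr (l, 0))) (w (Sum.inr (l, 1)))) *
        ∏ l' ∈ Finset.univ.erase l,
          ∑ k, a k * planeForm (x k) (y k) (w (Sum.inr (l', 0))) (w (Sum.inr (l', 1)))) v =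
      ∑ κ : Fin m → Fin (m + 1), (b (κ l) / a (κ l) * ∏ l', a (κ l')) *
        altSum (planeMonomial x y κ) v := by
    intro l
    simp_rw [← altSum_mul_left]
    rw [← altSum_sum]
    congr 1
    funext w
    have h2 := prod_sum_planeForm x y (fun l' k => if l' = l then b k else a k) w
    rw [← Finset.mul_prod_erase _ _ (Finset.mem_univ l), ← mul_assoc] at h2
    simp only [if_true] at h2
    rw [Finset.prod_congr (g := fun l' => ∑ k, a k *
      planeForm (x k) (y k) (w (Sum.inr (l', 0))) (w (Sum.inr (l', 1)))) rfl
        (fun l' hl' => by simp [Finset.ne_of_mem_erase hl'])] at h2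
    rw [h2]
    refine Finset.sum_congr rfl fun κ _ => ?_
    congr 1
    rw [← Finset.mul_prod_erase _ _ (Finset.mem_univ l),
      ← Finset.mul_prod_erase _ (fun l' => a (κ l')) (Finset.mem_univ l)]
    rw [Finset.prod_congr (g := fun l' => a (κ l')) rfl
        (fun l' hl' => by simp [Finset.ne_of_mem_erase hl'])]
    have := ha (κ l)
    simp only [if_true]
    field_simp
  have h3 : altSum (fun w => x (Fin.last m) (w (Sum.inl 0)) *
        ∏ l, ∑ k, a k * planeForm (x k) (y k) (w (Sum.inr (l, 0))) (w (Sum.inr (l, 1)))) v =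
      ∑ κ : Fin m → Fin (m + 1), (∏ l', a (κ l')) * altSum (planeMonomial x y κ) v := by
    simp_rw [← altSum_mul_left]
    rw [← altSum_sum]
    congr 1
    funext w
    exact prod_sum_planeForm x y (fun _ k => a k) w
  rw [Finset.sum_congr rfl fun l _ => h1 l, h3, Finset.sum_comm, Finset.mul_sum]
  refine Finset.sum_congr rfl fun κ _ => ?_
  rcases altSum_planeMonomial_eq_zero_or x y κ with h | ⟨π, hπ⟩
  · simp [h]
  · have h4 : ∑ l, b (κ l) / a (κ l) = ∑ k, b k / a k := by
      rw [Fin.sum_univ_castSucc (fun k => b k / a k), hb, zero_div, add_zero,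
        ← Equiv.sum_comp π (fun l => b l.castSucc / a l.castSucc)]
      simp [hπ]
    rw [← Finset.sum_mul, ← Finset.sum_mul, h4, mul_assoc]

/-- `2`-forms commute: permuting pairs of variables is an even permutation. -/
lemma altSum_planeMonomial_perm (π : Equiv.Perm (Fin m)) (v : Fin 1 ⊕ (Fin m × Fin 2) → V) :
    altSum (planeMonomial x y fun l => (π l).castSucc) v =
      altSum (planeMonomial x y Fin.castSucc) v := by
  have hs : Equiv.Perm.sign (Equiv.Perm.sumCongr (1 : Equiv.Perm (Fin 1))
      (Equiv.prodCongrLeft (fun _ : Fin 2 => π))) = 1 := by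
    rw [Equiv.Perm.sign_sumCongr, Equiv.Perm.sign_prodCongrLeft]
    rcases Int.units_eq_one_or (Equiv.Perm.sign π) with h | h <;> simp [h]
  have h := altSum_comp_perm (planeMonomial x y fun l => (π l).castSucc)
    (Equiv.Perm.sumCongr (1 : Equiv.Perm (Fin 1))
      (Equiv.prodCongrLeft (fun _ : Fin 2 => π))) v
  rw [hs] at h
  rw [Units.val_one, Int.cast_one, one_mul] at h
  rw [← h]
  congr 1
  funext w
  simp only [planeMonomial]
  congr 1
  rw [← Equiv.prod_comp π fun l => planeForm (x l.castSucc) (y l.castSucc) (w (Sum.inr (l, 0)))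
    (w (Sum.inr (l, 1)))]
  simp [Equiv.prodCongrLeft]

/-- On a basis dual to the `1`-forms `x` and `y`, the product of the last `1`-form and of all the
other planes does not vanish. -/
lemma altSum_planeMonomial_castSucc (v : Fin 1 ⊕ (Fin m × Fin 2) → V)
    (hx0 : ∀ k, x k (v (Sum.inl 0)) = if k = Fin.last m then 1 else 0)
    (hy0 : ∀ k, y k (v (Sum.inl 0)) = 0)
    (hx1 : ∀ k l, x k (v (Sum.inr (l, 0))) = if k = l.castSucc then 1 else 0)
    (hy1 : ∀ k l, y k (v (Sum.inr (l, 0))) = 0)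
    (hx2 : ∀ k l, x k (v (Sum.inr (l, 1))) = 0)
    (hy2 : ∀ k l, y k (v (Sum.inr (l, 1))) = if k = l.castSucc then 1 else 0) :
    altSum (planeMonomial x y Fin.castSucc) v = 4 ^ m := by
  -- In the antisymmetrization, each `2`-form may be replaced by four times a product.
  have hU : ∀ s : Finset (Fin m), altSum (planeMonomial x y Fin.castSucc) v =
      altSum (fun w => x (Fin.last m) (w (Sum.inl 0)) * ∏ l, if l ∈ s then
        4 * (x l.castSucc (w (Sum.inr (l, 0))) * y l.castSucc (w (Sum.inr (l, 1)))) else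
        planeForm (x l.castSucc) (y l.castSucc) (w (Sum.inr (l, 0))) (w (Sum.inr (l, 1)))) v := by
    intro s
    induction s using Finset.induction_on with
    | empty => simp only [Finset.notMem_empty, if_false]; rfl
    | insert l s hl ih =>
      rw [ih]
      have hij : (Sum.inr (l, 0) : Fin 1 ⊕ (Fin m × Fin 2)) ≠ Sum.inr (l, 1) := by simp
      refine altSum_eq_of_swap hij (fun w => ?_) v
      have hR : ∀ (i : Fin m) (j : Fin 2), i ∈ Finset.univ.erase l →
          Equiv.swap (Sum.inr (l, 0) : Fin 1 ⊕ (Fin m × Fin 2)) (Sum.inr (l, 1))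
            (Sum.inr (i, j)) = Sum.inr (i, j) := by
        intro i j hi
        have := Finset.ne_of_mem_erase hi
        exact Equiv.swap_apply_of_ne_of_ne (by simp [this]) (by simp [this])
      have e0 : Equiv.swap (Sum.inr (l, 0) : Fin 1 ⊕ (Fin m × Fin 2)) (Sum.inr (l, 1))
          (Sum.inl 0) = Sum.inl 0 := Equiv.swap_apply_of_ne_of_ne (by simp) (by simp)
      simp only [← Finset.mul_prod_erase _ _ (Finset.mem_univ l), Function.comp_apply, e0,
        Equiv.swap_apply_left, Equiv.swap_apply_right, hl, if_false, Finset.mem_insert_self,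
        if_true]
      have hc : ∀ G : Fin m → ℝ, (∀ i ∈ Finset.univ.erase l, G i = if i ∈ s then
          4 * (x i.castSucc (w (Sum.inr (i, 0))) * y i.castSucc (w (Sum.inr (i, 1)))) else
          planeForm (x i.castSucc) (y i.castSucc) (w (Sum.inr (i, 0))) (w (Sum.inr (i, 1)))) →
          ∏ i ∈ Finset.univ.erase l, G i = ∏ i ∈ Finset.univ.erase l, if i ∈ s then
          4 * (x i.castSucc (w (Sum.inr (i, 0))) * y i.castSucc (w (Sum.inr (i, 1)))) else
          planeForm (x i.castSucc) (y i.castSucc) (w (Sum.inr (i, 0))) (w (Sum.inr (i, 1))) :=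
        fun G hG => Finset.prod_congr rfl hG
      rw [hc (fun i => if i ∈ insert l s then 4 * (x i.castSucc (w (Sum.inr (i, 0))) *
          y i.castSucc (w (Sum.inr (i, 1)))) else _)
        (fun i hi => by simp [Finset.ne_of_mem_erase hi]),
        hc (fun i => if i ∈ insert l s then 4 * (x i.castSucc (w (Equiv.swap (Sum.inr (l, 0))
          (Sum.inr (l, 1)) (Sum.inr (i, 0)))) * y i.castSucc (w (Equiv.swap (Sum.inr (l, 0))
          (Sum.inr (l, 1)) (Sum.inr (i, 1))))) else _)
        (fun i hi => by simp [Finset.ne_of_mem_erase hi, hR i _ hi]),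
        hc (fun i => if i ∈ s then 4 * (x i.castSucc (w (Equiv.swap (Sum.inr (l, 0))
          (Sum.inr (l, 1)) (Sum.inr (i, 0)))) * y i.castSucc (w (Equiv.swap (Sum.inr (l, 0))
          (Sum.inr (l, 1)) (Sum.inr (i, 1))))) else _)
        (fun i hi => by simp [hR i _ hi])]
      simp only [planeForm]
      ring
  rw [hU Finset.univ]
  simp only [Finset.mem_univ, if_true, Finset.prod_mul_distrib, Finset.prod_const,
    Finset.card_univ, Fintype.card_fin]
  -- What remains is a product of `1`-forms, whose antisymmetrization is a determinant.
  let f : Fin 1 ⊕ (Fin m × Fin 2) → V → ℝ := Sum.elim (fun _ => x (Fin.last m))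
    fun p => if p.2 = 0 then x p.1.castSucc else y p.1.castSucc
  have hf : ∀ i j, f i (v j) =
      (1 : Matrix (Fin 1 ⊕ (Fin m × Fin 2)) (Fin 1 ⊕ (Fin m × Fin 2)) ℝ) j i := by
    rintro (i | ⟨i, s⟩) (j | ⟨j, t⟩)
    · fin_cases i; fin_cases j; simp [f, hx0]
    · fin_cases i; fin_cases t <;> simp [f, hx1, hx2, (Fin.castSucc_lt_last _).ne']
    · fin_cases j; fin_cases s <;> simp [f, hx0, hy0, (Fin.castSucc_lt_last _).ne]
    · fin_cases s <;> fin_cases t <;>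
        simp [f, hx1, hx2, hy1, hy2, Matrix.one_apply, eq_comm]
  have hprod : (fun w : Fin 1 ⊕ (Fin m × Fin 2) → V => x (Fin.last m) (w (Sum.inl 0)) *
      (4 ^ m * ((∏ l, x l.castSucc (w (Sum.inr (l, 0)))) *
        ∏ l, y l.castSucc (w (Sum.inr (l, 1)))))) = fun w => 4 ^ m * ∏ i, f i (w i) := by
    funext w
    simp only [Fintype.prod_sum_type, Fintype.prod_prod_type, Fin.prod_univ_two, f, Sum.elim_inl,
      Sum.elim_inr, if_true, one_ne_zero, if_false, Finset.prod_mul_distrib, Finset.univ_unique,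
      Finset.prod_singleton, Fin.default_eq_zero]
    ring
  rw [hprod, altSum_mul_left]
  have hdet : altSum (fun w => ∏ i, f i (w i)) v =
      (1 : Matrix (Fin 1 ⊕ (Fin m × Fin 2)) (Fin 1 ⊕ (Fin m × Fin 2)) ℝ).det := by
    rw [Matrix.det_apply', altSum]
    simp only [Function.comp_apply, hf]
  rw [hdet, Matrix.det_one, mul_one]

/-- The form `x ∧ (2 ∑ a x ∧ y)ᵐ`, where the first factor is the last of the `1`-forms `x`, is
positive on a dual basis: all the surviving terms of its expansion are equal to `4 ^ m` times
a product of weights. -/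
lemma altSum_planePow_pos (a : Fin (m + 1) → ℝ) (ha : ∀ k, 0 < a k)
    (v : Fin 1 ⊕ (Fin m × Fin 2) → V)
    (hx0 : ∀ k, x k (v (Sum.inl 0)) = if k = Fin.last m then 1 else 0)
    (hy0 : ∀ k, y k (v (Sum.inl 0)) = 0)
    (hx1 : ∀ k l, x k (v (Sum.inr (l, 0))) = if k = l.castSucc then 1 else 0)
    (hy1 : ∀ k l, y k (v (Sum.inr (l, 0))) = 0)
    (hx2 : ∀ k l, x k (v (Sum.inr (l, 1))) = 0)
    (hy2 : ∀ k l, y k (v (Sum.inr (l, 1))) = if k = l.castSucc then 1 else 0) :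
    0 < altSum (fun w => x (Fin.last m) (w (Sum.inl 0)) *
        ∏ l, ∑ k, a k * planeForm (x k) (y k) (w (Sum.inr (l, 0))) (w (Sum.inr (l, 1)))) v := by
  have hc := altSum_planeMonomial_castSucc x y v hx0 hy0 hx1 hy1 hx2 hy2
  simp_rw [prod_sum_planeForm x y (fun _ k => a k)]
  rw [altSum_sum]
  simp_rw [altSum_mul_left]
  refine Finset.sum_pos' (fun κ _ => ?_) ⟨Fin.castSucc, Finset.mem_univ _, ?_⟩
  · refine mul_nonneg (Finset.prod_nonneg fun l _ => (ha _).le) ?_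
    rcases altSum_planeMonomial_eq_zero_or x y κ with h | ⟨π, hπ⟩
    · rw [h]
    · rw [show κ = fun l => (π l).castSucc from funext hπ, altSum_planeMonomial_perm, hc]
      positivity
  · rw [hc]
    exact mul_pos (Finset.prod_pos fun l _ => ha _) (by positivity)

end PlaneForm

/-! ### Exterior derivatives of pulled back invariant forms -/

section PulledBack

variable {E : Type*} [NormedAddCommGroup E] [NormedSpace ℝ E]
  {𝔤 : Type*} [NormedAddCommGroup 𝔤] [NormedSpace ℝ 𝔤] {m : ℕ}

/-- The structure equations, at the point `x₀`, of a `1`-form `P` on `E` with values in `𝔤`, in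
terms of real coordinates `ξ₁, υ₁, …, ξₘ₊₁, υₘ₊₁` on `𝔤`: all the real `1`-forms `ξ ∘ P`, `υ ∘ P`
are closed at `x₀` except the last one, for which `d(υₘ₊₁ ∘ P) = -2 ∑ b ξ ∧ υ`. -/
structure StructureEquationsAt (P : E → E →L[ℝ] 𝔤) (x₀ : E) (ξ υ : Fin (m + 1) → 𝔤 →L[ℝ] ℝ)
    (b : Fin (m + 1) → ℝ) : Prop where
  differentiableAt : DifferentiableAt ℝ P x₀
  left : ∀ k u p, ξ k (fderiv ℝ P x₀ u p) - ξ k (fderiv ℝ P x₀ p u) = 0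
  right : ∀ (r : Fin m) u p,
    υ r.castSucc (fderiv ℝ P x₀ u p) - υ r.castSucc (fderiv ℝ P x₀ p u) = 0
  last : ∀ u p, υ (Fin.last m) (fderiv ℝ P x₀ u p) - υ (Fin.last m) (fderiv ℝ P x₀ p u) =
    -∑ k, b k * planeForm (ξ k) (υ k) (P x₀ u) (P x₀ p)

/-- The `2`-form `2 ∑ a ξ ∧ υ` as a function of two vectors. -/
def diagForm (ξ υ : Fin (m + 1) → 𝔤 →L[ℝ] ℝ) (a : Fin (m + 1) → ℝ) (p q : 𝔤) : ℝ :=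
  ∑ k, a k * planeForm (ξ k) (υ k) p q

/-- The derivative in the direction `u` of the pullback by `P` of a diagonal `2`-form. -/
def diagFormDeriv (ξ υ : Fin (m + 1) → 𝔤 →L[ℝ] ℝ) (a : Fin (m + 1) → ℝ) (P : E → E →L[ℝ] 𝔤)
    (x₀ : E) (u p q : E) : ℝ :=
  diagForm ξ υ a (fderiv ℝ P x₀ u p) (P x₀ q) + diagForm ξ υ a (P x₀ p) (fderiv ℝ P x₀ u q)

variable {P : E → E →L[ℝ] 𝔤} {x₀ : E} {ξ υ : Fin (m + 1) → 𝔤 →L[ℝ] ℝ} {b : Fin (m + 1) → ℝ}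

lemma hasFDerivAt_diagForm (hP : DifferentiableAt ℝ P x₀) (a : Fin (m + 1) → ℝ) (p q : E) :
    ∃ L : E →L[ℝ] ℝ, HasFDerivAt (fun y => diagForm ξ υ a (P y p) (P y q)) L x₀ ∧
      ∀ u, L u = diagFormDeriv ξ υ a P x₀ u p q := by
  have h : ∀ (ζ : 𝔤 →L[ℝ] ℝ) (p : E), HasFDerivAt (fun y => ζ (P y p))
      (ζ.comp ((fderiv ℝ P x₀).flip p)) x₀ := fun ζ p =>
    ζ.hasFDerivAt.comp x₀ (((ContinuousLinearMap.apply ℝ 𝔤 p).hasFDerivAt).comp x₀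
      hP.hasFDerivAt)
  refine ⟨_, HasFDerivAt.fun_sum fun k _ => ((((h (ξ k) p).mul (h (υ k) q)).sub
    ((h (υ k) p).mul (h (ξ k) q))).const_mul 2).const_mul (a k), fun u => ?_⟩
  simp only [_root_.sum_apply, diagFormDeriv, diagForm, ← Finset.sum_add_distrib,
    planeForm]
  refine Finset.sum_congr rfl fun k _ => ?_
  simp
  ring

/-- The exterior derivative of a diagonal `2`-form `ω` is `θ ∧ ∑ 2 b ξ ∧ υ`, where `θ` is twice
the product of the last coefficient of `ω` and the last of the `1`-forms `ξ`. -/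
lemma StructureEquationsAt.diagFormDeriv_cyclic (h : StructureEquationsAt P x₀ ξ υ b)
    (a : Fin (m + 1) → ℝ) (u p q : E) :
    diagFormDeriv ξ υ a P x₀ u p q - diagFormDeriv ξ υ a P x₀ p u q +
        diagFormDeriv ξ υ a P x₀ q u p =
      2 * a (Fin.last m) * (ξ (Fin.last m) (P x₀ u) * diagForm ξ υ b (P x₀ p) (P x₀ q) -
        ξ (Fin.last m) (P x₀ p) * diagForm ξ υ b (P x₀ u) (P x₀ q) +
        ξ (Fin.last m) (P x₀ q) * diagForm ξ υ b (P x₀ u) (P x₀ p)) := by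
  have h1 : ∀ k, (a k * planeForm (ξ k) (υ k) (fderiv ℝ P x₀ u p) (P x₀ q) +
        a k * planeForm (ξ k) (υ k) (P x₀ p) (fderiv ℝ P x₀ u q)) -
      (a k * planeForm (ξ k) (υ k) (fderiv ℝ P x₀ p u) (P x₀ q) +
        a k * planeForm (ξ k) (υ k) (P x₀ u) (fderiv ℝ P x₀ p q)) +
      (a k * planeForm (ξ k) (υ k) (fderiv ℝ P x₀ q u) (P x₀ p) +
        a k * planeForm (ξ k) (υ k) (P x₀ u) (fderiv ℝ P x₀ q p)) =
      2 * a k * (-(υ k (fderiv ℝ P x₀ u p) - υ k (fderiv ℝ P x₀ p u)) * ξ k (P x₀ q) +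
        (υ k (fderiv ℝ P x₀ u q) - υ k (fderiv ℝ P x₀ q u)) * ξ k (P x₀ p) -
        (υ k (fderiv ℝ P x₀ p q) - υ k (fderiv ℝ P x₀ q p)) * ξ k (P x₀ u)) := by
    intro k
    simp only [planeForm]
    linear_combination 2 * a k * (υ k (P x₀ q) * h.left k u p - υ k (P x₀ p) * h.left k u q +
      υ k (P x₀ u) * h.left k p q)
  simp only [diagFormDeriv]
  simp only [diagForm]
  simp only [← Finset.sum_add_distrib, ← Finset.sum_sub_distrib]
  rw [Finset.sum_congr rfl fun k _ => h1 k, Fin.sum_univ_castSucc]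
  simp only [h.right, h.last, neg_zero, zero_mul, add_zero, sub_zero, mul_zero,
    Finset.sum_const_zero, zero_add]
  ring

lemma differentiableAt_compContinuousLinearMap {F : Type*} [NormedAddCommGroup F]
    [NormedSpace ℝ F] {k : ℕ} (hP : DifferentiableAt ℝ P x₀) (η : 𝔤 [⋀^Fin k]→L[ℝ] F) :
    DifferentiableAt ℝ (fun y => η.compContinuousLinearMap (P y)) x₀ :=
  ((hasFDerivAt_const η x₀).continuousAlternatingMapCompContinuousLinearMap
    hP.hasFDerivAt).differentiableAt

/-- The Leibniz rule for the powers of a diagonal `2`-form. -/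
lemma extDeriv_wedgePow_diagForm (hP : DifferentiableAt ℝ P x₀) (a : Fin (m + 1) → ℝ)
    {η : 𝔤 [⋀^Fin 2]→L[ℝ] ℝ} (hη : ∀ v, η v = diagForm ξ υ a (v 0) (v 1)) (N : ℕ)
    (v : Fin (2 * N + 1) → E) :
    extDeriv (fun y => (wedgePow η N).compContinuousLinearMap (P y)) x₀ v =
      (2 ^ N : ℝ)⁻¹ * ∑ l, altSum (fun w : Fin 1 ⊕ (Fin N × Fin 2) → E =>
        diagFormDeriv ξ υ a P x₀ (w (Sum.inl 0)) (w (Sum.inr (l, 0))) (w (Sum.inr (l, 1))) *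
          ∏ l' ∈ Finset.univ.erase l,
            diagForm ξ υ a (P x₀ (w (Sum.inr (l', 0)))) (P x₀ (w (Sum.inr (l', 1)))))
        (v ∘ onePairsEquiv N) := by
  let T : E → (Fin N × Fin 2 → E) → ℝ := fun u w =>
    ∑ l, diagFormDeriv ξ υ a P x₀ u (w (l, 0)) (w (l, 1)) * ∏ l' ∈ Finset.univ.erase l,
      diagForm ξ υ a (P x₀ (w (l', 0))) (P x₀ (w (l', 1)))
  have hpow : ∀ (y : E) (w : Fin (2 * N) → E),
      (wedgePow η N).compContinuousLinearMap (P y) w = (2 ^ N : ℝ)⁻¹ *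
        ∑ σ : Equiv.Perm (Fin N × Fin 2), ((Equiv.Perm.sign σ : ℤ) : ℝ) *
          ∏ l, diagForm ξ υ a (P y ((w ∘ pairsEquiv N) (σ (l, 0))))
            (P y ((w ∘ pairsEquiv N) (σ (l, 1)))) := by
    intro y w
    rw [ContinuousAlternatingMap.compContinuousLinearMap_apply, wedgePow_eq_altSum, altSum]
    simp [hη]
  have hderiv : ∀ (u : E) (w : Fin (2 * N) → E),
      fderiv ℝ (fun y => (wedgePow η N).compContinuousLinearMap (P y) w) x₀ u =
        (2 ^ N : ℝ)⁻¹ * altSum (T u) (w ∘ pairsEquiv N) := by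
    intro u w
    choose L hL hLu using fun p q => hasFDerivAt_diagForm (ξ := ξ) (υ := υ) hP a p q
    have h1 := (HasFDerivAt.fun_sum (u := (Finset.univ : Finset (Equiv.Perm (Fin N × Fin 2))))
      fun σ _ => (HasFDerivAt.finsetProd (u := (Finset.univ : Finset (Fin N)))
        fun l _ => hL ((w ∘ pairsEquiv N) (σ (l, 0))) ((w ∘ pairsEquiv N) (σ (l, 1)))).const_mul
          ((Equiv.Perm.sign σ : ℤ) : ℝ)).const_mul (2 ^ N : ℝ)⁻¹
    simp_rw [hpow]
    rw [h1.fderiv]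
    simp only [_root_.smul_apply, _root_.sum_apply, smul_eq_mul, hLu, altSum, T,
      Function.comp_apply]
    congr 1
    refine Finset.sum_congr rfl fun σ _ => ?_
    congr 1
    exact Finset.sum_congr rfl fun l _ => mul_comm _ _
  rw [extDeriv_apply (differentiableAt_compContinuousLinearMap hP _)]
  simp only [hderiv, zsmul_eq_mul, Int.cast_pow, Int.cast_neg, Int.cast_one,
    mul_left_comm _ (2 ^ N : ℝ)⁻¹]
  rw [← Finset.mul_sum, ← altSum_sum]
  congr 1
  have h2 := altSum_succ (fun u (w : Fin (2 * N) → E) => T u (w ∘ pairsEquiv N)) v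
  simp only [altSum_equiv] at h2
  rw [← h2, ← altSum_equiv]
  congr 1
  funext w
  simp only [T, Function.comp_apply, onePairsEquiv_inl, onePairsEquiv_inr]

/-- For a diagonal `2`-form `ω = 2 ∑ a ξ ∧ υ` on a space of dimension `m + 1` over the complex
numbers, `d(ωᵐ) = t ξₘ₊₁ ∧ ωᵐ` with `t = 2 aₘ₊₁ ∑ b / a`. -/
lemma StructureEquationsAt.extDeriv_wedgePow (h : StructureEquationsAt P x₀ ξ υ b)
    (hb : b (Fin.last m) = 0) (a : Fin (m + 1) → ℝ) (ha : ∀ k, a k ≠ 0)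
    {η : 𝔤 [⋀^Fin 2]→L[ℝ] ℝ} (hη : ∀ v, η v = diagForm ξ υ a (v 0) (v 1))
    (v : Fin (2 * m + 1) → E) :
    extDeriv (fun y => (wedgePow η m).compContinuousLinearMap (P y)) x₀ v =
      (2 ^ m : ℝ)⁻¹ * ((2 * a (Fin.last m) * ∑ k, b k / a k) *
        altSum (fun w : Fin 1 ⊕ (Fin m × Fin 2) → E => ξ (Fin.last m) (P x₀ (w (Sum.inl 0))) *
          ∏ l, diagForm ξ υ a (P x₀ (w (Sum.inr (l, 0)))) (P x₀ (w (Sum.inr (l, 1)))))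
        (v ∘ onePairsEquiv m)) := by
  rw [extDeriv_wedgePow_diagForm h.differentiableAt a hη]
  congr 1
  have h1 : ∀ l, altSum (fun w : Fin 1 ⊕ (Fin m × Fin 2) → E =>
        diagFormDeriv ξ υ a P x₀ (w (Sum.inl 0)) (w (Sum.inr (l, 0))) (w (Sum.inr (l, 1))) *
          ∏ l' ∈ Finset.univ.erase l,
            diagForm ξ υ a (P x₀ (w (Sum.inr (l', 0)))) (P x₀ (w (Sum.inr (l', 1)))))
        (v ∘ onePairsEquiv m) =
      2 * a (Fin.last m) * altSum (fun w : Fin 1 ⊕ (Fin m × Fin 2) → E =>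
        ξ (Fin.last m) (P x₀ (w (Sum.inl 0))) *
          diagForm ξ υ b (P x₀ (w (Sum.inr (l, 0)))) (P x₀ (w (Sum.inr (l, 1)))) *
          ∏ l' ∈ Finset.univ.erase l,
            diagForm ξ υ a (P x₀ (w (Sum.inr (l', 0)))) (P x₀ (w (Sum.inr (l', 1)))))
        (v ∘ onePairsEquiv m) := by
    intro l
    rw [altSum_mul_prod_erase_congr l (K := diagFormDeriv ξ υ a P x₀)
      (K' := fun u p q => 2 * a (Fin.last m) * (ξ (Fin.last m) (P x₀ u) *
        diagForm ξ υ b (P x₀ p) (P x₀ q)))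
      (fun u p q => by rw [h.diagFormDeriv_cyclic a]; ring)
      (fun _ p q => diagForm ξ υ a (P x₀ p) (P x₀ q)), ← altSum_mul_left]
    congr 1
    funext w
    ring
  rw [Finset.sum_congr rfl fun l _ => h1 l, ← Finset.mul_sum, mul_assoc (2 * a (Fin.last m))]
  congr 1
  exact altSum_sum_replace (fun k p => ξ k (P x₀ p)) (fun k p => υ k (P x₀ p)) a b ha hb _

lemma wedge_wedgePow_diagForm (L : E →L[ℝ] 𝔤) (a : Fin (m + 1) → ℝ) (t : ℝ)
    {η : 𝔤 [⋀^Fin 2]→L[ℝ] ℝ} (hη : ∀ v, η v = diagForm ξ υ a (v 0) (v 1))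
    {θ : 𝔤 [⋀^Fin 1]→L[ℝ] ℝ} (hθ : ∀ v, θ v = t * ξ (Fin.last m) (v 0))
    (v : Fin (2 * m + 1) → E) :
    wedge (θ.compContinuousLinearMap L) (wedgePow (η.compContinuousLinearMap L) m)
        (v ∘ Fin.cast (Nat.add_comm _ _)) =
      (2 ^ m : ℝ)⁻¹ * (t *
        altSum (fun w : Fin 1 ⊕ (Fin m × Fin 2) → E => ξ (Fin.last m) (L (w (Sum.inl 0))) *
          ∏ l, diagForm ξ υ a (L (w (Sum.inr (l, 0)))) (L (w (Sum.inr (l, 1)))))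
        (v ∘ onePairsEquiv m)) := by
  rw [wedge_wedgePow_eq_altSum]
  congr 1
  rw [← altSum_mul_left]
  congr 1
  funext w
  simp [hθ, hη, mul_assoc]

/-- The exterior derivative of the product of a function and a diagonal `2`-form. -/
lemma StructureEquationsAt.extDeriv_smul (h : StructureEquationsAt P x₀ ξ υ b)
    (a : Fin (m + 1) → ℝ) {η : 𝔤 [⋀^Fin 2]→L[ℝ] ℝ} (hη : ∀ v, η v = diagForm ξ υ a (v 0) (v 1))
    {f : E → ℝ} (hf : DifferentiableAt ℝ f x₀) (u p q : E) :
    extDeriv (fun y => f y • η.compContinuousLinearMap (P y)) x₀ ![u, p, q] =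
      (fderiv ℝ f x₀ u * diagForm ξ υ a (P x₀ p) (P x₀ q) -
        fderiv ℝ f x₀ p * diagForm ξ υ a (P x₀ u) (P x₀ q) +
        fderiv ℝ f x₀ q * diagForm ξ υ a (P x₀ u) (P x₀ p)) +
      f x₀ * (2 * a (Fin.last m) * (ξ (Fin.last m) (P x₀ u) * diagForm ξ υ b (P x₀ p) (P x₀ q) -
        ξ (Fin.last m) (P x₀ p) * diagForm ξ υ b (P x₀ u) (P x₀ q) +
        ξ (Fin.last m) (P x₀ q) * diagForm ξ υ b (P x₀ u) (P x₀ p))) := by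
  have hd : ∀ (w : Fin 2 → E) (z : E),
      fderiv ℝ (fun y => (f y • η.compContinuousLinearMap (P y)) w) x₀ z =
        fderiv ℝ f x₀ z * diagForm ξ υ a (P x₀ (w 0)) (P x₀ (w 1)) +
        f x₀ * diagFormDeriv ξ υ a P x₀ z (w 0) (w 1) := by
    intro w z
    obtain ⟨L, hL, hLu⟩ :=
      hasFDerivAt_diagForm (ξ := ξ) (υ := υ) h.differentiableAt a (w 0) (w 1)
    have h1 : (fun y => (f y • η.compContinuousLinearMap (P y)) w) =
        fun y => f y * diagForm ξ υ a (P y (w 0)) (P y (w 1)) := by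
      funext y
      simp [hη]
    rw [h1, (hf.hasFDerivAt.fun_mul hL).fderiv]
    simp [hLu]
    ring
  rw [extDeriv_apply (hf.fun_smul (differentiableAt_compContinuousLinearMap h.differentiableAt η)),
    ← h.diagFormDeriv_cyclic a]
  have h3 : ∀ F : Fin (2 + 1) → ℝ, ∑ i, F i = F 0 + F 1 + F 2 := fun F => Fin.sum_univ_three F
  have e1 : (1 : Fin (2 + 1)).succAbove 1 = 2 := rfl
  have e2 : (2 : Fin (2 + 1)).succAbove 1 = 1 := rfl
  have e3 : (2 : Fin (2 + 1)).succAbove 0 = 0 := rfl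
  simp only [hd]
  rw [h3]
  simp [Fin.removeNth, e1, e2, e3]
  ring

end PulledBack

/-! ### The Maurer-Cartan form in charts -/

section MaurerCartan

variable {E : Type*} [NormedAddCommGroup E] [NormedSpace ℝ E]

section Manifold

variable {M N N' : Type*} [TopologicalSpace M] [ChartedSpace E M] [TopologicalSpace N]
  [ChartedSpace E N] [TopologicalSpace N'] [ChartedSpace E N']

/-- The differential of a map between manifolds modelled on `E`, as an endomorphism of `E`: the
tangent space at a point is identified with `E` by the preferred chart at this point. -/
def modelDeriv (f : M → N) (x : M) : E →L[ℝ] E := mfderiv 𝓘(ℝ, E) 𝓘(ℝ, E) f x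

lemma modelDeriv_comp {g : N → N'} {f : M → N} {x : M}
    (hg : MDifferentiableAt 𝓘(ℝ, E) 𝓘(ℝ, E) g (f x))
    (hf : MDifferentiableAt 𝓘(ℝ, E) 𝓘(ℝ, E) f x) :
    modelDeriv (E := E) (g ∘ f) x = (modelDeriv g (f x)).comp (modelDeriv f x) :=
  mfderiv_comp x hg hf

lemma modelDeriv_id (x : M) : modelDeriv (E := E) (id : M → M) x = ContinuousLinearMap.id ℝ E :=
  mfderiv_id

lemma modelDeriv_eq_fderiv (f : E → E) (x : E) : modelDeriv f x = fderiv ℝ f x :=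
  mfderiv_eq_fderiv

lemma modelDeriv_congr {f g : M → N} {x : M} (h : f =ᶠ[nhds x] g) :
    modelDeriv (E := E) f x = modelDeriv g x := h.mfderiv_eq

/-- The expression in the chart at `x₀` of a `1`-form on a manifold. -/
def chartExpr (β : M → E →L[ℝ] E) (x₀ : M) (y : E) : E →L[ℝ] E :=
  (β ((extChartAt 𝓘(ℝ, E) x₀).symm y)).comp (modelDeriv (extChartAt 𝓘(ℝ, E) x₀).symm y)

variable [IsManifold 𝓘(ℝ, E) ∞ M]

lemma contMDiffAt_extChartAt_symm {x₀ : M} {y : E} (hy : y ∈ (extChartAt 𝓘(ℝ, E) x₀).target) :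
    ContMDiffAt 𝓘(ℝ, E) 𝓘(ℝ, E) ∞ (extChartAt 𝓘(ℝ, E) x₀).symm y :=
  (contMDiffOn_extChartAt_symm x₀).contMDiffAt (extChartAt_target_mem_nhds' hy)

lemma modelDeriv_extChartAt_symm_self (x : M) :
    modelDeriv (extChartAt 𝓘(ℝ, E) x).symm (extChartAt 𝓘(ℝ, E) x x) =
      ContinuousLinearMap.id ℝ E := by
  have : IsManifold 𝓘(ℝ, E) 1 M := IsManifold.of_le (n := ∞) (by norm_num)
  have h := mfderivWithin_range_extChartAt_symm (I := 𝓘(ℝ, E)) (x := x)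
  rw [ModelWithCorners.range_eq_univ, mfderivWithin_univ] at h
  exact h

lemma modelDeriv_extChartAt_self (x : M) :
    modelDeriv (extChartAt 𝓘(ℝ, E) x) x = ContinuousLinearMap.id ℝ E := by
  have : IsManifold 𝓘(ℝ, E) 1 M := IsManifold.of_le (n := ∞) (by norm_num)
  exact mfderiv_extChartAt_self (I := 𝓘(ℝ, E)) (x := x)

lemma chartExpr_self (β : M → E →L[ℝ] E) (x : M) :
    chartExpr β x (extChartAt 𝓘(ℝ, E) x x) = β x := by
  rw [chartExpr, modelDeriv_extChartAt_symm_self, extChartAt_to_inv, ContinuousLinearMap.comp_id]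

end Manifold

variable {G : Type*} [TopologicalSpace G] [ChartedSpace E G] [Group G] [LieGroup 𝓘(ℝ, E) ∞ G]

/-- The Maurer-Cartan form of a Lie group: the left translation of tangent vectors to the
identity. -/
def maurerCartan (g : G) : E →L[ℝ] E := modelDeriv (fun b : G => g⁻¹ * b) g

variable (E) in
lemma mdifferentiableAt_leftMul (a b : G) :
    MDifferentiableAt 𝓘(ℝ, E) 𝓘(ℝ, E) (fun b : G => a * b) b :=
  (contMDiff_mul_left (I := 𝓘(ℝ, E)) (n := ∞) (a := a)).mdifferentiableAt (by simp)

lemma maurerCartan_comp_modelDeriv {h : E → G} {y : E}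
    (hh : MDifferentiableAt 𝓘(ℝ, E) 𝓘(ℝ, E) h y) :
    (maurerCartan (h y)).comp (modelDeriv h y) =
      fderiv ℝ (fun z => extChartAt 𝓘(ℝ, E) (1 : G) ((h y)⁻¹ * h z)) y := by
  have hm := mdifferentiableAt_leftMul E (h y)⁻¹ (h y)
  have h1 : (h y)⁻¹ * h y = 1 := inv_mul_cancel _
  have hc : MDifferentiableAt 𝓘(ℝ, E) 𝓘(ℝ, E) (extChartAt 𝓘(ℝ, E) (1 : G)) ((h y)⁻¹ * h y) := by
    rw [h1]
    exact (contMDiffAt_extChartAt (n := ∞)).mdifferentiableAt (by simp)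
  rw [← modelDeriv_eq_fderiv]
  change _ = modelDeriv (extChartAt 𝓘(ℝ, E) (1 : G) ∘ ((fun b => (h y)⁻¹ * b) ∘ h)) y
  rw [modelDeriv_comp (f := (fun b => (h y)⁻¹ * b) ∘ h) hc (hm.comp y hh),
    modelDeriv_comp (g := fun b => (h y)⁻¹ * b) hm hh, Function.comp_apply, h1,
    modelDeriv_extChartAt_self, ContinuousLinearMap.id_comp]
  rfl

lemma contDiffAt_chartExpr_maurerCartan {g₀ : G} {y₀ : E}
    (hy₀ : y₀ ∈ (extChartAt 𝓘(ℝ, E) g₀).target) :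
    ContDiffAt ℝ ∞ (chartExpr (maurerCartan (E := E) (G := G)) g₀) y₀ := by
  have hev : chartExpr (maurerCartan (E := E) (G := G)) g₀ =ᶠ[nhds y₀] fun y =>
      fderiv ℝ ((fun y z => extChartAt 𝓘(ℝ, E) (1 : G)
        (((extChartAt 𝓘(ℝ, E) g₀).symm y)⁻¹ * (extChartAt 𝓘(ℝ, E) g₀).symm z)) y) (id y) := by
    filter_upwards [extChartAt_target_mem_nhds' hy₀] with y hy
    exact maurerCartan_comp_modelDeriv
      ((contMDiffAt_extChartAt_symm hy).mdifferentiableAt (by simp))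
  refine ContDiffAt.congr_of_eventuallyEq ?_ hev
  refine ContDiffAt.fderiv (n := ∞) ?_ contDiffAt_id (by simp)
  rw [← contMDiffAt_iff_contDiffAt]
  have hs := contMDiffAt_extChartAt_symm hy₀
  have h1 : ContMDiffAt 𝓘(ℝ, E × E) 𝓘(ℝ, E) ∞
      (fun p : E × E => (extChartAt 𝓘(ℝ, E) g₀).symm p.1) (y₀, id y₀) :=
    ContMDiffAt.comp (y₀, id y₀) (g := (extChartAt 𝓘(ℝ, E) g₀).symm) (f := Prod.fst) hs
      contDiff_fst.contMDiff.contMDiffAt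
  have h2 : ContMDiffAt 𝓘(ℝ, E × E) 𝓘(ℝ, E) ∞
      (fun p : E × E => (extChartAt 𝓘(ℝ, E) g₀).symm p.2) (y₀, id y₀) :=
    ContMDiffAt.comp (y₀, id y₀) (g := (extChartAt 𝓘(ℝ, E) g₀).symm) (f := Prod.snd) hs
      contDiff_snd.contMDiff.contMDiffAt
  have h3 := h1.inv.mul h2
  refine ContMDiffAt.comp (y₀, id y₀) (g := extChartAt 𝓘(ℝ, E) (1 : G))
    (f := fun p : E × E => ((extChartAt 𝓘(ℝ, E) g₀).symm p.1)⁻¹ *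
      (extChartAt 𝓘(ℝ, E) g₀).symm p.2) ?_ h3
  simp only [id, inv_mul_cancel]
  exact contMDiffAt_extChartAt

lemma maurerCartan_mul_left (γ g : G) :
    (maurerCartan (E := E) (γ * g)).comp (modelDeriv (fun b : G => γ * b) g) =
      maurerCartan g := by
  rw [maurerCartan, ← modelDeriv_comp (mdifferentiableAt_leftMul E _ _)
    (mdifferentiableAt_leftMul E _ _), maurerCartan]
  congr 1
  funext b
  simp [mul_assoc]

/-- The value at `g` of the left-invariant vector field with value `v` at the identity. -/
def invariantField (v : E) (g : G) : E := modelDeriv (fun b : G => g * b) 1 v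

lemma maurerCartan_invariantField (g : G) (v : E) :
    maurerCartan g (invariantField v g) = v := by
  have h : (maurerCartan g).comp (modelDeriv (fun b : G => g * b) 1) =
      ContinuousLinearMap.id ℝ E := by
    have h1 := maurerCartan_mul_left (E := E) g (1 : G)
    rw [mul_one] at h1
    rw [h1, maurerCartan, ← modelDeriv_id (1 : G)]
    congr 1
    funext b
    simp
  exact DFunLike.congr_fun h v

lemma invariantField_maurerCartan (g : G) (v : E) :
    invariantField (maurerCartan g v) g = v := by
  have h : (modelDeriv (fun b : G => g * b) 1).comp (maurerCartan g) =
      ContinuousLinearMap.id ℝ E := by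
    have h1 := modelDeriv_comp (x := g) (mdifferentiableAt_leftMul E g (g⁻¹ * g))
      (mdifferentiableAt_leftMul E g⁻¹ g)
    rw [inv_mul_cancel] at h1
    rw [maurerCartan, ← h1, ← modelDeriv_id g]
    congr 1
    funext b
    simp
  exact DFunLike.congr_fun h v

end MaurerCartan

/-! ### The Maurer-Cartan form of a complex nilmanifold -/

section Coordinates

variable {E : Type*} [NormedAddCommGroup E] [NormedSpace ℝ E]
  {𝔤 : Type*} [NormedAddCommGroup 𝔤] [NormedSpace ℝ 𝔤] {m : ℕ}

/-- The real coordinate given by a complex `1`-form followed by `L` (the real or the imaginary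
part). -/
def realCoord (L : ℂ →L[ℝ] ℝ) (α : 𝔤 [⋀^Fin 1]→L[ℝ] ℂ) : 𝔤 →L[ℝ] ℝ :=
  L.comp ((ContinuousAlternatingMap.ofSubsingletonLIE
    (𝕜 := ℝ) (E := 𝔤) (F := ℂ) (0 : Fin 1)).symm α)

lemma realCoord_apply (L : ℂ →L[ℝ] ℝ) (α : 𝔤 [⋀^Fin 1]→L[ℝ] ℂ) (v : 𝔤) :
    realCoord L α v = L (α fun _ => v) := rfl

/-- The exterior derivative of the pullback of a `1`-form on `𝔤` by a `1`-form with values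
in `𝔤`. -/
lemma extDeriv_oneForm_compContinuousLinearMap {F : Type*} [NormedAddCommGroup F]
    [NormedSpace ℝ F] {P : E → E →L[ℝ] 𝔤} {x₀ : E} (hP : DifferentiableAt ℝ P x₀)
    (α : 𝔤 [⋀^Fin 1]→L[ℝ] F) (u p : E) :
    extDeriv (fun y => α.compContinuousLinearMap (P y)) x₀ ![u, p] =
      α (fun _ => fderiv ℝ P x₀ u p) - α (fun _ => fderiv ℝ P x₀ p u) := by
  have hf : ∀ (w : Fin 1 → E) (z : E),
      fderiv ℝ (fun y => α.compContinuousLinearMap (P y) w) x₀ z =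
        α (fun _ => fderiv ℝ P x₀ z (w 0)) := by
    intro w z
    let A : 𝔤 →L[ℝ] F := (ContinuousAlternatingMap.ofSubsingletonLIE
      (𝕜 := ℝ) (E := 𝔤) (F := F) (0 : Fin 1)).symm α
    have hA : (fun y => α.compContinuousLinearMap (P y) w) = fun y => A (P y (w 0)) := by
      funext y
      change α _ = α _
      congr 1
      funext i
      fin_cases i
      rfl
    have hA' : HasFDerivAt (fun y => A (P y (w 0)))
        (A.comp ((fderiv ℝ P x₀).flip (w 0))) x₀ :=
      A.hasFDerivAt.comp x₀ (((ContinuousLinearMap.apply ℝ 𝔤 (w 0)).hasFDerivAt).comp x₀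
        hP.hasFDerivAt)
    rw [hA, hA'.fderiv]
    rfl
  rw [extDeriv_apply (differentiableAt_compContinuousLinearMap hP α)]
  simp only [hf]
  rw [show ∀ G : Fin (1 + 1) → F, ∑ i, G i = G 0 + G 1 from fun G => Fin.sum_univ_two G]
  simp [Fin.removeNth, sub_eq_add_neg]

/-- The complex structure equations of a coframe in real coordinates. -/
lemma structureEquationsAt_of_extDeriv {P : E → E →L[ℝ] 𝔤} {x₀ : E}
    (hP : DifferentiableAt ℝ P x₀) (α : Fin (m + 1) → 𝔤 [⋀^Fin 1]→L[ℝ] ℂ) (c : Fin m → ℚ)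
    (h0 : ∀ r : Fin m,
      extDeriv (fun y => (α r.castSucc).compContinuousLinearMap (P y)) x₀ = 0)
    (h1 : extDeriv (fun y => (α (Fin.last m)).compContinuousLinearMap (P y)) x₀ =
      (∑ r : Fin m, ((c r : ℚ) : ℂ) • wedge (α r.castSucc)
        (conjForm (α r.castSucc))).compContinuousLinearMap (P x₀)) :
    StructureEquationsAt P x₀ (fun k => realCoord Complex.reCLM (α k))
      (fun k => realCoord Complex.imCLM (α k))
      (Fin.snoc (α := fun _ => ℝ) (fun r => (c r : ℝ)) 0) := by
  have hd := fun k => extDeriv_oneForm_compContinuousLinearMap hP (α k)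
  have hw : ∀ (r : Fin m) (p q : 𝔤),
      wedge (α r.castSucc) (conjForm (α r.castSucc)) ![p, q] =
        -Complex.I * (planeForm (realCoord Complex.reCLM (α r.castSucc))
          (realCoord Complex.imCLM (α r.castSucc)) p q : ℝ) := by
    intro r p q
    rw [wedge_one_one_apply]
    simp only [conjForm, ContinuousLinearMap.compContinuousAlternatingMap_coe,
      Function.comp_apply, planeForm,
      realCoord_apply]
    apply Complex.ext <;> simp <;> ring
  have hcomp : ∀ u p : E, (fun i : Fin 2 => P x₀ (![u, p] i)) = ![P x₀ u, P x₀ p] := by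
    intro u p
    funext i
    fin_cases i <;> rfl
  have hlast : ∀ u p : E, α (Fin.last m) (fun _ => fderiv ℝ P x₀ u p) -
      α (Fin.last m) (fun _ => fderiv ℝ P x₀ p u) = -Complex.I *
        ((∑ k, Fin.snoc (α := fun _ => ℝ) (fun r => (c r : ℝ)) 0 k *
          planeForm (realCoord Complex.reCLM (α k)) (realCoord Complex.imCLM (α k))
            (P x₀ u) (P x₀ p) : ℝ) : ℂ) := by
    intro u p
    rw [← hd, h1, Fin.sum_univ_castSucc]
    simp only [ContinuousAlternatingMap.compContinuousLinearMap_apply, Function.comp_def, hcomp,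
      ContinuousAlternatingMap.sum_apply, ContinuousAlternatingMap.smul_apply, hw,
      Fin.snoc_castSucc, Fin.snoc_last, zero_mul, add_zero]
    push_cast
    rw [Finset.mul_sum]
    refine Finset.sum_congr rfl fun r _ => ?_
    simp
    ring
  have h0' : ∀ (r : Fin m) (u p : E), α r.castSucc (fun _ => fderiv ℝ P x₀ u p) -
      α r.castSucc (fun _ => fderiv ℝ P x₀ p u) = 0 := by
    intro r u p
    rw [← hd, h0]
    rfl
  refine ⟨hP, fun k u p => ?_, fun r u p => ?_, fun u p => ?_⟩
  · rw [realCoord_apply, realCoord_apply, ← map_sub]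
    induction k using Fin.lastCases with
    | last => rw [hlast]; simp
    | cast r => rw [h0']; simp
  · rw [realCoord_apply, realCoord_apply, ← map_sub, h0']; simp
  · rw [realCoord_apply, realCoord_apply, ← map_sub, hlast]; simp

end Coordinates

lemma isManifold_real_of_complex {E : Type*} [NormedAddCommGroup E] [NormedSpace ℂ E]
    {M : Type*} [TopologicalSpace M] [ChartedSpace E M] [IsManifold 𝓘(ℂ, E) ω M] :
    IsManifold 𝓘(ℝ, E) ∞ M := by
  refine isManifold_of_contDiffOn _ _ _ fun e e' he he' => ?_
  have h := (mem_groupoid_of_pregroupoid.1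
    (HasGroupoid.compatible (G := contDiffGroupoid ω 𝓘(ℂ, E)) he he')).1
  have h' : ContDiffOn ℂ ω (e.symm ≫ₕ e') (e.symm ≫ₕ e').source := by
    simpa [contDiffPregroupoid] using h
  have h'' := (h'.restrict_scalars ℝ).of_le (m := ∞) le_top
  simpa using h''

namespace ComplexNilmanifold

variable {n : ℕ} (X : ComplexNilmanifold n)

instance isManifold_real : IsManifold 𝓘(ℝ, CSpace n) ∞ X.M := isManifold_real_of_complex

lemma isLocalDiffeomorph_proj :
    IsLocalDiffeomorph 𝓘(ℝ, CSpace n) 𝓘(ℝ, CSpace n) ∞ X.proj := X.localDiffeo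

lemma proj_eq_iff {g h : X.G} : X.proj g = X.proj h ↔ ∃ γ ∈ X.Γ, γ * h = g := by
  rw [proj, proj, Quotient.eq'', MulAction.orbitRel_apply, MulAction.mem_orbit_iff]
  simp [Subgroup.smul_def]

lemma mdifferentiableAt_proj (g : X.G) :
    MDifferentiableAt 𝓘(ℝ, CSpace n) 𝓘(ℝ, CSpace n) X.proj g :=
  X.isLocalDiffeomorph_proj.mdifferentiable (by simp) g

/-- The differential of the projection to the nilmanifold, as a linear equivalence. -/
def projDeriv (g : X.G) : CSpace n ≃L[ℝ] CSpace n :=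
  X.isLocalDiffeomorph_proj.mfderivToContinuousLinearEquiv (by simp) g

lemma projDeriv_coe (g : X.G) : (X.projDeriv g : CSpace n →L[ℝ] CSpace n) =
    modelDeriv X.proj g :=
  X.isLocalDiffeomorph_proj.mfderivToContinuousLinearEquiv_coe (by simp) g

/-- The Maurer-Cartan form of the nilmanifold: the inverse of the identification of the Lie algebra
with the tangent spaces of `Γ\G` given by left-invariant vector fields. It is computed at a chosen
preimage in `G`; left-invariance makes the choice immaterial. -/
def mc (x : X.M) : CSpace n →L[ℝ] CSpace n :=
  (maurerCartan (Quotient.out x : X.G)).comp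
    ((X.projDeriv (Quotient.out x)).symm : CSpace n →L[ℝ] CSpace n)

/-- Left-invariance of the Maurer-Cartan form of `G` makes that of the quotient well defined. -/
lemma mc_projDeriv (g : X.G) (v : CSpace n) :
    X.mc (X.proj g) (X.projDeriv g v) = maurerCartan g v := by
  obtain ⟨γ, hγ, hγg⟩ := X.proj_eq_iff.1
    (show X.proj (Quotient.out (X.proj g)) = X.proj g from Quotient.out_eq _)
  have hproj : X.proj ∘ (fun b => γ * b) = X.proj := by
    funext b
    exact X.proj_eq_iff.2 ⟨γ, hγ, rfl⟩
  have e1 := modelDeriv_comp (x := g) (X.mdifferentiableAt_proj (γ * g))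
    (mdifferentiableAt_leftMul (CSpace n) γ g)
  rw [hproj, ← projDeriv_coe, ← projDeriv_coe] at e1
  have e2 : X.projDeriv g v = X.projDeriv (γ * g) (modelDeriv (fun b : X.G => γ * b) g v) :=
    DFunLike.congr_fun e1 v
  have e3 := maurerCartan_mul_left (E := CSpace n) γ g
  rw [mc, ← hγg, ← e3, e2]
  simp

lemma mc_comp_projDeriv (g : X.G) :
    (X.mc (X.proj g)).comp (X.projDeriv g : CSpace n →L[ℝ] CSpace n) = maurerCartan g :=
  ContinuousLinearMap.ext fun v => X.mc_projDeriv g v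

lemma mc_bijective (x : X.M) : Function.Bijective (X.mc x) := by
  obtain ⟨g, rfl⟩ : ∃ g, X.proj g = x := Quotient.exists_rep x
  constructor
  · rw [injective_iff_map_eq_zero]
    intro v hv
    obtain ⟨u, rfl⟩ := (X.projDeriv g).surjective v
    rw [mc_projDeriv] at hv
    rw [← invariantField_maurerCartan g u, hv, invariantField, map_zero, map_zero]
  · intro v
    exact ⟨X.projDeriv g (invariantField v g), by
      rw [mc_projDeriv, maurerCartan_invariantField]⟩

/-- The Maurer-Cartan form of the nilmanifold is complex linear for the complex structure on the
Lie algebra. -/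
lemma mc_complexStructure (x : X.M) (v : CSpace n) :
    X.mc x (complexStructure x v) = X.J (X.mc x v) := by
  obtain ⟨g, rfl⟩ : ∃ g, X.proj g = x := Quotient.exists_rep x
  obtain ⟨u, rfl⟩ := (X.projDeriv g).surjective v
  have h1 : complexStructure (X.proj g) (modelDeriv (E := CSpace n) X.proj g
      (invariantField (E := CSpace n) (maurerCartan (E := CSpace n) g u) g)) =
      modelDeriv (E := CSpace n) X.proj g
        (invariantField (E := CSpace n) (X.J (maurerCartan (E := CSpace n) g u)) g) :=
    X.leftInvariant g (maurerCartan (E := CSpace n) g u)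
  rw [← projDeriv_coe, invariantField_maurerCartan] at h1
  refine (congrArg (X.mc (X.proj g)) h1).trans ?_
  refine (X.mc_projDeriv g _).trans ?_
  refine (maurerCartan_invariantField g _).trans ?_
  exact congrArg X.J (X.mc_projDeriv g u).symm

/-- In charts, the Maurer-Cartan form of the nilmanifold is locally a pullback of that of the
group. -/
lemma exists_chartExpr_mc_eq {x₀ : X.M} {y₀ : CSpace n}
    (hy₀ : y₀ ∈ (extChartAt 𝓘(ℝ, CSpace n) x₀).target) :
    ∃ (g : X.G) (ψ : CSpace n → CSpace n), ContDiffAt ℝ ∞ ψ y₀ ∧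
      ψ y₀ = extChartAt 𝓘(ℝ, CSpace n) g g ∧
      chartExpr X.mc x₀ =ᶠ[nhds y₀] fun y =>
        (chartExpr (maurerCartan (E := CSpace n) (G := X.G)) g (ψ y)).comp (fderiv ℝ ψ y) := by
  set χ := extChartAt 𝓘(ℝ, CSpace n) x₀ with hχ
  obtain ⟨g, hg⟩ : ∃ g, X.proj g = χ.symm y₀ := Quotient.exists_rep _
  have hloc : IsLocalDiffeomorphAt 𝓘(ℝ, CSpace n) 𝓘(ℝ, CSpace n) ∞ X.proj g :=
    X.isLocalDiffeomorph_proj g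
  let s := hloc.localInverse
  -- `σ` is a local section of the projection, read in the chart of the nilmanifold.
  let σ : CSpace n → X.G := fun y => s (χ.symm y)
  have hσ₀ : σ y₀ = g := by
    change s (χ.symm y₀) = g
    rw [← hg]
    exact hloc.localInverse_left_inv hloc.localInverse_mem_target
  have hmem : ∀ᶠ y in nhds y₀, χ.symm y ∈ s.source := by
    have hcont : ContinuousAt χ.symm y₀ := (contMDiffAt_extChartAt_symm hy₀).continuousAt
    refine hcont.eventually_mem (s.open_source.mem_nhds ?_)
    rw [← hg]
    exact hloc.localInverse_mem_source
  have hσs : ∀ᶠ y in nhds y₀, ContMDiffAt 𝓘(ℝ, CSpace n) 𝓘(ℝ, CSpace n) ∞ σ y := by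
    filter_upwards [hmem, extChartAt_target_mem_nhds' hy₀] with y hy hy'
    exact (hloc.localInverse_contMDiffOn.contMDiffAt (s.open_source.mem_nhds hy)).comp y
      (contMDiffAt_extChartAt_symm hy')
  have hσg : ∀ᶠ y in nhds y₀, σ y ∈ (extChartAt 𝓘(ℝ, CSpace n) g).source := by
    refine hσs.self_of_nhds.continuousAt.eventually_mem ?_
    rw [hσ₀]
    exact extChartAt_source_mem_nhds g
  refine ⟨g, fun y => extChartAt 𝓘(ℝ, CSpace n) g (σ y), ?_, ?_, ?_⟩
  · rw [← contMDiffAt_iff_contDiffAt]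
    refine ContMDiffAt.comp y₀ (g := extChartAt 𝓘(ℝ, CSpace n) g) ?_ hσs.self_of_nhds
    rw [hσ₀]
    exact contMDiffAt_extChartAt
  · simp only [hσ₀]
  · filter_upwards [hmem.eventually_nhds, hσs, hσg.eventually_nhds,
      extChartAt_target_mem_nhds' hy₀] with y hy hyσ hyg hyt
    have hyg' := hyg.self_of_nhds
    have d1 : MDifferentiableAt 𝓘(ℝ, CSpace n) 𝓘(ℝ, CSpace n) σ y :=
      hyσ.mdifferentiableAt (by simp)
    -- Both sides are the pullback of the Maurer-Cartan form of the group by the local section.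
    have hL : chartExpr X.mc x₀ y = (maurerCartan (σ y)).comp (modelDeriv σ y) := by
      have e1 : X.proj ∘ σ =ᶠ[nhds y] χ.symm := by
        filter_upwards [hy] with z hz
        exact hloc.localInverse_right_inv hz
      have e2 := modelDeriv_comp (x := y) (X.mdifferentiableAt_proj (σ y)) d1
      rw [modelDeriv_congr e1, ← projDeriv_coe] at e2
      have e4 : X.proj (σ y) = χ.symm y := e1.self_of_nhds
      rw [← X.mc_comp_projDeriv, ContinuousLinearMap.comp_assoc, ← e2, e4, chartExpr]
    rw [hL]
    set χg := extChartAt 𝓘(ℝ, CSpace n) g with hχg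
    have hm : IsManifold 𝓘(ℝ, CSpace n) 1 X.G := IsManifold.of_le (n := ∞) (by norm_num)
    have dχ : MDifferentiableAt 𝓘(ℝ, CSpace n) 𝓘(ℝ, CSpace n) χg (σ y) :=
      mdifferentiableAt_extChartAt (by simpa [χg] using hyg')
    have dψ : MDifferentiableAt 𝓘(ℝ, CSpace n) 𝓘(ℝ, CSpace n) (χg ∘ σ) y := dχ.comp y d1
    have dχs : MDifferentiableAt 𝓘(ℝ, CSpace n) 𝓘(ℝ, CSpace n) χg.symm ((χg ∘ σ) y) :=
      (contMDiffAt_extChartAt_symm (χg.map_source hyg')).mdifferentiableAt (by simp)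
    have e5 : χg.symm ∘ (χg ∘ σ) =ᶠ[nhds y] σ := by
      filter_upwards [hyg] with z hz
      exact χg.left_inv hz
    have e6 := modelDeriv_comp dχs dψ
    rw [modelDeriv_congr e5, modelDeriv_eq_fderiv] at e6
    rw [e6, chartExpr, ← ContinuousLinearMap.comp_assoc]
    change _ = ((maurerCartan (χg.symm (χg (σ y)))).comp _).comp _
    rw [χg.left_inv hyg']
    rfl

lemma contDiffAt_chartExpr_mc {x₀ : X.M} {y₀ : CSpace n}
    (hy₀ : y₀ ∈ (extChartAt 𝓘(ℝ, CSpace n) x₀).target) :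
    ContDiffAt ℝ ∞ (chartExpr X.mc x₀) y₀ := by
  obtain ⟨g, ψ, hψ, hψ₀, hev⟩ := X.exists_chartExpr_mc_eq hy₀
  refine ContDiffAt.congr_of_eventuallyEq ?_ hev
  refine ContDiffAt.clm_comp
    (g := fun y => chartExpr (maurerCartan (E := CSpace n) (G := X.G)) g (ψ y)) ?_
    (hψ.fderiv_right (m := ∞) (by simp))
  refine ContDiffAt.comp y₀ (g := chartExpr (maurerCartan (E := CSpace n) (G := X.G)) g) ?_ hψ
  rw [hψ₀]
  exact contDiffAt_chartExpr_maurerCartan (mem_extChartAt_target g)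

/-- The differential of an invariant `1`-form on the group, at the center of a chart. -/
lemma extDeriv_chartExpr_maurerCartan {k : ℕ} {α : CSpace n [⋀^Fin k]→L[ℝ] ℂ}
    {β : CSpace n [⋀^Fin (k + 1)]→L[ℝ] ℂ} {g : X.G}
    (h : (X.leftForm (α : X.LieAlg [⋀^Fin k]→L[ℝ] ℂ)).d g =
      X.leftForm (β : X.LieAlg [⋀^Fin (k + 1)]→L[ℝ] ℂ) g) :
    extDeriv (fun y => α.compContinuousLinearMap
        (chartExpr (maurerCartan (E := CSpace n) (G := X.G)) g y))
      (extChartAt 𝓘(ℝ, CSpace n) g g) =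
      β.compContinuousLinearMap (chartExpr (maurerCartan (E := CSpace n) (G := X.G)) g
        (extChartAt 𝓘(ℝ, CSpace n) g g)) := by
  have h' : (extDeriv (fun y => α.compContinuousLinearMap
        (chartExpr (maurerCartan (E := CSpace n) (G := X.G)) g y))
      (extChartAt 𝓘(ℝ, CSpace n) g g)).compContinuousLinearMap
        (modelDeriv (extChartAt 𝓘(ℝ, CSpace n) g) g) =
      β.compContinuousLinearMap (maurerCartan g) := h
  rw [modelDeriv_extChartAt_self] at h'
  rw [chartExpr_self, ← h']
  rfl

/-- Equations between differentials of invariant forms pass from the group to the charts of the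
nilmanifold, by naturality of the exterior derivative. -/
lemma extDeriv_chartExpr_mc {k : ℕ} {α : CSpace n [⋀^Fin k]→L[ℝ] ℂ}
    {β : CSpace n [⋀^Fin (k + 1)]→L[ℝ] ℂ}
    (h : (X.leftForm (α : X.LieAlg [⋀^Fin k]→L[ℝ] ℂ)).d =
      X.leftForm (β : X.LieAlg [⋀^Fin (k + 1)]→L[ℝ] ℂ))
    {x₀ : X.M} {y₀ : CSpace n} (hy₀ : y₀ ∈ (extChartAt 𝓘(ℝ, CSpace n) x₀).target) :
    extDeriv (fun y => α.compContinuousLinearMap (chartExpr X.mc x₀ y)) y₀ =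
      β.compContinuousLinearMap (chartExpr X.mc x₀ y₀) := by
  obtain ⟨g, ψ, hψ, hψ₀, hev⟩ := X.exists_chartExpr_mc_eq hy₀
  have h1 : (fun y => α.compContinuousLinearMap (chartExpr X.mc x₀ y)) =ᶠ[nhds y₀]
      fun y => ((fun z => α.compContinuousLinearMap
        (chartExpr (maurerCartan (E := CSpace n) (G := X.G)) g z)) (ψ y)).compContinuousLinearMap
          (fderiv ℝ ψ y) := by
    filter_upwards [hev] with y hy
    rw [hy]
    rfl
  have hd : DifferentiableAt ℝ (chartExpr (maurerCartan (E := CSpace n) (G := X.G)) g) (ψ y₀) := by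
    rw [hψ₀]
    exact (contDiffAt_chartExpr_maurerCartan (mem_extChartAt_target g)).differentiableAt (by simp)
  have h2 : chartExpr X.mc x₀ y₀ = (chartExpr (maurerCartan (E := CSpace n) (G := X.G)) g
      (ψ y₀)).comp (fderiv ℝ ψ y₀) := hev.self_of_nhds
  have h3 : minSmoothness ℝ 2 ≤ (∞ : WithTop ℕ∞) := by
    rw [minSmoothness_of_isRCLikeNormedField]
    exact ENat.LEInfty.out
  rw [h1.extDeriv_eq, extDeriv_pullback (r := ∞)
    (differentiableAt_compContinuousLinearMap hd α) hψ h3, h2, hψ₀,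
    X.extDeriv_chartExpr_maurerCartan (congrFun h g)]
  rfl

end ComplexNilmanifold

lemma ComplexNilmanifold.HasStructureEquations.structureEquationsAt {m : ℕ}
    {X : ComplexNilmanifold (m + 1)} {c : Fin m → ℚ}
    {α : Fin (m + 1) → CSpace (m + 1) [⋀^Fin 1]→L[ℝ] ℂ}
    (h : X.HasStructureEquations c α) {x₀ : X.M} {y₀ : CSpace (m + 1)}
    (hy₀ : y₀ ∈ (extChartAt 𝓘(ℝ, CSpace (m + 1)) x₀).target) :
    StructureEquationsAt (chartExpr X.mc x₀) y₀ (fun k => realCoord Complex.reCLM (α k))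
      (fun k => realCoord Complex.imCLM (α k))
      (Fin.snoc (α := fun _ => ℝ) (fun r => (c r : ℝ)) 0) := by
  refine structureEquationsAt_of_extDeriv
    ((X.contDiffAt_chartExpr_mc hy₀).differentiableAt (by simp)) α c (fun r => ?_) ?_
  · rw [X.extDeriv_chartExpr_mc (α := α r.castSucc) (β := 0) _ hy₀]
    · rfl
    · funext g
      exact (h.2.1 r g).trans rfl
  · exact X.extDeriv_chartExpr_mc h.2.2 hy₀

/-! ### Invariant metrics on a complex nilmanifold -/

namespace ComplexNilmanifold

variable {m : ℕ} {X : ComplexNilmanifold (m + 1)}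
  {α : Fin (m + 1) → CSpace (m + 1) [⋀^Fin 1]→L[ℝ] ℂ}

/-- The real part of a complex `1`-form. -/
def reForm {V : Type*} [AddCommGroup V] [Module ℝ V] [TopologicalSpace V]
    (β : V [⋀^Fin 1]→L[ℝ] ℂ) : V [⋀^Fin 1]→L[ℝ] ℝ :=
  Complex.reCLM.compContinuousAlternatingMap β

/-- The imaginary part of a complex `1`-form. -/
def imForm {V : Type*} [AddCommGroup V] [Module ℝ V] [TopologicalSpace V]
    (β : V [⋀^Fin 1]→L[ℝ] ℂ) : V [⋀^Fin 1]→L[ℝ] ℝ :=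
  Complex.imCLM.compContinuousAlternatingMap β

/-- The inner product `2 ∑ aₖ Re (αₖ ⊗ ᾱₖ)`. -/
def coframeInner (α : Fin (m + 1) → CSpace (m + 1) [⋀^Fin 1]→L[ℝ] ℂ) (a : Fin (m + 1) → ℝ) :
    CSpace (m + 1) →L[ℝ] CSpace (m + 1) →L[ℝ] ℝ :=
  ∑ k, (2 * a k) • ((realCoord Complex.reCLM (α k)).smulRight (realCoord Complex.reCLM (α k)) +
    (realCoord Complex.imCLM (α k)).smulRight (realCoord Complex.imCLM (α k)))

lemma coframeInner_apply (a : Fin (m + 1) → ℝ) (v w : CSpace (m + 1)) :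
    coframeInner α a v w = ∑ k, 2 * a k * ((α k fun _ => v).re * (α k fun _ => w).re +
      (α k fun _ => v).im * (α k fun _ => w).im) := by
  simp [coframeInner, realCoord_apply, _root_.sum_apply, mul_add]

/-- The `2`-form `i ∑ aₖ αₖ ∧ ᾱₖ = 2 ∑ aₖ Re αₖ ∧ Im αₖ`. -/
def coframeForm (α : Fin (m + 1) → CSpace (m + 1) [⋀^Fin 1]→L[ℝ] ℂ) (a : Fin (m + 1) → ℝ) :
    CSpace (m + 1) [⋀^Fin 2]→L[ℝ] ℝ :=
  ∑ k, (2 * a k) • wedge (reForm (α k)) (imForm (α k))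

lemma coframeForm_apply (a : Fin (m + 1) → ℝ) (v : Fin 2 → CSpace (m + 1)) :
    coframeForm α a v = ∑ k, 2 * a k * ((α k fun _ => v 0).re * (α k fun _ => v 1).im -
      (α k fun _ => v 1).re * (α k fun _ => v 0).im) := by
  simp [coframeForm, ContinuousAlternatingMap.sum_apply, wedge_one_one_apply, reForm, imForm]

lemma coframeForm_eq_diagForm (a : Fin (m + 1) → ℝ) (v : Fin 2 → CSpace (m + 1)) :
    coframeForm α a v = diagForm (fun k => realCoord Complex.reCLM (α k))
      (fun k => realCoord Complex.imCLM (α k)) a (v 0) (v 1) := by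
  rw [coframeForm_apply, diagForm]
  refine Finset.sum_congr rfl fun k _ => ?_
  simp only [planeForm, realCoord_apply, Complex.reCLM_apply, Complex.imCLM_apply]
  ring

lemma complexify_coframeForm_one :
    complexify (coframeForm α 1) = Complex.I • ∑ k, wedge (α k) (conjForm (α k)) := by
  ext v
  simp only [complexify, ContinuousLinearMap.compContinuousAlternatingMap_coe,
    Function.comp_apply, coframeForm_apply, ContinuousAlternatingMap.smul_apply,
    ContinuousAlternatingMap.sum_apply, wedge_one_one_apply, conjForm, smul_eq_mul,
    Finset.mul_sum, map_sum]
  refine Finset.sum_congr rfl fun k _ => ?_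
  apply Complex.ext <;> simp <;> ring

lemma IsCoframe.exists_eq (h : X.IsCoframe α) (x : X.M) (z : Fin (m + 1) → ℂ) :
    ∃ v, ∀ k, (α k fun _ => X.mc x v) = z k := by
  obtain ⟨u, hu⟩ := h.2.2 z
  obtain ⟨v, rfl⟩ := (X.mc_bijective x).2 u
  exact ⟨v, congrFun hu⟩

lemma IsCoframe.apply_complexStructure (h : X.IsCoframe α) (x : X.M) (v : CSpace (m + 1))
    (k : Fin (m + 1)) :
    (α k fun _ => X.mc x (complexStructure x v)) = Complex.I * α k fun _ => X.mc x v := by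
  rw [mc_complexStructure]
  exact h.1 k _

/-- The left-invariant Hermitian metric with fundamental form `i ∑ aₖ αₖ ∧ ᾱₖ`. -/
def IsCoframe.metric (h : X.IsCoframe α) (a : Fin (m + 1) → ℝ) (ha : ∀ k, 0 < a k) :
    HermitianMetric (m + 1) X.M where
  g x := (coframeInner α a).bilinearComp (X.mc x) (X.mc x)
  symm x v w := by
    change coframeInner α a _ _ = coframeInner α a _ _
    simp only [coframeInner_apply]
    exact Finset.sum_congr rfl fun k _ => by ring
  pos x v hv := by
    change 0 < coframeInner α a (X.mc x v) (X.mc x v)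
    rw [coframeInner_apply]
    have hnn : ∀ z : ℂ, z.re * z.re + z.im * z.im = Complex.normSq z := fun z => rfl
    simp only [hnn]
    refine Finset.sum_pos' (fun k _ => mul_nonneg (by linarith [ha k]) (Complex.normSq_nonneg _))
      ?_
    by_contra! hcon
    refine hv ((X.mc_bijective x).1 (h.2.1 (funext fun k => ?_)))
    have hk := hcon k (Finset.mem_univ k)
    have h0 : Complex.normSq (α k fun _ => X.mc x v) = 0 := by
      have := Complex.normSq_nonneg (α k fun _ => X.mc x v)
      nlinarith [ha k]
    have h1 := Complex.normSq_eq_zero.1 h0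
    exact h1.trans ((α k).map_coord_zero 0 (map_zero (X.mc x))).symm
  compatible x v w := by
    change coframeInner α a (X.mc x (complexStructure x v)) (X.mc x (complexStructure x w)) =
      coframeInner α a (X.mc x v) (X.mc x w)
    simp only [coframeInner_apply]
    refine Finset.sum_congr rfl fun k _ => ?_
    erw [h.apply_complexStructure x v k, h.apply_complexStructure x w k]
    simp only [Complex.mul_re, Complex.mul_im, Complex.I_re, Complex.I_im]
    ring
  smooth x₀ v w y hy := by
    have hP := X.contDiffAt_chartExpr_mc hy
    refine ContDiffAt.contDiffWithinAt ?_
    change ContDiffAt ℝ ∞ (fun y => coframeInner α a (chartExpr X.mc x₀ y v)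
      (chartExpr X.mc x₀ y w)) y
    exact ((coframeInner α a).contDiff.contDiffAt.comp y (hP.clm_apply contDiffAt_const)).clm_apply
      (hP.clm_apply contDiffAt_const)

variable {a : Fin (m + 1) → ℝ} {ha : ∀ k, 0 < a k}

lemma IsCoframe.fundamentalForm_metric (h : X.IsCoframe α) (x : X.M) :
    (h.metric a ha).fundamentalForm x =
      (coframeForm α a).compContinuousLinearMap (X.mc x) := by
  refine ContinuousAlternatingMap.ext fun v => ?_
  change coframeInner α a (X.mc x (complexStructure x (v 0))) (X.mc x (v 1)) =
    coframeForm α a fun i => X.mc x (v i)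
  rw [coframeInner_apply, coframeForm_apply]
  refine Finset.sum_congr rfl fun k _ => ?_
  erw [h.apply_complexStructure x (v 0) k]
  simp only [Complex.mul_re, Complex.mul_im, Complex.I_re, Complex.I_im]
  ring

lemma isInducedBy_comp_mc {F : Type*} [NormedAddCommGroup F] [NormedSpace ℝ F] {k : ℕ}
    (β : CSpace (m + 1) [⋀^Fin k]→L[ℝ] F) {η : DiffForm (CSpace (m + 1)) X.M F k}
    (hη : ∀ x, η x = β.compContinuousLinearMap (X.mc x)) : X.IsInducedBy η β := by
  intro g
  rw [hη]
  change (β.compContinuousLinearMap (X.mc (X.proj g))).compContinuousLinearMap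
    (modelDeriv X.proj g) = β.compContinuousLinearMap (maurerCartan g)
  rw [← X.mc_comp_projDeriv, projDeriv_coe]
  rfl

end ComplexNilmanifold

/-! ### The Lee form of an invariant metric -/

lemma mfderiv_eq_zero_of_isLocalMax {E : Type*} [NormedAddCommGroup E] [NormedSpace ℝ E]
    {M : Type*} [TopologicalSpace M] [ChartedSpace E M] {f : M → ℝ} {x : M}
    (hf : IsLocalMax f x) : mfderiv 𝓘(ℝ, E) 𝓘(ℝ, ℝ) f x = 0 := by
  by_cases hd : MDifferentiableAt 𝓘(ℝ, E) 𝓘(ℝ, ℝ) f x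
  · refine hd.mfderiv.trans ?_
    change fderivWithin ℝ (writtenInExtChartAt 𝓘(ℝ, E) 𝓘(ℝ, ℝ) x f) (range id)
      (extChartAt 𝓘(ℝ, E) x x) = 0
    rw [Set.range_id, fderivWithin_univ]
    refine IsLocalMax.fderiv_eq_zero ?_
    have hc : Filter.Tendsto (extChartAt 𝓘(ℝ, E) x).symm (nhds (extChartAt 𝓘(ℝ, E) x x))
        (nhds x) := by
      have h := continuousAt_extChartAt_symm (I := 𝓘(ℝ, E)) x
      rwa [ContinuousAt, extChartAt_to_inv] at h
    filter_upwards [hc.eventually hf] with y hy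
    change f _ ≤ f ((extChartAt 𝓘(ℝ, E) x).symm (extChartAt 𝓘(ℝ, E) x x))
    rw [extChartAt_to_inv]
    exact hy
  · exact mfderiv_zero_of_not_mdifferentiableAt hd

/-- An exact form on a compact manifold vanishes where its primitive is maximal. -/
lemma DiffForm.IsExact.exists_eq_zero {E : Type*} [NormedAddCommGroup E] [NormedSpace ℝ E]
    {M : Type*} [TopologicalSpace M] [ChartedSpace E M] [CompactSpace M] [Nonempty M]
    {θ : DiffForm E M ℝ 1} (hθ : θ.IsExact) : ∃ x, θ x = 0 := by
  obtain ⟨f, hf, h⟩ := hθ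
  obtain ⟨x, -, hx⟩ := isCompact_univ.exists_isMaxOn Set.univ_nonempty hf.continuous.continuousOn
  refine ⟨x, ContinuousAlternatingMap.ext fun v => ?_⟩
  have hv : v = fun _ => v 0 := by
    funext i
    fin_cases i
    rfl
  rw [hv]
  exact (h x (v 0)).trans (DFunLike.congr_fun (mfderiv_eq_zero_of_isLocalMax (f := f)
    (Filter.Eventually.of_forall fun y => hx (mem_univ y))) (v 0))

lemma exists_pos_sum_div_eq_zero {m : ℕ} (hm : 2 ≤ m) (c : Fin m → ℝ)
    (hpos : ∀ r : Fin m, (r : ℕ) + 1 < m → 0 < c r)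
    (hneg : ∀ r : Fin m, (r : ℕ) + 1 = m → c r < 0) :
    ∃ a : Fin m → ℝ, (∀ r, 0 < a r) ∧ ∑ r, c r / a r = 0 := by
  obtain ⟨k, rfl⟩ : ∃ k, m = k + 1 := ⟨m - 1, by omega⟩
  have hS : 0 < ∑ r : Fin k, c r.castSucc :=
    Finset.sum_pos (fun r _ => hpos _ (by simp)) ⟨⟨0, by omega⟩, Finset.mem_univ _⟩
  have hl := hneg (Fin.last k) (by simp)
  -- All weights but the last are `1`; the last one balances the sum.
  refine ⟨Fin.snoc (α := fun _ => ℝ) (fun _ => 1) (-c (Fin.last k) / ∑ r : Fin k, c r.castSucc),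
    fun r => ?_, ?_⟩
  · induction r using Fin.lastCases with
    | last => simpa using div_pos (neg_pos.2 hl) hS
    | cast r => simp
  · rw [Fin.sum_univ_castSucc]
    simp only [Fin.snoc_castSucc, Fin.snoc_last, div_one]
    have := hl.ne
    have := hS.ne'
    field_simp
    ring

namespace ComplexNilmanifold

variable {m : ℕ} {X : ComplexNilmanifold (m + 1)}
  {α : Fin (m + 1) → CSpace (m + 1) [⋀^Fin 1]→L[ℝ] ℂ} {c : Fin m → ℚ}
  {a : Fin (m + 1) → ℝ} {ha : ∀ k, 0 < a k}

instance nonempty_M : Nonempty X.M := ⟨X.proj 1⟩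

lemma d_apply_of_inChart {F : Type*} [NormedAddCommGroup F] [NormedSpace ℝ F] {k : ℕ}
    {η : DiffForm (CSpace (m + 1)) X.M F k} {x : X.M}
    {ζ : CSpace (m + 1) → CSpace (m + 1) [⋀^Fin k]→L[ℝ] F} (hη : η.inChart x = ζ)
    (v : Fin (k + 1) → CSpace (m + 1)) :
    η.d x v = extDeriv ζ (extChartAt 𝓘(ℝ, CSpace (m + 1)) x x) v := by
  subst hη
  change extDeriv (η.inChart x) _
    (fun i => modelDeriv (extChartAt 𝓘(ℝ, CSpace (m + 1)) x) x (v i)) =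
    _
  rw [modelDeriv_extChartAt_self]
  rfl

lemma inChart_comp_mc {F : Type*} [NormedAddCommGroup F] [NormedSpace ℝ F] {k : ℕ}
    {β : CSpace (m + 1) [⋀^Fin k]→L[ℝ] F} {η : DiffForm (CSpace (m + 1)) X.M F k}
    (hη : ∀ x, η x = β.compContinuousLinearMap (X.mc x)) (x₀ : X.M) :
    η.inChart x₀ = fun y => β.compContinuousLinearMap (chartExpr X.mc x₀ y) := by
  funext y
  rw [DiffForm.inChart, hη]
  rfl

lemma IsCoframe.omegaPow_metric (h : X.IsCoframe α) (x : X.M) :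
    (h.metric a ha).omegaPow x =
      (wedgePow (coframeForm α a) m).compContinuousLinearMap (X.mc x) := by
  change wedgePow ((h.metric a ha).fundamentalForm x) m = _
  rw [h.fundamentalForm_metric]
  exact wedgePow_compContinuousLinearMap _ _ _

/-- The `(2m+1)`-form `ξ ∧ ωᵐ`, up to a constant factor, where `ω` is the pullback by `L` of the
fundamental form with weights `a` and `ξ` is the pullback of the last real coordinate form. -/
def leeVolume (α : Fin (m + 1) → CSpace (m + 1) [⋀^Fin 1]→L[ℝ] ℂ) (a : Fin (m + 1) → ℝ)
    (L : CSpace (m + 1) →L[ℝ] CSpace (m + 1)) (v : Fin (2 * m + 1) → CSpace (m + 1)) : ℝ :=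
  altSum (fun w : Fin 1 ⊕ (Fin m × Fin 2) → CSpace (m + 1) =>
    realCoord Complex.reCLM (α (Fin.last m)) (L (w (Sum.inl 0))) *
      ∏ l, diagForm (fun k => realCoord Complex.reCLM (α k))
        (fun k => realCoord Complex.imCLM (α k)) a
        (L (w (Sum.inr (l, 0)))) (L (w (Sum.inr (l, 1))))) (v ∘ onePairsEquiv m)

lemma IsCoframe.exists_leeVolume_pos (h : X.IsCoframe α) (ha : ∀ k, 0 < a k) (x : X.M) :
    ∃ v, 0 < leeVolume α a (X.mc x) v := by
  choose e he using fun k => h.exists_eq x (Pi.single k 1)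
  choose f hf using fun k => h.exists_eq x (Pi.single k Complex.I)
  -- The basis dual to the real and imaginary parts of the coframe.
  refine ⟨Sum.elim (fun _ => e (Fin.last m))
    (fun p => if p.2 = 0 then e p.1.castSucc else f p.1.castSucc) ∘ (onePairsEquiv m).symm, ?_⟩
  rw [leeVolume, Function.comp_assoc, Equiv.symm_comp_self, Function.comp_id]
  refine altSum_planePow_pos
    (x := fun k p => realCoord Complex.reCLM (α k) (X.mc x p))
    (y := fun k p => realCoord Complex.imCLM (α k) (X.mc x p)) a ha _ ?_ ?_ ?_ ?_ ?_ ?_ <;>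
  · intros
    simp only [Sum.elim_inl, Sum.elim_inr, realCoord_apply, he, hf, Pi.single_apply, if_true,
      one_ne_zero, if_false]
    split_ifs <;> simp

/-- The differential of the top power of the fundamental form of a diagonal invariant metric. -/
lemma HasStructureEquations.d_omegaPow (h : X.HasStructureEquations c α) (x : X.M)
    (v : Fin (2 * m + 1) → CSpace (m + 1)) :
    (h.1.metric a ha).omegaPow.d x v = (2 ^ m : ℝ)⁻¹ *
      ((2 * a (Fin.last m) * ∑ r, (c r : ℝ) / a r.castSucc) * leeVolume α a (X.mc x) v) := by
  have h1 : DiffForm.inChart (k := 2 * m) (h.1.metric a ha).omegaPow x = fun y =>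
      (wedgePow (coframeForm α a) m).compContinuousLinearMap (chartExpr X.mc x y) :=
    inChart_comp_mc (k := 2 * m) h.1.omegaPow_metric x
  refine (d_apply_of_inChart (k := 2 * m) h1 v).trans ?_
  rw [(h.structureEquationsAt (mem_extChartAt_target x)).extDeriv_wedgePow (by simp) a
    (fun k => (ha k).ne') (coframeForm_eq_diagForm a), chartExpr_self, Fin.sum_univ_castSucc]
  simp [leeVolume]

/-- The invariant metric whose fundamental form has weights `a` is balanced as soon as
`∑ cᵣ / aᵣ = 0`. -/
lemma HasStructureEquations.isBalanced_metric (h : X.HasStructureEquations c α)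
    (hc : ∑ r, (c r : ℝ) / a r.castSucc = 0) : (h.1.metric a ha).IsBalanced := by
  intro x
  refine ContinuousAlternatingMap.ext fun v => ?_
  refine (h.d_omegaPow x v).trans ?_
  rw [hc, mul_zero, zero_mul, mul_zero]
  rfl

/-- An invariant metric with weights `a` is not globally conformally balanced if
`∑ cᵣ / aᵣ ≠ 0`: an exact Lee form vanishes somewhere. -/
lemma HasStructureEquations.not_isGCB_metric (h : X.HasStructureEquations c α)
    (hc : ∑ r, (c r : ℝ) / a r.castSucc ≠ 0) : ¬ (h.1.metric a ha).IsGCB := by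
  rintro ⟨θ, ⟨-, hθ⟩, hex⟩
  obtain ⟨x, hx⟩ := hex.exists_eq_zero
  obtain ⟨v, hv⟩ := h.1.exists_leeVolume_pos ha x
  have h1 := (h.d_omegaPow (ha := ha) x v).symm.trans (hθ x v)
  rw [hx, wedge_eq_altSum] at h1
  have h0 : altSum (fun w : Fin 1 ⊕ Fin (2 * (m + 1 - 1)) → TangentSpace 𝓘(ℝ, CSpace (m + 1)) x =>
      (0 : TangentSpace 𝓘(ℝ, CSpace (m + 1)) x [⋀^Fin 1]→L[ℝ] ℝ) (w ∘ Sum.inl) *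
        (h.1.metric a ha).omegaPow x (w ∘ Sum.inr))
      ((v ∘ Fin.cast (Nat.add_comm _ _)) ∘ finSumFinEquiv) = 0 := by
    simp [altSum]
  rw [h0, mul_zero] at h1
  have h2 : (0 : ℝ) < (2 ^ m : ℝ)⁻¹ := by positivity
  have h3 : 2 * a (Fin.last m) ≠ 0 := mul_ne_zero two_ne_zero (ha _).ne'
  exact mul_ne_zero h2.ne' (mul_ne_zero (mul_ne_zero h3 hc) hv.ne') h1

/-- The invariant `1`-form `t (α + ᾱ) = 2 t Re α`, where `α` is the last form of the coframe. -/
def leeForm (X : ComplexNilmanifold (m + 1)) (α : Fin (m + 1) → CSpace (m + 1) [⋀^Fin 1]→L[ℝ] ℂ)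
    (t : ℝ) : DiffForm (CSpace (m + 1)) X.M ℝ 1 := fun x =>
  ((2 * t) • reForm (α (Fin.last m))).compContinuousLinearMap (X.mc x)

lemma complexify_smul_reForm (t : ℝ) (β : CSpace (m + 1) [⋀^Fin 1]→L[ℝ] ℂ) :
    complexify ((2 * t) • reForm β) = (t : ℂ) • (β + conjForm β) := by
  ext v
  simp only [complexify, reForm, conjForm, ContinuousLinearMap.compContinuousAlternatingMap_coe,
    Function.comp_apply, ContinuousAlternatingMap.smul_apply, ContinuousAlternatingMap.add_apply]
  apply Complex.ext <;> simp
  ring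

lemma isSmooth_leeForm (t : ℝ) : (leeForm X α t).IsSmooth := by
  intro x₀ y hy
  rw [inChart_comp_mc (η := leeForm X α t) (fun _ => rfl)]
  refine ContDiffAt.contDiffWithinAt ?_
  let A := ContinuousAlternatingMap.ofSubsingletonLIE (𝕜 := ℝ) (E := CSpace (m + 1)) (F := ℝ)
    (0 : Fin 1)
  have h1 : (fun y => ((2 * t) • reForm (α (Fin.last m))).compContinuousLinearMap
      (chartExpr X.mc x₀ y)) = fun y =>
        A ((A.symm ((2 * t) • reForm (α (Fin.last m)))).comp (chartExpr X.mc x₀ y)) := by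
    funext y
    refine ContinuousAlternatingMap.ext fun v => ?_
    change ((2 * t) • reForm (α (Fin.last m))) _ = ((2 * t) • reForm (α (Fin.last m))) _
    congr 1
    funext i
    fin_cases i
    rfl
  rw [h1]
  exact A.contDiff.contDiffAt.comp y (contDiffAt_const.clm_comp (X.contDiffAt_chartExpr_mc hy))

lemma HasStructureEquations.isClosed_leeForm (h : X.HasStructureEquations c α) (t : ℝ) :
    (leeForm X α t).IsClosed := by
  intro x
  refine ContinuousAlternatingMap.ext fun v => ?_
  refine (d_apply_of_inChart (inChart_comp_mc (fun _ => rfl) x) v).trans ?_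
  have hs := h.structureEquationsAt (mem_extChartAt_target x)
  have hv : v = ![v 0, v 1] := by
    funext i
    fin_cases i <;> rfl
  rw [hv]
  refine (extDeriv_oneForm_compContinuousLinearMap hs.differentiableAt _ _ _).trans ?_
  have h1 := hs.left (Fin.last m) (v 0) (v 1)
  simp only [realCoord_apply] at h1
  change (2 * t) * _ - (2 * t) * _ = 0
  rw [← mul_sub]
  exact mul_eq_zero_of_right _ h1

lemma HasStructureEquations.isLeeForm_metric (h : X.HasStructureEquations c α) {t : ℝ}
    (ht : t = a (Fin.last m) * ∑ r, (c r : ℝ) / a r.castSucc) :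
    (h.1.metric a ha).IsLeeForm (leeForm X α t) := by
  refine ⟨isSmooth_leeForm t, fun x v => (h.d_omegaPow x v).trans ?_⟩
  change _ = wedge (((2 * t) • reForm (α (Fin.last m))).compContinuousLinearMap (X.mc x))
    (wedgePow ((h.1.metric a ha).fundamentalForm x) m) _
  rw [h.1.fundamentalForm_metric, mul_assoc 2, ← ht]
  refine Eq.symm (wedge_wedgePow_diagForm (ξ := fun k => realCoord Complex.reCLM (α k))
    (υ := fun k => realCoord Complex.imCLM (α k)) (X.mc x) a (2 * t)
    (coframeForm_eq_diagForm a) (fun w => ?_) v)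
  have hw : w = fun _ => w 0 := by
    funext i
    fin_cases i
    rfl
  rw [hw]
  rfl

lemma diagForm_realCoord (a : Fin (m + 1) → ℝ) (p q : CSpace (m + 1)) :
    diagForm (fun k => realCoord Complex.reCLM (α k)) (fun k => realCoord Complex.imCLM (α k)) a
        p q = ∑ k, a k * (2 * ((α k fun _ => p).re * (α k fun _ => q).im -
          (α k fun _ => p).im * (α k fun _ => q).re)) := rfl

lemma diagForm_of_single {p q : CSpace (m + 1)} {s t : Fin (m + 1)} {z w : ℂ}
    (hp : ∀ k, (α k fun _ => p) = (Pi.single s z : Fin (m + 1) → ℂ) k)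
    (hq : ∀ k, (α k fun _ => q) = (Pi.single t w : Fin (m + 1) → ℂ) k) :
    diagForm (fun k => realCoord Complex.reCLM (α k)) (fun k => realCoord Complex.imCLM (α k)) a
      p q = if s = t then a s * (2 * (z.re * w.im - z.im * w.re)) else 0 := by
  rw [diagForm_realCoord, Finset.sum_eq_single s]
  · rw [hp, hq, Pi.single_eq_same]
    split_ifs with hst
    · subst hst
      rw [Pi.single_eq_same]
    · rw [Pi.single_eq_of_ne hst]
      simp
  · intro k _ hk
    rw [hp, Pi.single_eq_of_ne hk]
    simp
  · simp

/-- If `d(Fω) = 0`, the form `dF` is a multiple of the last real coordinate form, and it has to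
cancel each of the terms of `dω`; since the coefficients `cᵣ` have different signs, this is
impossible. -/
lemma HasStructureEquations.not_isLCK_metric (h : X.HasStructureEquations c α) (hm : 2 ≤ m)
    (hpos : ∀ r : Fin m, (r : ℕ) + 1 < m → 0 < c r)
    (hneg : ∀ r : Fin m, (r : ℕ) + 1 = m → c r < 0) : ¬ (h.1.metric a ha).IsLCK := by
  intro hl
  let x := X.proj 1
  obtain ⟨U, f, hU, hxU, hf, hd⟩ := hl x
  let F : CSpace (m + 1) → ℝ := fun y =>
    Real.exp (-f ((extChartAt 𝓘(ℝ, CSpace (m + 1)) x).symm y))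
  have h1 : DiffForm.inChart (fun z => Real.exp (-f z) • (h.1.metric a ha).fundamentalForm z) x =
      fun y => F y • (coframeForm α a).compContinuousLinearMap (chartExpr X.mc x y) := by
    funext y
    rw [DiffForm.inChart, h.1.fundamentalForm_metric]
    rfl
  have hF : DifferentiableAt ℝ F (extChartAt 𝓘(ℝ, CSpace (m + 1)) x x) := by
    have h2 : ContMDiffAt 𝓘(ℝ, CSpace (m + 1)) 𝓘(ℝ, ℝ) ∞
        (fun y => f ((extChartAt 𝓘(ℝ, CSpace (m + 1)) x).symm y))
        (extChartAt 𝓘(ℝ, CSpace (m + 1)) x x) := by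
      refine ContMDiffAt.comp _ (g := f) ?_ (contMDiffAt_extChartAt_symm (mem_extChartAt_target x))
      rw [extChartAt_to_inv]
      exact hf.contMDiffAt (hU.mem_nhds hxU)
    exact ((contMDiffAt_iff_contDiffAt.1 h2).differentiableAt (by simp)).neg.exp
  have hs := h.structureEquationsAt (mem_extChartAt_target x)
  choose e he using fun k => h.1.exists_eq x (Pi.single k 1)
  choose g hg using fun k => h.1.exists_eq x (Pi.single k Complex.I)
  have key : ∀ r : Fin m, fderiv ℝ F (extChartAt 𝓘(ℝ, CSpace (m + 1)) x x) (e (Fin.last m)) *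
      a r.castSucc + F (extChartAt 𝓘(ℝ, CSpace (m + 1)) x x) * (2 * a (Fin.last m) * c r) = 0 := by
    intro r
    -- The value of `d(Fω)` on the vectors dual to `ξₘ₊₁`, `ξᵣ` and `υᵣ`.
    have h2 := (d_apply_of_inChart h1 ![e (Fin.last m), e r.castSucc, g r.castSucc]).symm.trans
      (DFunLike.congr_fun (hd x hxU) _)
    rw [hs.extDeriv_smul a (coframeForm_eq_diagForm a) hF, chartExpr_self] at h2
    have hne : Fin.last m ≠ r.castSucc := (Fin.castSucc_lt_last r).ne'
    rw [diagForm_of_single (he _) (hg _), diagForm_of_single (he _) (hg _),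
      diagForm_of_single (he _) (he _), diagForm_of_single (he _) (hg _),
      diagForm_of_single (he _) (hg _), diagForm_of_single (he _) (he _)] at h2
    simp only [hne, if_true, if_false, realCoord_apply, he, Pi.single_eq_same, Fin.snoc_castSucc,
      Complex.reCLM_apply, Complex.one_re, Complex.one_im, Complex.I_re, Complex.I_im] at h2
    have h3 : ∀ t : ℝ, t = (0 : CSpace (m + 1) [⋀^Fin 3]→L[ℝ] ℝ)
      ![e (Fin.last m), e r.castSucc, g r.castSucc] → t = 0 := fun t ht => ht
    have h4 := h3 _ h2
    linarith
  have hF0 : 0 < F (extChartAt 𝓘(ℝ, CSpace (m + 1)) x x) := Real.exp_pos _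
  have hal := ha (Fin.last m)
  have k1 := key ⟨0, by omega⟩
  have k2 := key ⟨m - 1, by omega⟩
  have c1 : (0 : ℝ) < c ⟨0, by omega⟩ := by exact_mod_cast hpos ⟨0, by omega⟩ (by simp; omega)
  have c2 : (c ⟨m - 1, by omega⟩ : ℝ) < 0 := by
    exact_mod_cast hneg ⟨m - 1, by omega⟩ (by simp; omega)
  have a1 := ha (Fin.castSucc ⟨0, by omega⟩)
  have a2 := ha (Fin.castSucc ⟨m - 1, by omega⟩)
  have p1 := mul_pos hF0 (mul_pos (mul_pos two_pos hal) c1)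
  have p2 := mul_neg_of_pos_of_neg hF0 (mul_neg_of_pos_of_neg (mul_pos two_pos hal) c2)
  rcases le_or_gt 0 (fderiv ℝ F (extChartAt 𝓘(ℝ, CSpace (m + 1)) x x) (e (Fin.last m))) with h0 | h0
  · have := mul_nonneg h0 a1.le
    linarith
  · have := mul_neg_of_neg_of_pos h0 a2
    linarith

end ComplexNilmanifold

/-! ### A two-step nilpotent Lie group -/

section Heisenberg

variable {m : ℕ} (c : Fin m → ℚ)

/-- The real linear coordinate functions of `ℂⁿ`. -/
def coordCLM {n : ℕ} (i : Fin n) : CSpace n →L[ℝ] ℂ :=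
  (EuclideanSpace.proj i : CSpace n →L[ℂ] ℂ).restrictScalars ℝ

/-- The bilinear map `(x, y) ↦ (∑ cᵣ x̄ᵣ yᵣ) eₘ₊₁`. -/
def heisForm : CSpace (m + 1) →L[ℝ] CSpace (m + 1) →L[ℝ] CSpace (m + 1) :=
  (ContinuousLinearMap.compL ℝ (CSpace (m + 1)) ℂ (CSpace (m + 1))
    ((ContinuousLinearMap.toSpanSingleton ℂ
      (EuclideanSpace.single (Fin.last m) (1 : ℂ))).restrictScalars ℝ)).comp
  (∑ r : Fin m, (c r : ℝ) • (ContinuousLinearMap.mul ℝ ℂ).bilinearComp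
    ((Complex.conjCLE : ℂ →L[ℝ] ℂ).comp (coordCLM r.castSucc)) (coordCLM r.castSucc))

lemma heisForm_apply (x y : CSpace (m + 1)) :
    heisForm c x y = (∑ r : Fin m, (c r : ℂ) * (starRingEnd ℂ (x r.castSucc) * y r.castSucc)) •
      EuclideanSpace.single (Fin.last m) (1 : ℂ) := by
  simp only [heisForm, coordCLM, _root_.sum_apply, ContinuousLinearMap.comp_apply,
    ContinuousLinearMap.compL_apply, _root_.smul_apply, ContinuousLinearMap.bilinearComp_apply,
    ContinuousLinearMap.mul_apply', ContinuousLinearMap.coe_restrictScalars',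
    ContinuousLinearMap.toSpanSingleton_apply]
  congr 1

@[simp]
lemma heisForm_apply_castSucc (x y : CSpace (m + 1)) (r : Fin m) :
    heisForm c x y r.castSucc = 0 := by
  simp [heisForm_apply, (Fin.castSucc_lt_last r).ne]

@[simp]
lemma heisForm_apply_last (x y : CSpace (m + 1)) : heisForm c x y (Fin.last m) =
    ∑ r : Fin m, (c r : ℂ) * (starRingEnd ℂ (x r.castSucc) * y r.castSucc) := by
  simp [heisForm_apply]

lemma heisForm_congr {x x' y y' : CSpace (m + 1)} (hx : ∀ r : Fin m, x r.castSucc = x' r.castSucc)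
    (hy : ∀ r : Fin m, y r.castSucc = y' r.castSucc) : heisForm c x y = heisForm c x' y' := by
  simp [heisForm_apply, hx, hy]

@[simp]
lemma heisForm_heisForm_left (x y z : CSpace (m + 1)) :
    heisForm c (heisForm c x y) z = 0 := by
  simp [heisForm_apply c (heisForm c x y)]

@[simp]
lemma heisForm_heisForm_right (x y z : CSpace (m + 1)) :
    heisForm c x (heisForm c y z) = 0 := by
  simp [heisForm_apply c x]

lemma heisForm_smul_right (x y : CSpace (m + 1)) (z : ℂ) :
    heisForm c x (z • y) = z • heisForm c x y := by
  rw [heisForm_apply, heisForm_apply, smul_smul, Finset.mul_sum]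
  congr 1
  refine Finset.sum_congr rfl fun r _ => ?_
  simp
  ring

/-- The space `ℂᵐ⁺¹` with the multiplication `x * y = x + y + (∑ cᵣ x̄ᵣ yᵣ) eₘ₊₁`. -/
def HeisGroup (_c : Fin m → ℚ) : Type := CSpace (m + 1)

namespace HeisGroup

instance : TopologicalSpace (HeisGroup c) := inferInstanceAs (TopologicalSpace (CSpace (m + 1)))

instance : T2Space (HeisGroup c) := inferInstanceAs (T2Space (CSpace (m + 1)))

instance : LocallyCompactSpace (HeisGroup c) :=
  inferInstanceAs (LocallyCompactSpace (CSpace (m + 1)))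

instance : SimplyConnectedSpace (HeisGroup c) :=
  inferInstanceAs (SimplyConnectedSpace (CSpace (m + 1)))

instance : ChartedSpace (CSpace (m + 1)) (HeisGroup c) :=
  inferInstanceAs (ChartedSpace (CSpace (m + 1)) (CSpace (m + 1)))

instance : IsManifold 𝓘(ℝ, CSpace (m + 1)) ∞ (HeisGroup c) :=
  inferInstanceAs (IsManifold 𝓘(ℝ, CSpace (m + 1)) ∞ (CSpace (m + 1)))

variable {c}

/-- The vector of coordinates of a point. -/
def toVec (x : HeisGroup c) : CSpace (m + 1) := x

/-- The point with given coordinates. -/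
def ofVec (x : CSpace (m + 1)) : HeisGroup c := x

@[simp] lemma toVec_ofVec (x : CSpace (m + 1)) : toVec (ofVec x : HeisGroup c) = x := rfl

@[simp] lemma ofVec_toVec (x : HeisGroup c) : ofVec (toVec x) = x := rfl

lemma toVec_injective : Function.Injective (toVec : HeisGroup c → CSpace (m + 1)) :=
  fun _ _ h => h

lemma continuous_toVec : Continuous (toVec : HeisGroup c → CSpace (m + 1)) := continuous_id

lemma continuous_ofVec : Continuous (ofVec : CSpace (m + 1) → HeisGroup c) := continuous_id

instance : Mul (HeisGroup c) :=
  ⟨fun x y => ofVec (toVec x + toVec y + heisForm c (toVec x) (toVec y))⟩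

instance : One (HeisGroup c) := ⟨ofVec 0⟩

instance : Inv (HeisGroup c) := ⟨fun x => ofVec (-toVec x + heisForm c (toVec x) (toVec x))⟩

@[simp] lemma toVec_mul (x y : HeisGroup c) :
    toVec (x * y) = toVec x + toVec y + heisForm c (toVec x) (toVec y) := rfl

@[simp] lemma toVec_one : toVec (1 : HeisGroup c) = 0 := rfl

@[simp] lemma toVec_inv (x : HeisGroup c) :
    toVec x⁻¹ = -toVec x + heisForm c (toVec x) (toVec x) := rfl

instance : Group (HeisGroup c) := Group.ofLeftAxioms
  (fun x y z => toVec_injective (by simp; abel))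
  (fun x => toVec_injective (by simp))
  (fun x => toVec_injective (by simp))

lemma toVec_mul_castSucc (x y : HeisGroup c) (r : Fin m) :
    toVec (x * y) r.castSucc = toVec x r.castSucc + toVec y r.castSucc := by
  simp

instance : LieGroup 𝓘(ℝ, CSpace (m + 1)) ∞ (HeisGroup c) where
  contMDiff_mul := by
    have h1 : ContMDiff (𝓘(ℝ, CSpace (m + 1)).prod 𝓘(ℝ, CSpace (m + 1))) 𝓘(ℝ, CSpace (m + 1)) ∞
        (fun p : CSpace (m + 1) × CSpace (m + 1) => p.1) := contMDiff_fst
    have h2 : ContMDiff (𝓘(ℝ, CSpace (m + 1)).prod 𝓘(ℝ, CSpace (m + 1))) 𝓘(ℝ, CSpace (m + 1)) ∞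
        (fun p : CSpace (m + 1) × CSpace (m + 1) => p.2) := contMDiff_snd
    exact (h1.add h2).add (((heisForm c).contMDiff.comp h1).clm_apply h2)
  contMDiff_inv := by
    have h1 : ContMDiff 𝓘(ℝ, CSpace (m + 1)) 𝓘(ℝ, CSpace (m + 1)) ∞
        (fun p : CSpace (m + 1) => p) := contMDiff_id
    exact h1.neg.add (((heisForm c).contMDiff.comp h1).clm_apply h1)

instance : IsTopologicalGroup (HeisGroup c) :=
  topologicalGroup_of_lieGroup 𝓘(ℝ, CSpace (m + 1)) ∞

/-- The projection to the first `m` coordinates, whose kernel is central. -/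
def toFirst : HeisGroup c →* Multiplicative (Fin m → ℂ) :=
  MonoidHom.mk' (fun x => Multiplicative.ofAdd fun r => toVec x r.castSucc) fun x y => by
    rw [← ofAdd_add]
    congr 1
    funext r
    simp

lemma isNilpotent : Group.IsNilpotent (HeisGroup c) := by
  refine Subgroup.isNilpotent_of_ker_le_center toFirst (fun x hx => ?_)
  rw [Subgroup.mem_center_iff]
  have hx' : ∀ r : Fin m, toVec x r.castSucc = (0 : CSpace (m + 1)) r.castSucc := fun r =>
    congrFun (congrArg Multiplicative.toAdd (MonoidHom.mem_ker.1 hx)) r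
  refine fun y => toVec_injective ?_
  rw [toVec_mul, toVec_mul, heisForm_congr c hx' (fun _ => rfl),
    heisForm_congr c (fun _ => rfl) hx']
  simp [add_comm]

lemma modelDeriv_mul_left (g h : HeisGroup c) :
    modelDeriv (E := CSpace (m + 1)) (fun b : HeisGroup c => g * b) h =
      ContinuousLinearMap.id ℝ (CSpace (m + 1)) + heisForm c (toVec g) := by
  have h1 : HasFDerivAt (fun b : CSpace (m + 1) => toVec g + b + heisForm c (toVec g) b)
      (ContinuousLinearMap.id ℝ (CSpace (m + 1)) + heisForm c (toVec g)) (toVec h) :=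
    ((hasFDerivAt_id _).const_add _).add (heisForm c (toVec g)).hasFDerivAt
  exact (modelDeriv_eq_fderiv _ _).trans h1.fderiv

/-- The Lie bracket of the Lie algebra, identified with `ℂᵐ⁺¹`. -/
lemma bracket_eq (v w : GroupLieAlgebra 𝓘(ℝ, CSpace (m + 1)) (HeisGroup c)) :
    ⁅v, w⁆ = heisForm c v w - heisForm c w v := by
  have hf : ∀ u : CSpace (m + 1), (mulInvariantVectorField (I := 𝓘(ℝ, CSpace (m + 1)))
      (G := HeisGroup c) u : HeisGroup c → CSpace (m + 1)) =
        fun g => u + heisForm c (toVec g) u := by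
    intro u
    funext g
    exact DFunLike.congr_fun (modelDeriv_mul_left g 1) u
  have hd : ∀ u : CSpace (m + 1), HasFDerivAt (fun g : CSpace (m + 1) => u + heisForm c g u)
      ((heisForm c).flip u) 0 := fun u =>
    ((heisForm c).flip u).hasFDerivAt.const_add u
  have h1 : ∀ p q : CSpace (m + 1),
      VectorField.lieBracket ℝ (fun g : CSpace (m + 1) => p + heisForm c g p)
        (fun g : CSpace (m + 1) => q + heisForm c g q) 0 = heisForm c p q - heisForm c q p := by
    intro p q
    rw [VectorField.lieBracket, (hd p).fderiv, (hd q).fderiv]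
    simp
  let T : (CSpace (m + 1) → CSpace (m + 1)) → (CSpace (m + 1) → CSpace (m + 1)) → CSpace (m + 1) :=
    fun V W => VectorField.mlieBracket 𝓘(ℝ, CSpace (m + 1)) V W (0 : CSpace (m + 1))
  have h2 : ∀ V W, T V W = VectorField.lieBracket ℝ V W 0 := fun V W =>
    (congrFun (VectorField.mlieBracketWithin_univ (I := 𝓘(ℝ, CSpace (m + 1))) (V := V)
      (W := W)) 0).symm.trans ((congrFun VectorField.mlieBracketWithin_eq_lieBracketWithin 0).trans
        (congrFun (VectorField.lieBracketWithin_univ (E := CSpace (m + 1)) (V := V) (W := W)) 0))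
  exact (congrArg₂ T (hf v) (hf w)).trans ((h2 _ _).trans (h1 v w))

end HeisGroup

end Heisenberg

/-! ### Quotients of the group by discrete subgroups -/

namespace HeisGroup

variable {m : ℕ} {c : Fin m → ℚ}

/-- The complex linear part of the affine map `x ↦ g * x`. -/
def leftLinear (g : HeisGroup c) : CSpace (m + 1) →L[ℂ] CSpace (m + 1) :=
  LinearMap.toContinuousLinearMap
    { toFun := fun v => v + heisForm c (toVec g) v
      map_add' := fun v w => by rw [map_add]; abel
      map_smul' := fun z v => by rw [heisForm_smul_right, RingHom.id_apply, smul_add] }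

lemma leftLinear_apply (g : HeisGroup c) (v : CSpace (m + 1)) :
    leftLinear g v = v + heisForm c (toVec g) v := rfl

lemma toVec_mul_eq (g x : HeisGroup c) : toVec (g * x) = toVec g + leftLinear g (toVec x) := by
  rw [toVec_mul, leftLinear_apply, add_assoc]

lemma modelDeriv_mul_left_apply (g h : HeisGroup c) (v : CSpace (m + 1)) :
    modelDeriv (E := CSpace (m + 1)) (fun b : HeisGroup c => g * b) h v = leftLinear g v := by
  rw [modelDeriv_mul_left]
  rfl

lemma contMDiff_toVec : ContMDiff 𝓘(ℝ, CSpace (m + 1)) 𝓘(ℝ, CSpace (m + 1)) ∞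
    (toVec : HeisGroup c → CSpace (m + 1)) :=
  contMDiff_id (M := CSpace (m + 1))

lemma contMDiff_ofVec : ContMDiff 𝓘(ℝ, CSpace (m + 1)) 𝓘(ℝ, CSpace (m + 1)) ∞
    (ofVec : CSpace (m + 1) → HeisGroup c) :=
  contMDiff_id (M := CSpace (m + 1))

variable (Γ : Subgroup (HeisGroup c))

/-- The projection to the quotient by a subgroup. -/
def mk (g : HeisGroup c) : LeftQuotient Γ := Quotient.mk _ g

lemma mk_surjective : Function.Surjective (mk Γ) := Quotient.mk_surjective

lemma mk_eq_iff {g h : HeisGroup c} : mk Γ g = mk Γ h ↔ ∃ γ ∈ Γ, γ * h = g := by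
  rw [mk, mk, Quotient.eq'', MulAction.orbitRel_apply, MulAction.mem_orbit_iff]
  simp [Subgroup.smul_def]

variable [DiscreteTopology Γ]

instance : ProperlyDiscontinuousSMul Γ (HeisGroup c) :=
  Γ.properlyDiscontinuousSMul_of_tendsto_cofinite
    (Γ.tendsto_coe_cofinite_of_discrete (isDiscrete_iff_discreteTopology.2 inferInstance))

lemma isLocalHomeomorph_mk : IsLocalHomeomorph (mk Γ) :=
  (isQuotientCoveringMap_quotientMk_of_properlyDiscontinuousSMul
    (G := Γ) (E := HeisGroup c)).isCoveringMap.isLocalHomeomorph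

variable {Γ}

lemma symm_apply_of_mem_atlas {e : OpenPartialHomeomorph (LeftQuotient Γ) (CSpace (m + 1))}
    (he : e ∈ atlas (CSpace (m + 1)) (LeftQuotient Γ)) (y : CSpace (m + 1)) :
    e.symm y = mk Γ (ofVec y) := by
  obtain ⟨q, rfl⟩ := he
  exact congrFun ((isLocalHomeomorph_mk Γ).localInverseAt_symm _) _

/-- A chart of the quotient, composed with the projection, is locally a left translation. -/
lemma exists_eventually_chart_mk_eq {e : OpenPartialHomeomorph (LeftQuotient Γ) (CSpace (m + 1))}
    (he : e ∈ atlas (CSpace (m + 1)) (LeftQuotient Γ)) {g : HeisGroup c}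
    (hg : mk Γ g ∈ e.source) :
    ∃ γ ∈ Γ, ∀ᶠ z in nhds g, e (mk Γ z) = toVec (γ * z) := by
  have h1 : mk Γ (ofVec (e (mk Γ g))) = mk Γ g := by
    rw [← symm_apply_of_mem_atlas he, e.left_inv hg]
  obtain ⟨γ, hγ, h2⟩ := (mk_eq_iff Γ).1 h1
  refine ⟨γ, hγ, ?_⟩
  have h3 : ∀ᶠ z in nhds g, toVec (γ * z) ∈ e.target := by
    refine (continuous_toVec.comp (continuous_const_mul γ)).continuousAt.eventually_mem
      (e.open_target.mem_nhds ?_)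
    rw [Function.comp_apply, h2, toVec_ofVec]
    exact e.map_source hg
  filter_upwards [h3] with z hz
  have h4 : e.symm (toVec (γ * z)) = mk Γ z := by
    rw [symm_apply_of_mem_atlas he, ofVec_toVec]
    exact (mk_eq_iff Γ).2 ⟨γ, hγ, rfl⟩
  rw [← h4, e.right_inv hz]

/-- The changes of charts are locally left translations, which are holomorphic. -/
instance : IsManifold 𝓘(ℂ, CSpace (m + 1)) ω (LeftQuotient Γ) := by
  refine isManifold_of_contDiffOn _ _ _ fun e e' he he' y hy => ?_
  refine ContDiffAt.contDiffWithinAt ?_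
  have hy' : e.symm y ∈ e'.source := by
    simp at hy
    exact hy.2
  rw [symm_apply_of_mem_atlas he] at hy'
  obtain ⟨γ, -, hγ⟩ := exists_eventually_chart_mk_eq he' hy'
  have h1 : (fun z : CSpace (m + 1) => e' (e.symm z)) =ᶠ[nhds y] fun z =>
      toVec γ + leftLinear γ z := by
    filter_upwards [continuous_ofVec.continuousAt.eventually hγ] with z hz
    rw [symm_apply_of_mem_atlas he, hz, toVec_mul_eq, toVec_ofVec]
  refine ContDiffAt.congr_of_eventuallyEq ?_ h1
  exact contDiffAt_const.add (leftLinear γ).contDiff.contDiffAt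

instance : IsManifold 𝓘(ℝ, CSpace (m + 1)) ∞ (LeftQuotient Γ) := isManifold_real_of_complex

variable (Γ)

lemma contMDiff_mk : ContMDiff 𝓘(ℝ, CSpace (m + 1)) 𝓘(ℝ, CSpace (m + 1)) ∞ (mk Γ) := by
  intro g
  rw [contMDiffAt_iff_target]
  refine ⟨(isLocalHomeomorph_mk Γ).continuous.continuousAt, ?_⟩
  obtain ⟨γ, -, hγ⟩ := exists_eventually_chart_mk_eq (chart_mem_atlas (CSpace (m + 1)) (mk Γ g))
    (mem_chart_source (CSpace (m + 1)) (mk Γ g))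
  refine ContMDiffAt.congr_of_eventuallyEq (f := fun z => toVec (γ * z)) ?_ hγ
  exact (contMDiff_toVec.comp (contMDiff_mul_left (a := γ))).contMDiffAt

lemma contMDiffOn_localInverseAt_mk (g : HeisGroup c) :
    ContMDiffOn 𝓘(ℝ, CSpace (m + 1)) 𝓘(ℝ, CSpace (m + 1)) ∞
      ((isLocalHomeomorph_mk Γ).localInverseAt g)
      ((isLocalHomeomorph_mk Γ).localInverseAt g).source := by
  intro q hq
  set s := (isLocalHomeomorph_mk Γ).localInverseAt g with hs
  refine ContMDiffAt.contMDiffWithinAt ?_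
  have hsq : mk Γ (s q) = q := (isLocalHomeomorph_mk Γ).apply_localInverseAt_of_mem hq
  have hmem : mk Γ (s q) ∈ (chartAt (CSpace (m + 1)) q).source := by
    rw [hsq]
    exact mem_chart_source _ q
  obtain ⟨γ, -, hγ⟩ := exists_eventually_chart_mk_eq (chart_mem_atlas (CSpace (m + 1)) q) hmem
  have h1 : s =ᶠ[nhds q] fun x => γ⁻¹ * ofVec (chartAt (CSpace (m + 1)) q x) := by
    filter_upwards [(s.continuousAt hq).eventually hγ, s.open_source.mem_nhds hq] with x hx hx'
    have hsx : mk Γ (s x) = x := (isLocalHomeomorph_mk Γ).apply_localInverseAt_of_mem hx'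
    rw [hsx] at hx
    rw [hx, ofVec_toVec, inv_mul_cancel_left]
  refine ContMDiffAt.congr_of_eventuallyEq ?_ h1
  have h2 : ContMDiffAt 𝓘(ℝ, CSpace (m + 1)) 𝓘(ℝ, CSpace (m + 1)) ∞
      (chartAt (CSpace (m + 1)) q) q := contMDiffAt_extChartAt
  exact ((contMDiff_mul_left (a := γ⁻¹)).comp contMDiff_ofVec).contMDiffAt.comp q h2

lemma isLocalDiffeomorph_mk :
    IsLocalDiffeomorph 𝓘(ℝ, CSpace (m + 1)) 𝓘(ℝ, CSpace (m + 1)) ∞ (mk Γ) := by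
  intro g
  let s := (isLocalHomeomorph_mk Γ).localInverseAt g
  have hs : ∀ x, s.symm x = mk Γ x := congrFun ((isLocalHomeomorph_mk Γ).localInverseAt_symm g)
  refine ⟨{ toPartialEquiv := s.symm.toPartialEquiv
            open_source := s.open_target
            open_target := s.open_source
            contMDiffOn_toFun := (contMDiff_mk Γ).contMDiffOn.congr fun x _ => hs x
            contMDiffOn_invFun := contMDiffOn_localInverseAt_mk Γ g }, ?_, fun x _ => (hs x).symm⟩
  exact (isLocalHomeomorph_mk Γ).self_mem_localInverseAt_target

/-- In the charts, the differential of the projection is that of a left translation; in particular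
it is complex linear. -/
lemma exists_modelDeriv_mk_eq (g : HeisGroup c) : ∃ γ : HeisGroup c, ∀ v : CSpace (m + 1),
    modelDeriv (E := CSpace (m + 1)) (mk Γ) g v = leftLinear γ v := by
  obtain ⟨γ, -, hγ⟩ := exists_eventually_chart_mk_eq (chart_mem_atlas (CSpace (m + 1)) (mk Γ g))
    (mem_chart_source (CSpace (m + 1)) (mk Γ g))
  refine ⟨γ, fun v => ?_⟩
  have hχ : MDifferentiableAt 𝓘(ℝ, CSpace (m + 1)) 𝓘(ℝ, CSpace (m + 1))
      (extChartAt 𝓘(ℝ, CSpace (m + 1)) (mk Γ g)) (mk Γ g) :=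
    (contMDiffAt_extChartAt (n := ∞)).mdifferentiableAt (by simp)
  have h1 := modelDeriv_comp (E := CSpace (m + 1)) hχ
    ((contMDiff_mk Γ g).mdifferentiableAt (by simp))
  rw [modelDeriv_extChartAt_self, ContinuousLinearMap.id_comp] at h1
  have h2 : (extChartAt 𝓘(ℝ, CSpace (m + 1)) (mk Γ g) ∘ mk Γ) =ᶠ[nhds g]
      fun z => toVec (γ * z) := hγ
  rw [← h1, modelDeriv_congr h2, ← modelDeriv_mul_left_apply γ g v]
  rfl

end HeisGroup

/-! ### A cocompact lattice and the resulting nilmanifold -/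

namespace HeisGroup

variable {m : ℕ} (c : Fin m → ℚ)

/-- A common denominator of the coefficients. -/
def commonDen : ℕ := ∏ r, (c r).den

lemma commonDen_pos : 0 < commonDen c := Finset.prod_pos fun r _ => (c r).den_pos

lemma exists_commonDen_mul_eq (r : Fin m) : ∃ k : ℤ, (c r : ℂ) * commonDen c = k := by
  obtain ⟨d, hd⟩ : (c r).den ∣ commonDen c := Finset.dvd_prod_of_mem _ (Finset.mem_univ r)
  have h : c r * commonDen c = ((c r).num * d : ℤ) := by
    rw [hd]
    push_cast
    rw [← mul_assoc, Rat.mul_den_eq_num]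
  exact ⟨_, by exact_mod_cast congrArg (fun q : ℚ => (q : ℂ)) h⟩

/-- The cocycle takes values in `Nℤ[i]` on vectors with coordinates in `Nℤ[i]`, since `N cᵣ` is an
integer. -/
lemma exists_heisForm_last_eq {x y : CSpace (m + 1)}
    (hx : ∀ i, ∃ z : GaussianInt, x i = commonDen c * (z : ℂ))
    (hy : ∀ i, ∃ z : GaussianInt, y i = commonDen c * (z : ℂ)) :
    ∃ z : GaussianInt, heisForm c x y (Fin.last m) = commonDen c * (z : ℂ) := by
  choose z hz using hx
  choose w hw using hy
  choose k hk using exists_commonDen_mul_eq c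
  refine ⟨∑ r : Fin m, (k r : GaussianInt) * (star (z r.castSucc) * w r.castSucc), ?_⟩
  rw [heisForm_apply_last, map_sum, Finset.mul_sum]
  refine Finset.sum_congr rfl fun r _ => ?_
  rw [hz, hw, map_mul, map_mul, map_mul, map_intCast, ← hk, GaussianInt.toComplex_star,
    Complex.conj_natCast]
  ring

/-- The lattice of points with coordinates in `Nℤ[i]`, where `N` is a common denominator of the
coefficients; the factor `N` makes it a subgroup. -/
def lattice : Subgroup (HeisGroup c) where
  carrier := {g | ∀ i, ∃ z : GaussianInt, toVec g i = commonDen c * (z : ℂ)}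
  one_mem' i := ⟨0, by simp⟩
  mul_mem' {x y} hx hy i := by
    obtain ⟨z, hz⟩ := hx i
    obtain ⟨w, hw⟩ := hy i
    induction i using Fin.lastCases with
    | last =>
      obtain ⟨t, ht⟩ := exists_heisForm_last_eq c hx hy
      refine ⟨z + w + t, ?_⟩
      rw [toVec_mul, PiLp.add_apply, PiLp.add_apply, hz, hw, ht, map_add, map_add]
      ring
    | cast r =>
      refine ⟨z + w, ?_⟩
      rw [toVec_mul_castSucc, hz, hw, map_add]
      ring
  inv_mem' {x} hx i := by
    obtain ⟨z, hz⟩ := hx i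
    induction i using Fin.lastCases with
    | last =>
      obtain ⟨t, ht⟩ := exists_heisForm_last_eq c hx hx
      refine ⟨-z + t, ?_⟩
      rw [toVec_inv, PiLp.add_apply, PiLp.neg_apply, hz, ht, map_add, map_neg]
      ring
    | cast r =>
      refine ⟨-z, ?_⟩
      rw [toVec_inv, PiLp.add_apply, PiLp.neg_apply, hz, heisForm_apply_castSucc, map_neg]
      ring

instance : DiscreteTopology (lattice c) := by
  rw [discreteTopology_iff_isOpen_singleton_one]
  have h : ({1} : Set (lattice c)) = (fun g : lattice c => toVec (g : HeisGroup c)) ⁻¹'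
      Metric.ball 0 1 := by
    ext ⟨g, hg⟩
    simp only [mem_singleton_iff, mem_preimage, mem_ball_zero_iff, Subgroup.mk_eq_one]
    refine ⟨fun h => by rw [h]; simp, fun h => toVec_injective ?_⟩
    ext i
    obtain ⟨z, hz⟩ := hg i
    have h1 : ‖(z : ℂ)‖ < 1 := by
      have hN : (1 : ℝ) ≤ commonDen c := by exact_mod_cast commonDen_pos c
      have h2 : ‖toVec g i‖ < 1 := (PiLp.norm_apply_le (toVec g) i).trans_lt h
      rw [hz, norm_mul, Complex.norm_natCast] at h2
      nlinarith [norm_nonneg (z : ℂ)]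
    have hre : z.re = 0 := by
      have := (Complex.abs_re_le_norm (z : ℂ)).trans_lt h1
      rw [← GaussianInt.intCast_re, ← Int.cast_abs] at this
      exact Int.abs_lt_one_iff.1 (by exact_mod_cast this)
    have him : z.im = 0 := by
      have := (Complex.abs_im_le_norm (z : ℂ)).trans_lt h1
      rw [← GaussianInt.intCast_im, ← Int.cast_abs] at this
      exact Int.abs_lt_one_iff.1 (by exact_mod_cast this)
    have hz0 : z = 0 := Zsqrtd.ext hre him
    rw [hz, hz0]
    simp
  rw [h]
  exact Metric.isOpen_ball.preimage (continuous_toVec.comp continuous_subtype_val)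

lemma exists_norm_mul_gaussianInt_add_le {N : ℕ} (hN : 0 < N) (w : ℂ) :
    ∃ z : GaussianInt, ‖(N : ℂ) * (z : ℂ) + w‖ ≤ 2 * N := by
  have hN' : (0 : ℝ) < N := by exact_mod_cast hN
  refine ⟨⟨-⌊w.re / N⌋, -⌊w.im / N⌋⟩, ?_⟩
  have h : ∀ t : ℝ, |(N : ℝ) * -(⌊t / N⌋ : ℝ) + t| ≤ N := by
    intro t
    have h1 := Int.floor_le (t / N)
    have h2 := (Int.lt_floor_add_one (t / N)).le
    rw [le_div_iff₀ hN'] at h1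
    rw [div_le_iff₀ hN'] at h2
    rw [abs_le]
    constructor <;> nlinarith
  refine (Complex.norm_le_abs_re_add_abs_im _).trans ?_
  have hre := h w.re
  have him := h w.im
  simp [GaussianInt.toComplex_def] at hre him ⊢
  linarith

/-- Every orbit meets the polydisc of radius `2N`: the first `m` coordinates are reduced first, and
then the last one. -/
instance : CompactSpace (LeftQuotient (lattice c)) := by
  let K : Set (CSpace (m + 1)) := (fun v : Fin (m + 1) → ℂ => WithLp.toLp 2 v) ''
    Set.univ.pi fun _ => Metric.closedBall (0 : ℂ) (2 * commonDen c)
  have hK : IsCompact K :=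
    (isCompact_univ_pi fun _ => isCompact_closedBall _ _).image (PiLp.continuous_toLp 2 _)
  refine ⟨?_⟩
  have himage : (fun v : CSpace (m + 1) => mk (lattice c) (ofVec v)) '' K = univ := by
    rw [eq_univ_iff_forall]
    intro q
    obtain ⟨g, rfl⟩ := mk_surjective _ q
    -- The first coordinates of the translation determine the cocycle that enters the last one.
    choose z hz using fun w => exists_norm_mul_gaussianInt_add_le (commonDen_pos c) w
    let x : CSpace (m + 1) := WithLp.toLp 2 (Fin.snoc (α := fun _ => ℂ)
      (fun r : Fin m => commonDen c * (z (toVec g r.castSucc) : ℂ)) 0)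
    let t := toVec g (Fin.last m) + heisForm c x (toVec g) (Fin.last m)
    let γ : HeisGroup c := ofVec (WithLp.toLp 2 (Fin.snoc (α := fun _ => ℂ)
      (fun r : Fin m => commonDen c * (z (toVec g r.castSucc) : ℂ)) (commonDen c * (z t : ℂ))))
    have hγ : γ ∈ lattice c := by
      intro i
      induction i using Fin.lastCases with
      | last => exact ⟨z t, by simp [γ]⟩
      | cast r => exact ⟨z (toVec g r.castSucc), by simp [γ]⟩
    have hγx : heisForm c (toVec γ) (toVec g) = heisForm c x (toVec g) :=
      heisForm_congr c (fun r => by simp [γ, x]) (fun _ => rfl)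
    refine ⟨toVec (γ * g), ⟨fun i => toVec (γ * g) i, fun i _ => ?_, rfl⟩,
      (mk_eq_iff _).2 ⟨γ, hγ, rfl⟩⟩
    rw [mem_closedBall_zero_iff]
    induction i using Fin.lastCases with
    | last =>
      have h1 : toVec (γ * g) (Fin.last m) = commonDen c * (z t : ℂ) + t := by
        rw [toVec_mul, hγx, PiLp.add_apply, PiLp.add_apply, add_assoc]
        congr 1
        simp [γ]
      exact (congrArg norm h1).trans_le (hz t)
    | cast r =>
      have h1 : toVec (γ * g) r.castSucc =
          commonDen c * (z (toVec g r.castSucc) : ℂ) + toVec g r.castSucc := by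
        rw [toVec_mul_castSucc]
        congr 1
        simp [γ]
      exact (congrArg norm h1).trans_le (hz _)
  rw [← himage]
  exact hK.image ((isLocalHomeomorph_mk (lattice c)).continuous.comp continuous_ofVec)

/-- The nilmanifold `Γ\G`, with the complex structure for which the left translations of `G = ℂᵐ⁺¹`
are holomorphic. -/
def nilmanifold : ComplexNilmanifold.{0} (m + 1) where
  G := HeisGroup c
  nilpotent := isNilpotent
  Γ := lattice c
  localDiffeo := isLocalDiffeomorph_mk (lattice c)
  J := show CSpace (m + 1) →L[ℝ] CSpace (m + 1) from
    (Complex.I • ContinuousLinearMap.id ℂ (CSpace (m + 1))).restrictScalars ℝ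
  leftInvariant g v := by
    obtain ⟨γ, hγ⟩ := exists_modelDeriv_mk_eq (lattice c) g
    have h : ∀ u : CSpace (m + 1), Complex.I • modelDeriv (E := CSpace (m + 1)) (mk (lattice c)) g
        (modelDeriv (E := CSpace (m + 1)) (fun b : HeisGroup c => g * b) 1 u) =
      modelDeriv (E := CSpace (m + 1)) (mk (lattice c)) g
        (modelDeriv (E := CSpace (m + 1)) (fun b : HeisGroup c => g * b) 1 (Complex.I • u)) := by
      intro u
      rw [hγ, hγ, modelDeriv_mul_left_apply, modelDeriv_mul_left_apply, map_smul, map_smul]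
    exact h v

/-- The coordinate functions at the identity, as complex `1`-forms on the Lie algebra. -/
def coframe (i : Fin (m + 1)) : CSpace (m + 1) [⋀^Fin 1]→L[ℝ] ℂ :=
  ContinuousAlternatingMap.ofSubsingletonLIE (𝕜 := ℝ) (E := CSpace (m + 1)) (F := ℂ) (0 : Fin 1)
    (coordCLM i)

lemma coframe_apply (i : Fin (m + 1)) (v : Fin 1 → CSpace (m + 1)) : coframe i v = v 0 i := rfl

lemma isTwoStep_nilmanifold {r : Fin m} (hr : c r ≠ 0) : (nilmanifold c).IsTwoStep := by
  have hb : ∀ x y : (nilmanifold c).LieAlg, ⁅x, y⁆ = heisForm c x y - heisForm c y x :=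
    fun x y => bracket_eq x y
  have h0 : ∀ x y z : CSpace (m + 1), heisForm c (heisForm c x y - heisForm c y x) z -
      heisForm c z (heisForm c x y - heisForm c y x) = 0 := by
    intro x y z
    rw [map_sub, map_sub, _root_.sub_apply]
    simp
  refine ⟨fun x y z => ?_, ?_⟩
  · rw [hb, hb]
    exact h0 x y z
  · let x : CSpace (m + 1) := EuclideanSpace.single r.castSucc 1
    let y : CSpace (m + 1) := EuclideanSpace.single r.castSucc Complex.I
    refine ⟨x, y, fun h => ?_⟩
    have h1 : heisForm c x y - heisForm c y x = 0 := (hb x y).symm.trans h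
    have h2 := congrArg (fun v : CSpace (m + 1) => v (Fin.last m)) h1
    exact hr (by simpa [x, y] using h2)

lemma maurerCartan_eq (g : HeisGroup c) : maurerCartan (E := CSpace (m + 1)) g =
    ContinuousLinearMap.id ℝ (CSpace (m + 1)) - heisForm c (toVec g) := by
  rw [maurerCartan, modelDeriv_mul_left, toVec_inv, map_add, map_neg, sub_eq_add_neg]
  congr 1
  ext v
  simp

lemma d_leftForm_apply (β : CSpace (m + 1) [⋀^Fin 1]→L[ℝ] ℂ) (g : HeisGroup c)
    (u p : CSpace (m + 1)) :
    ((nilmanifold c).leftForm (β : (nilmanifold c).LieAlg [⋀^Fin 1]→L[ℝ] ℂ)).d g ![u, p] =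
      β (fun _ => heisForm c p u) - β (fun _ => heisForm c u p) := by
  let P : CSpace (m + 1) → CSpace (m + 1) →L[ℝ] CSpace (m + 1) := fun y =>
    ContinuousLinearMap.id ℝ (CSpace (m + 1)) - heisForm c y
  have hP : HasFDerivAt P (-heisForm c) (toVec g) :=
    ((heisForm c).hasFDerivAt.const_sub _)
  have h1 : chartExpr (maurerCartan (E := CSpace (m + 1)) (G := HeisGroup c)) g = P := by
    funext y
    have h2 : modelDeriv (extChartAt 𝓘(ℝ, CSpace (m + 1)) g).symm y =
        ContinuousLinearMap.id ℝ (CSpace (m + 1)) := modelDeriv_id (M := CSpace (m + 1)) y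
    rw [chartExpr, h2, ContinuousLinearMap.comp_id]
    exact maurerCartan_eq c _
  have h3 : ((nilmanifold c).leftForm (β : (nilmanifold c).LieAlg [⋀^Fin 1]→L[ℝ] ℂ)).d g ![u, p] =
      extDeriv (fun y => β.compContinuousLinearMap
        (chartExpr (maurerCartan (E := CSpace (m + 1)) (G := HeisGroup c)) g y)) (toVec g)
        (fun i => modelDeriv (extChartAt 𝓘(ℝ, CSpace (m + 1)) g) g
          ((![u, p] : Fin 2 → CSpace (m + 1)) i)) := rfl
  rw [h3, h1, modelDeriv_extChartAt_self]
  refine (extDeriv_oneForm_compContinuousLinearMap hP.differentiableAt β u p).trans ?_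
  rw [hP.fderiv]
  have hβ : ∀ w, β (fun _ => -w) = -β (fun _ => w) := fun w =>
    map_neg ((ContinuousAlternatingMap.ofSubsingletonLIE
      (𝕜 := ℝ) (E := CSpace (m + 1)) (F := ℂ) (0 : Fin 1)).symm β) w
  simp only [_root_.neg_apply, hβ]
  abel

lemma coframe_last_heisForm_sub (g : HeisGroup c) (u p : CSpace (m + 1)) :
    coframe (Fin.last m) (fun _ => heisForm c p u) -
        coframe (Fin.last m) (fun _ => heisForm c u p) =
      (∑ r : Fin m, ((c r : ℚ) : ℂ) • wedge (coframe r.castSucc) (conjForm (coframe r.castSucc)))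
        ![maurerCartan g u, maurerCartan g p] := by
  have h : ∀ (v : CSpace (m + 1)) (r : Fin m),
      (maurerCartan (E := CSpace (m + 1)) g v) r.castSucc = v r.castSucc := by
    intro v r
    rw [maurerCartan_eq]
    simp
  simp only [ContinuousAlternatingMap.sum_apply, ContinuousAlternatingMap.smul_apply,
    wedge_one_one_apply, conjForm, ContinuousLinearMap.compContinuousAlternatingMap_coe,
    Function.comp_apply, coframe_apply, heisForm_apply_last, ← Finset.sum_sub_distrib,
    Matrix.cons_val_zero, Matrix.cons_val_one, h]
  refine Finset.sum_congr rfl fun r _ => ?_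
  simp
  ring

lemma hasStructureEquations_nilmanifold :
    (nilmanifold c).HasStructureEquations c (coframe (m := m)) := by
  have hv : ∀ v : Fin 2 → CSpace (m + 1), v = ![v 0, v 1] := by
    intro v
    funext i
    fin_cases i <;> rfl
  refine ⟨⟨fun i v => rfl, ?_, ?_⟩, fun r g => ?_, ?_⟩
  · intro v w h
    exact PiLp.ext fun i => congrFun h i
  · intro z
    exact ⟨WithLp.toLp 2 z, rfl⟩
  · refine ContinuousAlternatingMap.ext fun v => ?_
    have h : ∀ x y : CSpace (m + 1), coframe r.castSucc (fun _ => heisForm c y x) -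
        coframe r.castSucc (fun _ => heisForm c x y) = 0 := by
      intro x y
      simp [coframe_apply]
    exact (congrArg _ (hv v)).trans ((d_leftForm_apply c _ g _ _).trans (h _ _))
  · funext g
    refine ContinuousAlternatingMap.ext fun v => ?_
    refine (congrArg _ (hv v)).trans ((d_leftForm_apply c _ g _ _).trans ?_)
    refine (coframe_last_heisForm_sub c g _ _).trans ?_
    let Ω : CSpace (m + 1) [⋀^Fin 2]→L[ℝ] ℂ := ∑ r : Fin m, ((c r : ℚ) : ℂ) •
      wedge (coframe r.castSucc) (conjForm (coframe r.castSucc))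
    refine congrArg (fun w => Ω w) ?_
    funext i
    fin_cases i <;> rfl

end HeisGroup

/-! ### Balanced and strictly locally conformally balanced invariant metrics -/

namespace ComplexNilmanifold

variable {m : ℕ} {c : Fin m → ℚ} {X : ComplexNilmanifold (m + 1)}
  {α : Fin (m + 1) → CSpace (m + 1) [⋀^Fin 1]→L[ℝ] ℂ}

lemma HasStructureEquations.exists_isBalanced (h : X.HasStructureEquations c α) (hm : 2 ≤ m)
    (hpos : ∀ r : Fin m, (r : ℕ) + 1 < m → 0 < c r)
    (hneg : ∀ r : Fin m, (r : ℕ) + 1 = m → c r < 0) :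
    ∃ (g : HermitianMetric (m + 1) X.M) (a : X.LieAlg [⋀^Fin 2]→L[ℝ] ℝ),
      X.IsInducedBy g.fundamentalForm a ∧ g.IsBalanced := by
  obtain ⟨a, ha, hsum⟩ := exists_pos_sum_div_eq_zero hm (fun r => (c r : ℝ))
    (fun r hr => by exact_mod_cast hpos r hr) (fun r hr => by exact_mod_cast hneg r hr)
  have ha' : ∀ k, 0 < Fin.snoc (α := fun _ => ℝ) a 1 k := by
    intro k
    induction k using Fin.lastCases with
    | last => simp
    | cast r => simpa using ha r
  exact ⟨h.1.metric _ ha', coframeForm α _, isInducedBy_comp_mc _ h.1.fundamentalForm_metric,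
    h.isBalanced_metric (by simpa using hsum)⟩

/-- The metric with all weights equal to `1` is strictly locally conformally balanced. -/
lemma HasStructureEquations.exists_strictly_lcb (h : X.HasStructureEquations c α) (hm : 2 ≤ m)
    (hpos : ∀ r : Fin m, (r : ℕ) + 1 < m → 0 < c r)
    (hneg : ∀ r : Fin m, (r : ℕ) + 1 = m → c r < 0) (hsum : ∑ r, c r ≠ 0) :
    ∃ (g : HermitianMetric (m + 1) X.M) (a : X.LieAlg [⋀^Fin 2]→L[ℝ] ℝ)
      (θ : DiffForm (CSpace (m + 1)) X.M ℝ 1) (b : X.LieAlg [⋀^Fin 1]→L[ℝ] ℝ),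
      X.IsInducedBy g.fundamentalForm a ∧
      complexify a = Complex.I • ∑ i, wedge (α i) (conjForm (α i)) ∧
      g.IsLeeForm θ ∧
      X.IsInducedBy θ b ∧
      complexify b = ((∑ r, c r : ℚ) : ℂ) • (α (Fin.last m) + conjForm (α (Fin.last m))) ∧
      θ.IsClosed ∧ ¬ θ.IsExact ∧ g.IsLCB ∧ ¬ g.IsGCB ∧ ¬ g.IsLCK := by
  have ha : ∀ k, 0 < (1 : Fin (m + 1) → ℝ) k := fun _ => one_pos
  have hs : ∑ r, (c r : ℝ) / (1 : Fin (m + 1) → ℝ) r.castSucc = ((∑ r, c r : ℚ) : ℝ) := by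
    simp
  have hs0 : ∑ r, (c r : ℝ) / (1 : Fin (m + 1) → ℝ) r.castSucc ≠ 0 := by
    rw [hs]
    exact_mod_cast hsum
  have hθ : (h.1.metric 1 ha).IsLeeForm (leeForm X α ((∑ r, c r : ℚ) : ℝ)) :=
    h.isLeeForm_metric (by rw [hs, Pi.one_apply, one_mul])
  have hcl := h.isClosed_leeForm ((∑ r, c r : ℚ) : ℝ)
  have hgcb := h.not_isGCB_metric (ha := ha) hs0
  refine ⟨h.1.metric 1 ha, coframeForm α 1, leeForm X α ((∑ r, c r : ℚ) : ℝ),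
    (2 * ((∑ r, c r : ℚ) : ℝ)) • reForm (α (Fin.last m)),
    isInducedBy_comp_mc _ h.1.fundamentalForm_metric, complexify_coframeForm_one, hθ,
    isInducedBy_comp_mc _ fun _ => rfl, ?_, hcl, fun hex => hgcb ⟨_, hθ, hex⟩, ⟨_, hθ, hcl⟩,
    hgcb, h.not_isLCK_metric hm hpos hneg⟩
  refine (complexify_smul_reForm _ _).trans ?_
  rw [Complex.ofReal_ratCast]

end ComplexNilmanifold

end

theorem mainTheorem6 (m : ℕ) (hm : 2 ≤ m) (c : Fin m → ℚ)
    (hpos : ∀ r : Fin m, (r : ℕ) + 1 < m → 0 < c r)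
    (hneg : ∀ r : Fin m, (r : ℕ) + 1 = m → c r < 0)
    (hsum : ∑ r, c r ≠ 0) :
    (∃ (X : ComplexNilmanifold.{0} (m + 1)) (α : Fin (m + 1) → X.LieAlg [⋀^Fin 1]→L[ℝ] ℂ),
      X.IsTwoStep ∧ X.HasStructureEquations c α) ∧
    (∀ (X : ComplexNilmanifold.{u} (m + 1)) (α : Fin (m + 1) → X.LieAlg [⋀^Fin 1]→L[ℝ] ℂ),
      X.HasStructureEquations c α →
        (∃ (h : HermitianMetric (m + 1) X.M) (a : X.LieAlg [⋀^Fin 2]→L[ℝ] ℝ),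
          X.IsInducedBy h.fundamentalForm a ∧ h.IsBalanced) ∧
        (∃ (h : HermitianMetric (m + 1) X.M) (a : X.LieAlg [⋀^Fin 2]→L[ℝ] ℝ)
          (θ : DiffForm (CSpace (m + 1)) X.M ℝ 1) (b : X.LieAlg [⋀^Fin 1]→L[ℝ] ℝ),
          X.IsInducedBy h.fundamentalForm a ∧
          complexify a = Complex.I • ∑ i, wedge (α i) (conjForm (α i)) ∧
          h.IsLeeForm θ ∧
          X.IsInducedBy θ b ∧
          complexify b = ((∑ r, c r : ℚ) : ℂ) • (α (Fin.last m) + conjForm (α (Fin.last m))) ∧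
          θ.IsClosed ∧ ¬ θ.IsExact ∧ h.IsLCB ∧ ¬ h.IsGCB ∧ ¬ h.IsLCK)) ∧
    ¬ (∀ (M : Type) [TopologicalSpace M] [T2Space M] [CompactSpace M] [ConnectedSpace M]
        [ChartedSpace (CSpace (m + 1)) M] [IsManifold 𝓘(ℂ, CSpace (m + 1)) ω M],
        (∃ h₀ : HermitianMetric (m + 1) M, h₀.IsBalanced) →
          ∀ h : HermitianMetric (m + 1) M, h.IsLCB → h.IsGCB) := by
  have hX := HeisGroup.hasStructureEquations_nilmanifold c
  refine ⟨⟨HeisGroup.nilmanifold c, HeisGroup.coframe, ?_, hX⟩,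
    fun X α h => ⟨h.exists_isBalanced hm hpos hneg, h.exists_strictly_lcb hm hpos hneg hsum⟩,
    fun hall => ?_⟩
  · exact HeisGroup.isTwoStep_nilmanifold c (r := ⟨0, by omega⟩)
      (hpos ⟨0, by omega⟩ (by simp; omega)).ne'
  · obtain ⟨g₀, -, -, hg₀⟩ := hX.exists_isBalanced hm hpos hneg
    obtain ⟨g, -, -, -, -, -, -, -, -, -, -, hlcb, hgcb, -⟩ :=
      hX.exists_strictly_lcb hm hpos hneg hsum
    have hT2 : T2Space (HeisGroup.nilmanifold c).M :=
      inferInstanceAs (T2Space (Quotient (MulAction.orbitRel (HeisGroup.lattice c) (HeisGroup c))))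
    have hconn : ConnectedSpace (HeisGroup.nilmanifold c).M :=
      (HeisGroup.mk_surjective (HeisGroup.lattice c)).connectedSpace
        (HeisGroup.isLocalHomeomorph_mk (HeisGroup.lattice c)).continuous
    exact hgcb (hall (HeisGroup.nilmanifold c).M ⟨g₀, hg₀⟩ g hlcb)
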